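/- A spherical curve $P$ is (the image of) a generic immersion $S^1\to S^2$, that is, a smooth immersion whose only multiple points are transverse double points; spherical curves are considered up to isotopy of $S^2$, independently of the parametrization and of the orientation of the curve. Let $c(P)$ be the number of double points of $P$. Orient $P$ and smooth every double point in the way compatible with the orientation (Seifert resolution); the result is a disjoint union of circles, whose number is $s(P)$. Choose an orientation of $P$ and a base point on $P$ that is not a double point. Replace each double point by a negative crossing, and join its two preimages on $S^1$ by an arrow from the preimage on the over-path (tail) to the preimage on the under-path (head). Let $x_u$, $x_l$, $x_r$, $x_b$ be the numbers of pairs of crossing arrows whose four end points, read from the base point along the orientation, are respectively (tail, head, head, tail), (tail, tail, head, head), (head, head, tail, tail), (head, tail, tail, head). Put $x(P)=x_u+x_l+x_r+x_b$, $$\mu(P)=2(x_u-x_l-x_r+x_b)+s(P)-c(P),\qquad \kappa(P)=s(P)-c(P).$$ RI replaces, inside a disk, an embedded arc by an arc with exactly one double point, or conversely. RII replaces, inside a disk, two disjoint arcs by two arcs bounding a bigon, or conversely; it is weak if the two arcs run along the bigon in the same direction. RIII moves, inside a disk, one of three pairwise crossing arcs across the crossing of the other two; it is weak if the triangle formed by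 the three arcs is not coherently oriented. **Theorem.** The numbers $\mu(P)$ and $\kappa(P)$ do not depend on the choice of the base point and the orientation, nor on the choice of $P$ in its isotopy class, and: 1. $\mu$ is invariant under RI and weak RII. Every weak RIII changes $x(P)$, and a weak RIII that increases $x(P)$ changes $\mu(P)$ by $-2$ (so one that decreases $x(P)$ changes it by $+2$). 2. $\kappa$ is invariant under RI and weak RIII. 3. Both invariants are non-trivial: neither $\mu$ nor $\kappa$ is constant on the set of all spherical curves. -/

import Mathlib

open scoped ContDiff

noncomputable section

/-- The ambient space of the unit sphere `S²`. -/
abbrev E3 : Type := EuclideanSpace ℝ (Fin 3)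

/-- The determinant of three vectors. At a point `n` of the unit sphere, tangent vectors `v, w` form
a positively oriented basis (for the outward normal) iff `0 < tripleDet n v w`. -/
def tripleDet (n v w : E3) : ℝ := Matrix.det (Matrix.of ![n.ofLp, v.ofLp, w.ofLp])

/-- Two real parameters represent the same point of the circle `ℝ / ℤ`. -/
def SameParam (s t : ℝ) : Prop := ∃ n : ℤ, t = s + n

/-- A spherical curve, given by a generic immersion of the circle `ℝ / ℤ` into the unit sphere:
a smooth immersion whose only multiple points are transverse double points. -/
structure SphericalCurve where
  toFun : ℝ → E3
  smooth : ContDiff ℝ ∞ toFun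
  periodic : ∀ t, toFun (t + 1) = toFun t
  norm_eq_one : ∀ t, ‖toFun t‖ = 1
  immersion : ∀ t, deriv toFun t ≠ 0
  transverse : ∀ s t, toFun s = toFun t → ¬ SameParam s t →
    LinearIndependent ℝ ![deriv toFun s, deriv toFun t]
  no_triple : ∀ r s t, toFun r = toFun s → toFun s = toFun t →
    SameParam r s ∨ SameParam s t ∨ SameParam r t

namespace SphericalCurve

variable (P : SphericalCurve)

/-- The parameters `s` and `t` are two different preimages of a double point. -/
def IsDoublePair (s t : ℝ) : Prop := P.toFun s = P.toFun t ∧ ¬ SameParam s t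

/-- The point with parameter `t` is a double point. -/
def IsDoubleParam (t : ℝ) : Prop := ∃ s, P.IsDoublePair t s

/-- `c(P)`, the number of double points. -/
def numDouble : ℕ := Set.ncard {x : E3 | ∃ s t, P.IsDoublePair s t ∧ P.toFun s = x}

/-! ### Based arrow diagrams -/

/-- A base point: a point of the curve that is not a double point. -/
def IsBase (b : ℝ) : Prop := ¬ P.IsDoubleParam b

/-- The arrow diagram: the chord of a double point is an arrow from `s` (tail) to `t` (head) when
the double point, replaced by a crossing with over path at `s` and under path at `t`, is a negative
crossing. A crossing is negative when (over velocity, under velocity) is a negatively oriented basis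
of the tangent plane. -/
def IsArrow (s t : ℝ) : Prop :=
  P.IsDoublePair s t ∧ tripleDet (P.toFun s) (deriv P.toFun s) (deriv P.toFun t) < 0

/-- The number of quadruples of parameters `t₁ < t₂ < t₃ < t₄`, met in this order when the circle is
run through once from the base point `b` along the orientation of the curve, that satisfy `τ`. -/
def countSub (b : ℝ) (τ : ℝ → ℝ → ℝ → ℝ → Prop) : ℕ :=
  Set.ncard {q : ℝ × ℝ × ℝ × ℝ | b < q.1 ∧ q.1 < q.2.1 ∧ q.2.1 < q.2.2.1 ∧
    q.2.2.1 < q.2.2.2 ∧ q.2.2.2 < b + 1 ∧ τ q.1 q.2.1 q.2.2.1 q.2.2.2}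

/-- `x_u`: two crossing arrows, read from the base point as tail, head, head, tail. -/
def xu (b : ℝ) : ℕ := countSub b fun t₁ t₂ t₃ t₄ => P.IsArrow t₁ t₃ ∧ P.IsArrow t₄ t₂

/-- `x_l`: two crossing arrows, read from the base point as tail, tail, head, head. -/
def xl (b : ℝ) : ℕ := countSub b fun t₁ t₂ t₃ t₄ => P.IsArrow t₁ t₃ ∧ P.IsArrow t₂ t₄

/-- `x_r`: two crossing arrows, read from the base point as head, head, tail, tail. -/
def xr (b : ℝ) : ℕ := countSub b fun t₁ t₂ t₃ t₄ => P.IsArrow t₃ t₁ ∧ P.IsArrow t₄ t₂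

/-- `x_b`: two crossing arrows, read from the base point as head, tail, tail, head. -/
def xb (b : ℝ) : ℕ := countSub b fun t₁ t₂ t₃ t₄ => P.IsArrow t₃ t₁ ∧ P.IsArrow t₂ t₄

/-- `x = x_u + x_l + x_r + x_b`. -/
def xTotal (b : ℝ) : ℕ := P.xu b + P.xl b + P.xr b + P.xb b

/-! ### Seifert circles -/

/-- Two non-double points of the curve are adjacent after Seifert resolution of all double points:
they are the same point of the circle, or an arc without double points joins them, or the first lies
on the arc arriving at a double point through one branch and the second lies on the arc leaving the
same double point through the other branch. -/
def SeifertAdj (t u : {t : ℝ // ¬ P.IsDoubleParam t}) : Prop :=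
  u.1 = t.1 + 1 ∨
  (t.1 ≤ u.1 ∧ ∀ v ∈ Set.Icc t.1 u.1, ¬ P.IsDoubleParam v) ∨
  ∃ p q, P.IsDoublePair p q ∧
    t.1 < p ∧ (∀ v ∈ Set.Ico t.1 p, ¬ P.IsDoubleParam v) ∧
    q < u.1 ∧ (∀ v ∈ Set.Ioc q u.1, ¬ P.IsDoubleParam v)

/-- `s(P)`, the number of Seifert circles: the number of classes of non-double points under the
equivalence relation generated by adjacency. -/
def numSeifert : ℕ := Nat.card (Quot P.SeifertAdj)

/-- `s(P) - c(P)`. -/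
def kappa : ℤ := (P.numSeifert : ℤ) - P.numDouble

/-- `2 (x_u - x_l - x_r + x_b) + s(P) - c(P)`, computed with the base point `b`. -/
def mu (b : ℝ) : ℤ :=
  2 * ((P.xu b : ℤ) - P.xl b - P.xr b + P.xb b) + P.numSeifert - P.numDouble

end SphericalCurve

/-! ### Isotopy -/

/-- An orientation preserving diffeomorphism of the unit sphere, written through extensions of it
and of its inverse to `ℝ³ ∖ {0}` (for instance the radial ones). -/
structure SphereDiffeo where
  toFun : E3 → E3
  invFun : E3 → E3
  smooth : ContDiffOn ℝ ∞ toFun {0}ᶜ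
  smooth_inv : ContDiffOn ℝ ∞ invFun {0}ᶜ
  norm_eq_one : ∀ x, ‖x‖ = 1 → ‖toFun x‖ = 1
  norm_inv_eq_one : ∀ x, ‖x‖ = 1 → ‖invFun x‖ = 1
  left_inv : ∀ x, ‖x‖ = 1 → invFun (toFun x) = x
  right_inv : ∀ x, ‖x‖ = 1 → toFun (invFun x) = x
  orientation : ∀ x v w, ‖x‖ = 1 → inner ℝ x v = 0 → inner ℝ x w = 0 → 0 < tripleDet x v w →
    0 < tripleDet (toFun x) (fderiv ℝ toFun x v) (fderiv ℝ toFun x w)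

/-- A diffeomorphism of the circle `ℝ / ℤ`, preserving or reversing the orientation, lifted
to `ℝ`. -/
structure CircleReparam where
  toFun : ℝ → ℝ
  smooth : ContDiff ℝ ∞ toFun
  deriv_ne_zero : ∀ t, deriv toFun t ≠ 0
  map_add_one : (∀ t, toFun (t + 1) = toFun t + 1) ∨ (∀ t, toFun (t + 1) = toFun t - 1)

/-- The two generic immersions describe the same spherical curve up to isotopy of the sphere
(with any parametrization and either orientation of the curve). -/
def SphericalCurve.Isotopic (P Q : SphericalCurve) : Prop :=
  ∃ (ψ : SphereDiffeo) (θ : CircleReparam), ∀ t, Q.toFun (θ.toFun t) = ψ.toFun (P.toFun t)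

/-! ### Reidemeister moves -/

/-- A smooth embedding of the plane into the unit sphere. -/
structure SphereChart where
  toFun : ℝ × ℝ → E3
  smooth : ContDiff ℝ ∞ toFun
  norm_eq_one : ∀ x, ‖toFun x‖ = 1
  injective : Function.Injective toFun
  immersion : ∀ x, Function.Injective (fderiv ℝ toFun x)

/-- The square `[-1,1]²`; its image under a chart is the disk in which a move takes place. -/
def closedSquare : Set (ℝ × ℝ) := Set.Icc (-1) 1 ×ˢ Set.Icc (-1) 1

/-- The open square `(-1,1)²`. -/
def openSquare : Set (ℝ × ℝ) := Set.Ioo (-1) 1 ×ˢ Set.Ioo (-1) 1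

/-- In the disk `Φ([-1,1]²)` the curve `P` consists of the `k` strands `Φ ∘ β i` and the curve `P'`
of the `k` strands `Φ ∘ β' i` (parametrized by `[-1,1]`); outside this disk `P` and `P'` agree.
The curves run through the `i`-th strand in the direction of increasing strand parameter
if `ε i = 1`, and in the opposite direction if `ε i = -1`. -/
def IsLocalReplacement (Φ : SphereChart) {k : ℕ} (β β' : Fin k → ℝ → ℝ × ℝ) (ε : Fin k → ℤˣ)
    (P P' : SphericalCurve) : Prop :=
  ∃ (c : Fin k → ℝ) (r : ℝ), 0 < r ∧
    (∀ (i j : Fin k) (n : ℤ), |c i - (c j + n)| ≤ 2 * r → i = j ∧ n = 0) ∧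
    (∀ i, ∀ u ∈ Set.Icc (-1 : ℝ) 1,
      P.toFun (c i + ((ε i : ℤ) : ℝ) * r * u) = Φ.toFun (β i u) ∧
      P'.toFun (c i + ((ε i : ℤ) : ℝ) * r * u) = Φ.toFun (β' i u)) ∧
    (∀ t, (∀ (i : Fin k) (n : ℤ), r ≤ |t - (c i + n)|) → P.toFun t = P'.toFun t) ∧
    (∀ t, (∀ (i : Fin k) (n : ℤ), r < |t - (c i + n)|) → P.toFun t ∉ Φ.toFun '' closedSquare)

/-- A local move RI creating a double point: a strand without double points is replaced by a strand
with exactly one double point. -/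
def LocalRI (P P' : SphericalCurve) : Prop :=
  ∃ (Φ : SphereChart) (ε : Fin 1 → ℤˣ) (β : ℝ → ℝ × ℝ),
    (∀ u ∈ Set.Ioo (-1 : ℝ) 1, β u ∈ openSquare) ∧
    (∃ p ∈ Set.Icc (-1 : ℝ) 1, ∃ q ∈ Set.Icc (-1 : ℝ) 1, p < q ∧
      ∀ u ∈ Set.Icc (-1 : ℝ) 1, ∀ v ∈ Set.Icc (-1 : ℝ) 1,
        u < v → (β u = β v ↔ u = p ∧ v = q)) ∧
    IsLocalReplacement Φ ![fun u => (u, 0)] ![β] ε P P'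

/-- A local weak move RII creating two double points. The first strand is the horizontal axis, the
second one is a graph; at first it lies above the axis, afterwards it meets the axis twice.
The move is weak when the two strands run in the same direction along the bigon, and strong when
they run in opposite directions. -/
def LocalWeakRII (P P' : SphericalCurve) : Prop :=
  ∃ (Φ : SphereChart) (ε : Fin 2 → ℤˣ) (f g : ℝ → ℝ),
    (∀ u ∈ Set.Icc (-1 : ℝ) 1, 0 < f u ∧ f u < 1) ∧
    (∀ u ∈ Set.Icc (-1 : ℝ) 1, -1 < g u ∧ g u < 1) ∧
    (∃ p q : ℝ, p < q ∧ {u ∈ Set.Icc (-1 : ℝ) 1 | g u = 0} = {p, q}) ∧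
    ε 0 = ε 1 ∧
    IsLocalReplacement Φ ![fun u => (u, 0), fun u => (u, f u)]
      ![fun u => (u, 0), fun u => (u, g u)] ε P P'

/-- A local weak move RIII. Two strands are the lines of slope `1/2` and `-1/2` through the origin;
the third one is a graph that crosses each of them once, and that passes below the origin at first
and above it afterwards. The sides of the triangle, on the strands `0, 1, 2`, are coherently
oriented iff `ε 0 = ε 1 = -ε 2`; the move is strong in this case, and weak otherwise. -/
def LocalWeakRIII (P P' : SphericalCurve) : Prop :=
  ∃ (Φ : SphereChart) (ε : Fin 3 → ℤˣ) (f g : ℝ → ℝ),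
    (∀ h ∈ ({f, g} : Set (ℝ → ℝ)),
      (∀ u ∈ Set.Icc (-1 : ℝ) 1, |h u| < 1) ∧ |h (-1)| < 1 / 2 ∧ |h 1| < 1 / 2 ∧
      (∃! u, u ∈ Set.Icc (-1 : ℝ) 1 ∧ h u = u / 2) ∧
      (∃! u, u ∈ Set.Icc (-1 : ℝ) 1 ∧ h u = -(u / 2))) ∧
    f 0 < 0 ∧ 0 < g 0 ∧
    ¬ (ε 0 = ε 1 ∧ ε 2 = -ε 0) ∧
    IsLocalReplacement Φ ![fun u => (u, u / 2), fun u => (u, -(u / 2)), fun u => (u, f u)]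
      ![fun u => (u, u / 2), fun u => (u, -(u / 2)), fun u => (u, g u)] ε P P'

/-- A relation between generic immersions, transported to spherical curves up to isotopy. -/
def UpToIsotopy (M : SphericalCurve → SphericalCurve → Prop) (P P' : SphericalCurve) : Prop :=
  ∃ Q Q' : SphericalCurve, P.Isotopic Q ∧ M Q Q' ∧ Q'.Isotopic P'

/-- The move RI (in the direction that creates a double point). -/
def RI : SphericalCurve → SphericalCurve → Prop := UpToIsotopy LocalRI

/-- The move weak RII (in the direction that creates two double points). -/
def WeakRII : SphericalCurve → SphericalCurve → Prop := UpToIsotopy LocalWeakRII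

/-- The move weak RIII. -/
def WeakRIII : SphericalCurve → SphericalCurve → Prop := UpToIsotopy LocalWeakRIII

end

open Set Filter Topology

/-! Give every chord of the Gauss diagram the sign `sgn` of its crossing, with the two ends read in
their order from the base point. An arrow has its tail first exactly when this sign is -1, so a pair
of interlaced chords is counted in `x_l` or `x_r` if the signs agree and in `x_u` or `x_b` if they
differ. Hence `mu` is -2 times the sum of the products of signs over interlaced pairs (`crossSum`),
plus `s - c`, and `x` is the same sum with all signs replaced by 1.

Base point: when it passes an end of a chord, only the sign of that chord changes, and the chord
contributes its sign times the sum of the signs of the chords interlaced with it. That sum is the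
algebraic number of crossings of the two loops at the double point, which is zero
(`sum_sgn_eq_zero`). In the plane, after stereographic projection, this is a statement on winding
numbers: as a point runs along the second loop, the winding number of the first loop around it jumps
by the sign at every crossing, and it has the same value at both ends, because the second loop
leaves and enters the corner through the same complementary region. Reversal of the curve changes
all chord signs at once, and an orientation preserving diffeomorphism changes none.

Moves: outside the disk of the move nothing changes, and a chord with both ends outside the disk
meets all points of one strand on the same side. So only the new chords matter. RI adds an isolated
chord, one double point and one Seifert circle. Weak RII adds two interlaced chords of opposite sign
whose interactions with all other chords cancel: the cross sum drops by 1, `c` grows by 2 and `s` is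
unchanged. Weak RIII reverses the order of the two chord ends on each of the three strands; both the
plain and the signed cross sum change by the same number 1 or -1, while `s` and `c` are unchanged.

Seifert circles are counted through functions that are constant on them (`SeifertInv`). Such a
function is governed in the disk by equations between the values on the pieces of the strands
(`Resolves`). If the equations before and after the move put the same conditions on the ends of the
strands and determine the middle pieces, the two sets of circles are in bijection
(`numSeifert_eq_of_resolves`).

Non-triviality is seen on a great circle, with `kappa` at least 1, and on a curve with four double
points and at most three Seifert circles; in both cases the signed cross sum vanishes, so `mu =
kappa`. -/

/-! ### Parameters on the circle and the orientation determinant. -/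

theorem SameParam.refl (s : ℝ) : SameParam s s := ⟨0, by simp⟩

theorem SameParam.symm {s t : ℝ} (h : SameParam s t) : SameParam t s := by
  obtain ⟨n, rfl⟩ := h
  exact ⟨-n, by push_cast; ring⟩

theorem SameParam.trans {r s t : ℝ} (h : SameParam r s) (h' : SameParam s t) : SameParam r t := by
  obtain ⟨n, rfl⟩ := h
  obtain ⟨m, rfl⟩ := h'
  exact ⟨n + m, by push_cast; ring⟩

theorem sameParam_add_int (s : ℝ) (n : ℤ) : SameParam s (s + n) := ⟨n, rfl⟩

theorem SameParam.eq_of_abs_sub_lt {s t : ℝ} (h : SameParam s t) (h' : |s - t| < 1) : s = t := by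
  obtain ⟨n, rfl⟩ := h
  have h1 : |(n : ℝ)| < 1 := by simpa using h'
  have h2 : n = 0 := Int.abs_lt_one_iff.1 (by exact_mod_cast h1)
  simp [h2]

/-- The error term of strict differentiability is at most half of `‖f'‖ * ‖p.1 - p.2‖`, too small to
cancel the linear term. -/
theorem HasStrictDerivAt.eventually_injective {E : Type*} [NormedAddCommGroup E] [NormedSpace ℝ E]
    {f : ℝ → E} {f' : E} {x : ℝ} (h : HasStrictDerivAt f f' x) (hf' : f' ≠ 0) :
    ∀ᶠ p : ℝ × ℝ in 𝓝 (x, x), f p.1 = f p.2 → p.1 = p.2 := by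
  have h0 : 0 < ‖f'‖ / 2 := half_pos (norm_pos_iff.2 hf')
  have h1 := h.hasStrictFDerivAt.isLittleO.def h0
  filter_upwards [h1] with p hp he
  by_contra hne
  have h2 : 0 < ‖p.1 - p.2‖ := norm_pos_iff.2 (sub_ne_zero.2 hne)
  have h3 : 0 < ‖f'‖ := norm_pos_iff.2 hf'
  rw [he, sub_self, zero_sub, norm_neg, ContinuousLinearMap.toSpanSingleton_apply, norm_smul] at hp
  nlinarith

theorem tripleDet_eq (n v w : E3) : tripleDet n v w =
    n 0 * (v 1 * w 2 - v 2 * w 1) - n 1 * (v 0 * w 2 - v 2 * w 0) +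
      n 2 * (v 0 * w 1 - v 1 * w 0) := by
  simp [tripleDet, Matrix.det_fin_three]
  ring

theorem tripleDet_swap (n v w : E3) : tripleDet n w v = -tripleDet n v w := by
  simp only [tripleDet_eq]
  ring

theorem tripleDet_smul_smul (n v w : E3) (a b : ℝ) :
    tripleDet n (a • v) (b • w) = a * b * tripleDet n v w := by
  simp only [tripleDet_eq, PiLp.smul_apply, smul_eq_mul]
  ring

theorem inner_E3 (v w : E3) : inner ℝ v w = v 0 * w 0 + v 1 * w 1 + v 2 * w 2 := by
  simp [PiLp.inner_apply, Fin.sum_univ_three, mul_comm]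

/-- In a linear relation between the three vectors the coefficient of `n` vanishes by orthogonality,
and independence of `v, w` kills the other two. -/
theorem tripleDet_ne_zero {n v w : E3} (hn : n ≠ 0) (hv : inner ℝ n v = (0 : ℝ))
    (hw : inner ℝ n w = (0 : ℝ)) (h : LinearIndependent ℝ ![v, w]) : tripleDet n v w ≠ 0 := by
  intro h0
  obtain ⟨a, ha, ha0⟩ := Matrix.exists_vecMul_eq_zero_iff.2 h0
  have h1 : a 0 • n + a 1 • v + a 2 • w = 0 := by
    ext i
    have := congrFun ha0 i
    simpa [Matrix.vecMul, dotProduct, Fin.sum_univ_three] using this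
  have h2 : a 0 = 0 := by
    have := congrArg (fun x => inner ℝ n x) h1
    simp only [inner_add_right, inner_smul_right, hv, hw, inner_zero_right, mul_zero, add_zero,
      mul_eq_zero, inner_self_eq_zero, hn, or_false] at this
    exact this
  rw [h2, zero_smul, zero_add] at h1
  have h3 := LinearIndependent.pair_iff.1 h _ _ h1
  apply ha
  ext i
  fin_cases i
  · exact h2
  · exact h3.1
  · exact h3.2

theorem linearIndependent_of_tripleDet_ne_zero {n v w : E3} (h : tripleDet n v w ≠ 0) :
    LinearIndependent ℝ ![v, w] := by
  rw [LinearIndependent.pair_iff]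
  intro a b hab
  have h0 : ∀ i, a * v i + b * w i = 0 := fun i => by simpa using congrArg (fun x : E3 => x i) hab
  have h1 : a * tripleDet n v w = 0 := by
    rw [tripleDet_eq]
    linear_combination (n 0 * w 2 - n 2 * w 0) * h0 1 + (n 1 * w 0 - n 0 * w 1) * h0 2 +
      (n 2 * w 1 - n 1 * w 2) * h0 0
  have h2 : b * tripleDet n v w = 0 := by
    rw [tripleDet_eq]
    linear_combination -((n 0 * v 2 - n 2 * v 0) * h0 1 + (n 1 * v 0 - n 0 * v 1) * h0 2 +
      (n 2 * v 1 - n 1 * v 2) * h0 0)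
  exact ⟨(mul_eq_zero.1 h1).resolve_right h, (mul_eq_zero.1 h2).resolve_right h⟩

namespace SphericalCurve

variable (P : SphericalCurve)

theorem apply_add_int (t : ℝ) (n : ℤ) : P.toFun (t + n) = P.toFun t := by
  have h : Function.Periodic P.toFun 1 := P.periodic
  simpa using h.int_mul n t

theorem apply_eq_of_sameParam {s t : ℝ} (h : SameParam s t) : P.toFun s = P.toFun t := by
  obtain ⟨n, rfl⟩ := h
  exact (P.apply_add_int s n).symm

theorem deriv_add_int (t : ℝ) (n : ℤ) : deriv P.toFun (t + n) = deriv P.toFun t := by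
  rw [← deriv_comp_add_const]
  congr 1
  ext1 x
  exact P.apply_add_int x n

theorem continuous : Continuous P.toFun := P.smooth.continuous

theorem hasStrictDerivAt (t : ℝ) : HasStrictDerivAt P.toFun (deriv P.toFun t) t :=
  P.smooth.contDiffAt.hasStrictDerivAt (by simp)

theorem hasDerivAt (t : ℝ) : HasDerivAt P.toFun (deriv P.toFun t) t :=
  (P.hasStrictDerivAt t).hasDerivAt

theorem apply_ne_zero (t : ℝ) : P.toFun t ≠ 0 := by
  intro h
  have := P.norm_eq_one t
  simp [h] at this

theorem inner_deriv (t : ℝ) : inner ℝ (P.toFun t) (deriv P.toFun t) = (0 : ℝ) := by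
  have h1 := (P.hasDerivAt t).inner ℝ (P.hasDerivAt t)
  have h2 : (fun t => inner ℝ (P.toFun t) (P.toFun t)) = fun _ => (1 : ℝ) := by
    ext t
    rw [real_inner_self_eq_norm_sq, P.norm_eq_one, one_pow]
  rw [h2] at h1
  have h3 := h1.unique (hasDerivAt_const t (1 : ℝ))
  rw [real_inner_comm (P.toFun t)] at h3
  linarith

variable {P}

theorem IsDoublePair.symm {s t : ℝ} (h : P.IsDoublePair s t) : P.IsDoublePair t s :=
  ⟨h.1.symm, fun h' => h.2 h'.symm⟩

theorem IsDoublePair.of_sameParam {s t s' t' : ℝ} (h : P.IsDoublePair s t) (hs : SameParam s s')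
    (ht : SameParam t t') : P.IsDoublePair s' t' :=
  ⟨by rw [← P.apply_eq_of_sameParam hs, ← P.apply_eq_of_sameParam ht, h.1],
    fun h' => h.2 ((hs.trans h').trans ht.symm)⟩

theorem isDoublePair_iff_of_sameParam {s t s' t' : ℝ} (hs : SameParam s s')
    (ht : SameParam t t') : P.IsDoublePair s t ↔ P.IsDoublePair s' t' :=
  ⟨fun h => h.of_sameParam hs ht, fun h => h.of_sameParam hs.symm ht.symm⟩

theorem isDoubleParam_iff_of_sameParam {s t : ℝ} (h : SameParam s t) :
    P.IsDoubleParam s ↔ P.IsDoubleParam t :=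
  exists_congr fun u => isDoublePair_iff_of_sameParam h (SameParam.refl u)

theorem isDoubleParam_add_int {t : ℝ} (n : ℤ) : P.IsDoubleParam (t + n) ↔ P.IsDoubleParam t :=
  (isDoubleParam_iff_of_sameParam (sameParam_add_int t n)).symm

theorem isDoubleParam_add_one {t : ℝ} : P.IsDoubleParam (t + 1) ↔ P.IsDoubleParam t := by
  simpa using isDoubleParam_add_int (P := P) (t := t) 1

theorem IsDoublePair.left {s t : ℝ} (h : P.IsDoublePair s t) : P.IsDoubleParam s := ⟨t, h⟩

theorem IsDoublePair.right {s t : ℝ} (h : P.IsDoublePair s t) : P.IsDoubleParam t := ⟨s, h.symm⟩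

/-- The second preimage of a double point is unique. -/
theorem IsDoublePair.sameParam_of_left {s t u : ℝ} (h : P.IsDoublePair s t)
    (h' : P.IsDoublePair s u) : SameParam t u := by
  rcases P.no_triple t s u h.1.symm h'.1 with h1 | h1 | h1
  · exact absurd h1.symm h.2
  · exact absurd h1 h'.2
  · exact h1

theorem IsDoublePair.tripleDet_ne_zero {s t : ℝ} (h : P.IsDoublePair s t) :
    tripleDet (P.toFun s) (deriv P.toFun s) (deriv P.toFun t) ≠ 0 :=
  _root_.tripleDet_ne_zero (P.apply_ne_zero s) (P.inner_deriv s) (by rw [h.1]; exact P.inner_deriv t)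
    (P.transverse s t h.1 h.2)

variable (P)

/-! ### Finiteness of the set of double points. -/

/-- Double pairs are isolated in the parameter plane. At a pair of equal circle points this is local
injectivity of an immersion; at a double pair it is transversality, which makes the derivative of `P
u - P v` injective; elsewhere continuity suffices. -/
theorem eventually_not_isDoublePair (x : ℝ × ℝ) :
    ∀ᶠ y in 𝓝[≠] x, ¬ P.IsDoublePair y.1 y.2 := by
  obtain ⟨s, t⟩ := x
  by_cases hst : P.toFun s = P.toFun t
  · by_cases hp : SameParam s t
    · obtain ⟨n, rfl⟩ := hp
      have h1 := (P.hasStrictDerivAt s).eventually_injective (P.immersion s)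
      have h2 : Tendsto (fun p : ℝ × ℝ => (p.1, p.2 - n)) (𝓝 (s, s + n)) (𝓝 (s, s)) := by
        have : Continuous (fun p : ℝ × ℝ => (p.1, p.2 - (n : ℝ))) := by fun_prop
        simpa using this.tendsto (s, s + n)
      refine ((h2.eventually h1).filter_mono nhdsWithin_le_nhds).mono ?_
      rintro ⟨u, v⟩ h ⟨h3, h4⟩
      have h5 : P.toFun (v - n) = P.toFun v := by
        simpa using (P.apply_add_int (v - n) n).symm
      have h6 : u = v - n := h (h3.trans h5.symm)
      exact h4 ⟨n, by simp [h6]⟩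
    · have hG : HasFDerivAt (fun p : ℝ × ℝ => P.toFun p.1 - P.toFun p.2)
          ((((ContinuousLinearMap.toSpanSingleton ℝ (deriv P.toFun s)).comp
            (ContinuousLinearMap.fst ℝ ℝ ℝ))) -
            ((ContinuousLinearMap.toSpanSingleton ℝ (deriv P.toFun t)).comp
            (ContinuousLinearMap.snd ℝ ℝ ℝ))) (s, t) :=
        ((P.hasDerivAt s).hasFDerivAt.comp (s, t) hasFDerivAt_fst).sub
          ((P.hasDerivAt t).hasFDerivAt.comp (s, t) hasFDerivAt_snd)
      have hker : LinearMap.ker ((((ContinuousLinearMap.toSpanSingleton ℝ (deriv P.toFun s)).comp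
            (ContinuousLinearMap.fst ℝ ℝ ℝ))) -
            ((ContinuousLinearMap.toSpanSingleton ℝ (deriv P.toFun t)).comp
            (ContinuousLinearMap.snd ℝ ℝ ℝ)) : ℝ × ℝ →L[ℝ] E3).toLinearMap = ⊥ := by
        rw [LinearMap.ker_eq_bot']
        rintro ⟨a, b⟩ hab
        have hab' : a • deriv P.toFun s + (-b) • deriv P.toFun t = 0 := by
          simpa [sub_eq_add_neg] using hab
        have := LinearIndependent.pair_iff.1 (P.transverse s t hst hp) _ _ hab'
        ext
        · exact this.1
        · simpa using this.2
      obtain ⟨K, -, hK⟩ := LinearMap.exists_antilipschitzWith _ hker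
      filter_upwards [hG.eventually_ne (c := 0) ⟨K, hK⟩] with y hy h
      exact hy (sub_eq_zero.2 h.1)
  · have h1 : ∀ᶠ y : ℝ × ℝ in 𝓝 (s, t), P.toFun y.1 - P.toFun y.2 ≠ 0 := by
      have : Continuous fun y : ℝ × ℝ => P.toFun y.1 - P.toFun y.2 := by
        have := P.continuous
        fun_prop
      exact this.continuousAt.eventually_ne (sub_ne_zero.2 hst)
    filter_upwards [h1.filter_mono nhdsWithin_le_nhds] with y hy h
    exact hy (sub_eq_zero.2 h.1)

theorem finite_isDoublePair (K : Set (ℝ × ℝ)) (hK : IsCompact K) :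
    {p ∈ K | P.IsDoublePair p.1 p.2}.Finite := by
  by_contra h
  obtain ⟨x, -, hx⟩ := Set.Infinite.exists_accPt_of_subset_isCompact h hK (sep_subset _ _)
  rw [accPt_iff_frequently_nhdsNE] at hx
  obtain ⟨y, hy, hy'⟩ := (hx.and_eventually (P.eventually_not_isDoublePair x)).exists
  exact hy' hy.2

theorem finite_isDoubleParam (a b : ℝ) : {t ∈ Icc a b | P.IsDoubleParam t}.Finite := by
  refine ((P.finite_isDoublePair (Icc a b ×ˢ Icc 0 1) (isCompact_Icc.prod isCompact_Icc)).image
    Prod.fst).subset ?_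
  rintro t ⟨ht, s, hs⟩
  -- The second preimage is moved into the unit interval to obtain a compact range.
  refine ⟨(t, Int.fract s), ⟨⟨ht, Int.fract_nonneg s, (Int.fract_lt_one s).le⟩, ?_⟩, rfl⟩
  exact hs.of_sameParam (SameParam.refl t) ⟨-⌊s⌋, by rw [← Int.self_sub_floor]; push_cast; ring⟩

theorem eventually_not_isDoubleParam (x : ℝ) : ∀ᶠ y in 𝓝[≠] x, ¬ P.IsDoubleParam y := by
  have h1 : ∀ᶠ y in 𝓝 x, y ∉ {t ∈ Icc (x - 1) (x + 1) | P.IsDoubleParam t} \ {x} :=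
    ((P.finite_isDoubleParam (x - 1) (x + 1)).subset sdiff_subset).isClosed.isOpen_compl.mem_nhds
      (by simp)
  have h2 : ∀ᶠ y in 𝓝 x, y ∈ Icc (x - 1) (x + 1) := Icc_mem_nhds (by simp) (by simp)
  filter_upwards [h1.filter_mono nhdsWithin_le_nhds, h2.filter_mono nhdsWithin_le_nhds,
    self_mem_nhdsWithin] with y h3 h4 h5 h6
  exact h3 ⟨⟨h4, h6⟩, h5⟩

theorem eventually_not_isDoubleParam_of_not {x : ℝ} (hx : ¬ P.IsDoubleParam x) :
    ∀ᶠ y in 𝓝 x, ¬ P.IsDoubleParam y := by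
  rw [← nhdsNE_sup_pure x, eventually_sup]
  exact ⟨P.eventually_not_isDoubleParam x, by simpa using hx⟩

theorem exists_isBase_mem_Ioo {a b : ℝ} (h : a < b) : ∃ t ∈ Ioo a b, P.IsBase t := by
  have h1 : ∀ᶠ y in 𝓝[>] a, P.IsBase y :=
    (P.eventually_not_isDoubleParam a).filter_mono (nhdsWithin_mono _ fun y hy => ne_of_gt hy)
  obtain ⟨t, h2, h3⟩ := (h1.and (Ioo_mem_nhdsGT h)).exists
  exact ⟨t, h3, h2⟩

theorem exists_isBase : ∃ t, P.IsBase t :=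
  let ⟨t, _, ht⟩ := P.exists_isBase_mem_Ioo zero_lt_one
  ⟨t, ht⟩

/-! ### Chords -/

/-- The sign of a crossing with given preimages, in this order. -/
noncomputable def sgn (s t : ℝ) : ℤ :=
  if tripleDet (P.toFun s) (deriv P.toFun s) (deriv P.toFun t) < 0 then -1 else 1

theorem sgn_eq_one_or (s t : ℝ) : P.sgn s t = 1 ∨ P.sgn s t = -1 := by
  unfold sgn
  split_ifs <;> simp

theorem sgn_mul_self (s t : ℝ) : P.sgn s t * P.sgn s t = 1 := by
  rcases P.sgn_eq_one_or s t with h | h <;> simp [h]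

variable {P}

theorem IsDoublePair.sgn_swap {s t : ℝ} (h : P.IsDoublePair s t) : P.sgn t s = -P.sgn s t := by
  have h0 := h.tripleDet_ne_zero
  unfold sgn
  rw [← h.1, tripleDet_swap]
  rcases lt_or_gt_of_ne h0 with h1 | h1
  · rw [if_neg (by linarith), if_pos h1]; rfl
  · rw [if_pos (by linarith), if_neg (by linarith)]

theorem IsDoublePair.isArrow_iff {s t : ℝ} (h : P.IsDoublePair s t) :
    P.IsArrow s t ↔ P.sgn s t = -1 := by
  unfold IsArrow sgn
  split_ifs with h1
  · simp [h, h1]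
  · simp [h1]

theorem IsDoublePair.isArrow_swap_iff {s t : ℝ} (h : P.IsDoublePair s t) :
    P.IsArrow t s ↔ P.sgn s t = 1 := by
  rw [h.symm.isArrow_iff, h.sgn_swap]
  omega

theorem IsDoublePair.of_lt {b s t : ℝ} (h1 : b < s) (h2 : s < t) (h3 : t < b + 1)
    (h : P.toFun s = P.toFun t) : P.IsDoublePair s t :=
  ⟨h, fun h' => h2.ne (h'.eq_of_abs_sub_lt (by rw [abs_lt]; constructor <;> linarith))⟩

variable (P)

theorem finite_chords (b : ℝ) :
    {p : ℝ × ℝ | b < p.1 ∧ p.1 < p.2 ∧ p.2 < b + 1 ∧ P.toFun p.1 = P.toFun p.2}.Finite := by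
  refine (P.finite_isDoublePair (Icc b (b + 1) ×ˢ Icc b (b + 1))
    (isCompact_Icc.prod isCompact_Icc)).subset ?_
  rintro ⟨s, t⟩ ⟨h1, h2, h3, h4⟩
  simp only at h1 h2 h3 h4
  exact ⟨⟨⟨h1.le, by linarith⟩, ⟨by linarith, h3.le⟩⟩, IsDoublePair.of_lt h1 h2 h3 h4⟩

/-- The chords of the Gauss diagram, as pairs of parameters following the base point `b`. -/
noncomputable def chords (b : ℝ) : Finset (ℝ × ℝ) := (P.finite_chords b).toFinset

variable {P}

theorem mem_chords {b : ℝ} {p : ℝ × ℝ} : p ∈ P.chords b ↔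
    b < p.1 ∧ p.1 < p.2 ∧ p.2 < b + 1 ∧ P.toFun p.1 = P.toFun p.2 := by
  simp [chords]

theorem mem_chords_iff_isDoublePair {b : ℝ} {p : ℝ × ℝ} : p ∈ P.chords b ↔
    b < p.1 ∧ p.1 < p.2 ∧ p.2 < b + 1 ∧ P.IsDoublePair p.1 p.2 := by
  rw [mem_chords]
  exact ⟨fun ⟨h1, h2, h3, h4⟩ => ⟨h1, h2, h3, .of_lt h1 h2 h3 h4⟩,
    fun ⟨h1, h2, h3, h4⟩ => ⟨h1, h2, h3, h4.1⟩⟩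

theorem isDoublePair_of_mem_chords {b : ℝ} {p : ℝ × ℝ} (h : p ∈ P.chords b) :
    P.IsDoublePair p.1 p.2 := (mem_chords_iff_isDoublePair.1 h).2.2.2

theorem exists_sameParam_mem_Ico (b t : ℝ) : ∃ t' ∈ Ico b (b + 1), SameParam t t' := by
  obtain ⟨n, hn, -⟩ := existsUnique_add_zsmul_mem_Ico one_pos t b
  exact ⟨t + n, by simpa using hn, n, rfl⟩

theorem IsBase.exists_sameParam_mem_Ioo {b t : ℝ} (hb : P.IsBase b) (ht : P.IsDoubleParam t) :
    ∃ t' ∈ Ioo b (b + 1), SameParam t t' := by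
  obtain ⟨t', h1, h2⟩ := exists_sameParam_mem_Ico b t
  refine ⟨t', ⟨lt_of_le_of_ne h1.1 ?_, h1.2⟩, h2⟩
  rintro rfl
  exact hb ((isDoubleParam_iff_of_sameParam h2).1 ht)

/-- A double point has two preimages in the open period after the base point, and exactly one way to
put them in increasing order. -/
theorem numDouble_eq_card_chords {b : ℝ} (hb : P.IsBase b) :
    P.numDouble = (P.chords b).card := by
  unfold numDouble
  rw [← Set.ncard_coe_finset]
  symm
  refine Set.ncard_congr (fun p _ => P.toFun p.1) ?_ ?_ ?_
  · intro p hp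
    exact ⟨p.1, p.2, isDoublePair_of_mem_chords hp, rfl⟩
  · rintro ⟨s, t⟩ ⟨s', t'⟩ hp hp' h
    simp only at h
    have h1 := mem_chords_iff_isDoublePair.1 (Finset.mem_coe.1 hp)
    have h2 := mem_chords_iff_isDoublePair.1 (Finset.mem_coe.1 hp')
    simp only at h1 h2
    have key : ∀ u v, b < u → u < b + 1 → b < v → v < b + 1 → SameParam u v → u = v := by
      intro u v _ _ _ _ h
      exact h.eq_of_abs_sub_lt (by rw [abs_lt]; constructor <;> linarith)
    by_cases hs : SameParam s s'
    · have e1 := key s s' h1.1 (by linarith) h2.1 (by linarith) hs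
      subst e1
      have e2 := key t t' (by linarith) (by linarith) (by linarith) (by linarith)
        (h1.2.2.2.sameParam_of_left h2.2.2.2)
      rw [e2]
    · have h3 : P.IsDoublePair s s' := ⟨h, hs⟩
      have h4 : P.IsDoublePair s' s := h3.symm
      have e1 := key t s' (by linarith) (by linarith) (by linarith) (by linarith)
        (h1.2.2.2.sameParam_of_left h3)
      have e2 := key t' s (by linarith) (by linarith) (by linarith) (by linarith)
        (h2.2.2.2.sameParam_of_left h4)
      linarith
  · rintro x ⟨s, t, hst, rfl⟩
    obtain ⟨s', hs', h1⟩ := hb.exists_sameParam_mem_Ioo hst.left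
    obtain ⟨t', ht', h2⟩ := hb.exists_sameParam_mem_Ioo hst.right
    have h3 := hst.of_sameParam h1 h2
    rcases lt_trichotomy s' t' with h4 | h4 | h4
    · exact ⟨(s', t'), Finset.mem_coe.2 (mem_chords.2 ⟨hs'.1, h4, ht'.2, h3.1⟩),
        (P.apply_eq_of_sameParam h1).symm⟩
    · exact absurd (h4 ▸ SameParam.refl _) h3.2
    · exact ⟨(t', s'), Finset.mem_coe.2 (mem_chords.2 ⟨ht'.1, h4, hs'.2, h3.1.symm⟩),
        ((P.apply_eq_of_sameParam h1).trans h3.1).symm⟩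

end SphericalCurve

/-! ### The invariants as sums over interlaced chords. -/

/-- The endpoints of the chords `c` and `d` alternate, starting with `c`. -/
def Interlaced (c d : ℝ × ℝ) : Prop := c.1 < d.1 ∧ d.1 < c.2 ∧ c.2 < d.2

open Classical in
/-- The sum of `f c * f d` over the pairs of interlaced chords `c ∈ S`, `d ∈ T`. -/
noncomputable def crossSum (S T : Finset (ℝ × ℝ)) (f : ℝ × ℝ → ℤ) : ℤ :=
  ∑ c ∈ S, ∑ d ∈ T, if Interlaced c d then f c * f d else 0

namespace SphericalCurve

variable {P : SphericalCurve}

/-- The sign of a chord. -/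
noncomputable def chordSgn (P : SphericalCurve) (c : ℝ × ℝ) : ℤ := P.sgn c.1 c.2

-- An increasing quadruple is the same as an interlaced pair of chords, by taking its first and
-- third and its second and fourth entries.
open Classical in
theorem countSub_eq {b : ℝ} {A B : ℝ → ℝ → Prop} (hA : ∀ s t, A s t → P.toFun s = P.toFun t)
    (hB : ∀ s t, B s t → P.toFun s = P.toFun t) :
    (countSub b (fun t₁ t₂ t₃ t₄ => A t₁ t₃ ∧ B t₂ t₄) : ℤ) =
      ∑ c ∈ P.chords b, ∑ d ∈ P.chords b,
        if Interlaced c d ∧ A c.1 c.2 ∧ B d.1 d.2 then 1 else 0 := by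
  rw [← Finset.sum_product' (f := fun c d => if Interlaced c d ∧ A c.1 c.2 ∧ B d.1 d.2 then (1 : ℤ)
    else 0), Finset.sum_boole, Nat.cast_inj, ← Set.ncard_coe_finset]
  refine Set.ncard_congr (fun q _ => ((q.1, q.2.2.1), (q.2.1, q.2.2.2))) ?_ ?_ ?_
  · rintro ⟨t₁, t₂, t₃, t₄⟩ ⟨h1, h2, h3, h4, h5, h6, h7⟩
    simp only at h1 h2 h3 h4 h5 h6 h7
    simp only [Finset.coe_filter, Finset.mem_product, mem_chords, Set.mem_ofPred_eq]
    exact ⟨⟨⟨h1, by linarith, by linarith, hA _ _ h6⟩, by linarith, by linarith, h5, hB _ _ h7⟩,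
      ⟨h2, h3, h4⟩, h6, h7⟩
  · rintro ⟨t₁, t₂, t₃, t₄⟩ ⟨u₁, u₂, u₃, u₄⟩ _ _ h
    simp only [Prod.mk.injEq] at h ⊢
    tauto
  · rintro ⟨⟨t₁, t₃⟩, ⟨t₂, t₄⟩⟩ h
    simp only [Finset.coe_filter, Finset.mem_product, mem_chords, Set.mem_ofPred_eq] at h
    obtain ⟨⟨⟨h1, h2, h3, h4⟩, h5, h6, h7, h8⟩, ⟨h9, h10, h11⟩, h12, h13⟩ := h
    exact ⟨(t₁, t₂, t₃, t₄), ⟨h1, h9, h10, h11, h7, h12, h13⟩, rfl⟩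

theorem IsArrow.apply_eq {s t : ℝ} (h : P.IsArrow s t) : P.toFun s = P.toFun t := h.1.1

/-- Every chord is an arrow in exactly one direction, so every interlaced pair shows exactly one of
the four patterns. -/
theorem xTotal_eq (b : ℝ) : (P.xTotal b : ℤ) = crossSum (P.chords b) (P.chords b) fun _ => 1 := by
  classical
  unfold xTotal xu xl xr xb crossSum
  push_cast
  rw [countSub_eq (A := fun s t => P.IsArrow s t) (B := fun s t => P.IsArrow t s)
      (fun _ _ h => h.apply_eq) (fun _ _ h => h.apply_eq.symm),
    countSub_eq (A := fun s t => P.IsArrow s t) (B := fun s t => P.IsArrow s t)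
      (fun _ _ h => h.apply_eq) (fun _ _ h => h.apply_eq),
    countSub_eq (A := fun s t => P.IsArrow t s) (B := fun s t => P.IsArrow t s)
      (fun _ _ h => h.apply_eq.symm) (fun _ _ h => h.apply_eq.symm),
    countSub_eq (A := fun s t => P.IsArrow t s) (B := fun s t => P.IsArrow s t)
      (fun _ _ h => h.apply_eq.symm) (fun _ _ h => h.apply_eq)]
  simp only [← Finset.sum_add_distrib]
  refine Finset.sum_congr rfl fun c hc => Finset.sum_congr rfl fun d hd => ?_
  have hc := isDoublePair_of_mem_chords hc
  have hd := isDoublePair_of_mem_chords hd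
  simp only [hc.isArrow_iff, hc.isArrow_swap_iff, hd.isArrow_iff, hd.isArrow_swap_iff]
  by_cases h : Interlaced c d
  · rcases P.sgn_eq_one_or c.1 c.2 with h1 | h1 <;> rcases P.sgn_eq_one_or d.1 d.2 with h2 | h2 <;>
      simp [h, h1, h2]
  · simp [h]

/-- The tail comes first exactly on chords of sign -1. Patterns `l` and `r` therefore have sign
product 1 and patterns `u` and `b` have sign product -1, the negatives of their coefficients in
`mu`. -/
theorem mu_eq (b : ℝ) : P.mu b =
    -2 * crossSum (P.chords b) (P.chords b) P.chordSgn + P.numSeifert - P.numDouble := by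
  classical
  have key : (P.xu b : ℤ) - P.xl b - P.xr b + P.xb b =
      -crossSum (P.chords b) (P.chords b) P.chordSgn := by
    unfold xu xl xr xb crossSum
    rw [countSub_eq (A := fun s t => P.IsArrow s t) (B := fun s t => P.IsArrow t s)
        (fun _ _ h => h.apply_eq) (fun _ _ h => h.apply_eq.symm),
      countSub_eq (A := fun s t => P.IsArrow s t) (B := fun s t => P.IsArrow s t)
        (fun _ _ h => h.apply_eq) (fun _ _ h => h.apply_eq),
      countSub_eq (A := fun s t => P.IsArrow t s) (B := fun s t => P.IsArrow t s)
        (fun _ _ h => h.apply_eq.symm) (fun _ _ h => h.apply_eq.symm),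
      countSub_eq (A := fun s t => P.IsArrow t s) (B := fun s t => P.IsArrow s t)
        (fun _ _ h => h.apply_eq.symm) (fun _ _ h => h.apply_eq)]
    simp only [← Finset.sum_add_distrib, ← Finset.sum_sub_distrib, ← Finset.sum_neg_distrib]
    refine Finset.sum_congr rfl fun c hc => Finset.sum_congr rfl fun d hd => ?_
    have hc := isDoublePair_of_mem_chords hc
    have hd := isDoublePair_of_mem_chords hd
    simp only [hc.isArrow_iff, hc.isArrow_swap_iff, hd.isArrow_iff, hd.isArrow_swap_iff, chordSgn]
    by_cases h : Interlaced c d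
    · rcases P.sgn_eq_one_or c.1 c.2 with h1 | h1 <;>
        rcases P.sgn_eq_one_or d.1 d.2 with h2 | h2 <;> simp [h, h1, h2]
    · simp [h]
  unfold mu
  rw [key]
  ring

end SphericalCurve

/-! ### Locally constant functions and their jumps. -/

/-- A function that is constant on a punctured neighbourhood of every point is, near every point,
equal to the same constant. -/
theorem exists_eventually_eq_of_punctured {α : Type*} {f : ℝ → α}
    (h : ∀ x, ∃ a, ∀ᶠ y in 𝓝[≠] x, f y = a) : ∃ a, ∀ x, ∀ᶠ y in 𝓝[≠] x, f y = a := by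
  choose H hH using h
  -- `H x` is the value near, but not necessarily at, `x`; two nearby choices are compared at a
  -- third point close to both.
  have h1 : IsLocallyConstant H := by
    rw [IsLocallyConstant.iff_eventually_eq]
    intro x
    have h2 := eventually_nhdsWithin_iff.1 (hH x)
    filter_upwards [h2.eventually_nhds] with y hy
    rcases eq_or_ne y x with rfl | hyx
    · rfl
    · obtain ⟨z, ⟨h3, h4⟩, h5⟩ := (((hy.filter_mono nhdsWithin_le_nhds).and (hH y)).and
        ((eventually_ne_nhds hyx).filter_mono nhdsWithin_le_nhds)).exists
      rw [← h4, h3 h5]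
  refine ⟨H 0, fun x => ?_⟩
  rw [← h1.apply_eq_of_isPreconnected isPreconnected_univ (mem_univ x) (mem_univ 0)]
  exact hH x

/-- Subtracting the step function with the given jumps leaves a function that is constant up to
isolated points; its values near the two infinities differ by the total jump. -/
theorem sum_jumps_eq_zero {ι : Type*} (F : Finset ι) (x : ι → ℝ) (j : ι → ℂ) (f : ℝ → ℂ) (w₀ : ℂ)
    (h : ∀ y, ∃ a, (∀ᶠ v in 𝓝[<] y, f v = a) ∧
      ∀ᶠ v in 𝓝[>] y, f v = a + ∑ i ∈ F with x i = y, j i)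
    (hbot : ∀ᶠ v in atBot, f v = w₀) (htop : ∀ᶠ v in atTop, f v = w₀) : ∑ i ∈ F, j i = 0 := by
  set k : ℝ → ℂ := fun v => ∑ i ∈ F, if x i < v then j i else 0 with hk
  have h1 : ∀ y, ∃ a, ∀ᶠ v in 𝓝[≠] y, f v - k v = a := by
    intro y
    obtain ⟨a, ha1, ha2⟩ := h y
    refine ⟨a - k y, ?_⟩
    rw [← Iio_union_Ioi, nhdsWithin_union, eventually_sup]
    constructor
    · have h2 : ∀ᶠ v in 𝓝[<] y, ∀ i ∈ F, (x i < v ↔ x i < y) := by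
        rw [Filter.eventually_all_finset]
        intro i _
        by_cases hi : x i < y
        · filter_upwards [Ioo_mem_nhdsLT hi] with v hv
          simp [hi, hv.1]
        · filter_upwards [self_mem_nhdsWithin] with v hv
          simp only [hi, iff_false, not_lt]
          exact le_trans (le_of_lt hv) (not_lt.1 hi)
      filter_upwards [ha1, h2] with v h3 h4
      rw [h3]
      congr 1
      exact Finset.sum_congr rfl fun i hi => by simp [h4 i hi]
    · have h2 : ∀ᶠ v in 𝓝[>] y, ∀ i ∈ F, (x i < v ↔ x i ≤ y) := by
        rw [Filter.eventually_all_finset]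
        intro i _
        by_cases hi : x i ≤ y
        · filter_upwards [self_mem_nhdsWithin] with v hv
          simp only [hi, iff_true]
          exact lt_of_le_of_lt hi hv
        · filter_upwards [Ioo_mem_nhdsGT (not_le.1 hi)] with v hv
          simp only [hi, iff_false, not_lt]
          exact hv.2.le
      filter_upwards [ha2, h2] with v h3 h4
      rw [h3]
      have h5 : k v = k y + ∑ i ∈ F with x i = y, j i := by
        simp only [hk]
        rw [Finset.sum_filter, ← Finset.sum_add_distrib]
        refine Finset.sum_congr rfl fun i hi => ?_
        simp only [h4 i hi]
        rcases lt_trichotomy (x i) y with h | h | h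
        · simp [h.le, h, h.ne]
        · simp [h]
        · simp [h.not_ge, h.not_gt, h.ne']
      rw [h5]
      ring
  obtain ⟨a, ha⟩ := exists_eventually_eq_of_punctured h1
  have h2 : ∀ᶠ v in atBot, ∀ i ∈ F, v ≤ x i := by
    rw [Filter.eventually_all_finset]
    exact fun i _ => eventually_le_atBot _
  have h3 : ∀ᶠ v in atTop, ∀ i ∈ F, x i < v := by
    rw [Filter.eventually_all_finset]
    exact fun i _ => eventually_gt_atTop _
  have e1 : a = w₀ := by
    obtain ⟨c, hc⟩ := eventually_atBot.1 (hbot.and h2)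
    obtain ⟨v, hv, hv'⟩ := ((ha (c - 1)).and ((eventually_lt_nhds (b := c)
      (by linarith)).filter_mono nhdsWithin_le_nhds)).exists
    obtain ⟨h4, h5⟩ := hc v hv'.le
    have h6 : k v = 0 := Finset.sum_eq_zero fun i hi => if_neg (h5 i hi).not_gt
    rw [h4, h6, sub_zero] at hv
    exact hv.symm
  have e2 : a = w₀ - ∑ i ∈ F, j i := by
    obtain ⟨c, hc⟩ := eventually_atTop.1 (htop.and h3)
    obtain ⟨v, hv, hv'⟩ := ((ha (c + 1)).and ((eventually_gt_nhds (b := c)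
      (by linarith)).filter_mono nhdsWithin_le_nhds)).exists
    obtain ⟨h4, h5⟩ := hc v hv'.le
    have h6 : k v = ∑ i ∈ F, j i := Finset.sum_congr rfl fun i hi => if_pos (h5 i hi)
    rw [h4, h6] at hv
    exact hv.symm
  rw [e1] at e2
  linear_combination e2

/-! ### The winding integral -/

/-- The integral of `dz / (z - w)` along the curve `z` over `[p, q]`. -/
noncomputable def windInt (z : ℝ → ℂ) (p q : ℝ) (w : ℂ) : ℂ := ∫ u in p..q, deriv z u / (z u - w)

/-- The solutions of `exp W = 1` have mutual distance at least `2π`, so a convergent family of them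
is eventually constant. -/
theorem eventually_eq_of_tendsto_exp_eq_one {α : Type*} {l : Filter α} [l.NeBot] {W : α → ℂ} {ℓ : ℂ}
    (h : Tendsto W l (𝓝 ℓ)) (h' : ∀ᶠ v in l, Complex.exp (W v) = 1) : ∀ᶠ v in l, W v = ℓ := by
  have h1 : Complex.exp ℓ = 1 :=
    tendsto_nhds_unique ((Complex.continuous_exp.tendsto ℓ).comp h)
      (tendsto_const_nhds.congr' (h'.mono fun v hv => hv.symm))
  have h2 : ∀ᶠ v in l, ‖W v - ℓ‖ < 2 * Real.pi := by
    have := (tendsto_iff_norm_sub_tendsto_zero.1 h).eventually_lt_const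
      (u := 2 * Real.pi) (by positivity)
    exact this
  filter_upwards [h', h2] with v h3 h4
  have h5 : Complex.exp (W v - ℓ) = 1 := by rw [Complex.exp_sub, h3, h1, div_one]
  obtain ⟨n, hn⟩ := Complex.exp_eq_one_iff.1 h5
  rw [hn] at h4
  have h6 : |(n : ℝ)| < 1 := by
    have h7 : ‖(n : ℂ) * (2 * Real.pi * Complex.I)‖ = |(n : ℝ)| * (2 * Real.pi) := by
      simp [abs_of_pos Real.pi_pos]
    rw [h7] at h4
    have := Real.two_pi_pos
    nlinarith
  have h8 : n = 0 := Int.abs_lt_one_iff.1 (by exact_mod_cast h6)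
  rw [h8] at hn
  simpa [sub_eq_zero] using hn

section

variable {z : ℝ → ℂ} (hz : ContDiff ℝ 1 z)
include hz

theorem hasDerivAt_of_contDiff_one (u : ℝ) : HasDerivAt z (deriv z u) u :=
  (hz.differentiable (by simp) u).hasDerivAt

theorem continuousOn_windInt_integrand {K : Set ℝ} {w : ℂ} (h : ∀ u ∈ K, z u ≠ w) :
    ContinuousOn (fun u => deriv z u / (z u - w)) K :=
  (hz.continuous_deriv le_rfl).continuousOn.div (hz.continuous.sub continuous_const).continuousOn
    fun u hu => sub_ne_zero.2 (h u hu)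

theorem windInt_add {p q r : ℝ} (hpq : p ≤ q) (hqr : q ≤ r) {w : ℂ}
    (h : ∀ u ∈ Icc p r, z u ≠ w) : windInt z p r w = windInt z p q w + windInt z q r w := by
  unfold windInt
  rw [intervalIntegral.integral_add_adjacent_intervals]
  · refine ContinuousOn.intervalIntegrable_of_Icc hpq (continuousOn_windInt_integrand hz ?_)
    exact fun u hu => h u ⟨hu.1, hu.2.trans hqr⟩
  · refine ContinuousOn.intervalIntegrable_of_Icc hqr (continuousOn_windInt_integrand hz ?_)
    exact fun u hu => h u ⟨hpq.trans hu.1, hu.2⟩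

/-- The factor `κ` rotates the branch cut away from the arc, so that a branch of the logarithm is a
primitive. -/
theorem windInt_eq_log {p q : ℝ} (hpq : p ≤ q) {w κ : ℂ} (hκ : κ ≠ 0)
    (h : ∀ u ∈ Icc p q, κ * (z u - w) ∈ Complex.slitPlane) :
    windInt z p q w = Complex.log (κ * (z q - w)) - Complex.log (κ * (z p - w)) := by
  have h0 : ∀ u ∈ Icc p q, z u ≠ w := by
    intro u hu h1
    have := h u hu
    simp [h1] at this
  unfold windInt
  rw [intervalIntegral.integral_eq_sub_of_hasDerivAt (f := fun u => Complex.log (κ * (z u - w)))]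
  · intro u hu
    rw [uIcc_of_le hpq] at hu
    have h1 := (((hasDerivAt_of_contDiff_one hz u).sub_const w).const_mul κ).clog_real (h u hu)
    rwa [mul_div_mul_left _ _ hκ] at h1
  · exact ContinuousOn.intervalIntegrable_of_Icc hpq (continuousOn_windInt_integrand hz h0)

/-- Integrality of the winding number: `(z - w) * exp (-windInt)` has derivative zero, and `z - w`
has the same value at both ends of a closed arc. -/
theorem exp_windInt {p q : ℝ} (hpq : p ≤ q) {w : ℂ} (h : ∀ u ∈ Icc p q, z u ≠ w)
    (hc : z p = z q) : Complex.exp (windInt z p q w) = 1 := by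
  have hcont := continuousOn_windInt_integrand hz h
  set g : ℝ → ℂ := fun x => (z x - w) * Complex.exp (-windInt z p x w) with hg
  have hint : ∀ x ∈ Icc p q, IntervalIntegrable (fun u => deriv z u / (z u - w))
      MeasureTheory.volume p x := fun x hx =>
    ContinuousOn.intervalIntegrable_of_Icc hx.1 (hcont.mono (Icc_subset_Icc_right hx.2))
  have hderiv : ∀ x ∈ Icc p q, HasDerivWithinAt g 0 (Icc p q) x := by
    intro x hx
    have h1 : HasDerivWithinAt (fun x => windInt z p x w) (deriv z x / (z x - w)) (Icc p q) x := by
      unfold windInt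
      have : Fact (x ∈ Icc p q) := ⟨hx⟩
      refine intervalIntegral.integral_hasDerivWithinAt_right (hint x hx)
        (t := Icc p q) ?_ (hcont x hx)
      exact hcont.stronglyMeasurableAtFilter_nhdsWithin measurableSet_Icc x
    have h2 := ((hasDerivAt_of_contDiff_one hz x).sub_const w).hasDerivWithinAt (s := Icc p q)
    have h3 := h2.mul h1.neg.cexp
    have h4 : z x - w ≠ 0 := sub_ne_zero.2 (h x hx)
    refine h3.congr_deriv ?_
    field_simp
    ring
  have h1 : g q = g p := by
    refine (constant_of_has_deriv_right_zero (f := g) (a := p) (b := q) ?_ ?_) q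
      ⟨hpq, le_rfl⟩
    · exact fun x hx => (hderiv x hx).continuousWithinAt
    · exact fun x hx => (hderiv x ⟨hx.1, hx.2.le⟩).mono_of_mem_nhdsWithin
        (Icc_mem_nhdsGE_of_mem hx)
  have h2 : windInt z p p w = 0 := by simp [windInt]
  simp only [hg, h2, neg_zero, Complex.exp_zero, mul_one, ← hc] at h1
  have h3 : z p - w ≠ 0 := sub_ne_zero.2 (h p ⟨le_rfl, hpq⟩)
  have h4 : Complex.exp (-windInt z p q w) = 1 := by
    apply mul_left_cancel₀ h3
    rw [h1, mul_one]
  rw [Complex.exp_neg, inv_eq_one] at h4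
  exact h4

theorem continuousAt_windInt {p q : ℝ} (hpq : p ≤ q) {w : ℂ} (h : ∀ u ∈ Icc p q, z u ≠ w) :
    ContinuousAt (windInt z p q) w := by
  have hcomp : IsCompact (z '' Icc p q) := isCompact_Icc.image hz.continuous
  obtain ⟨δ, hδ, hball⟩ := Metric.isOpen_iff.1 hcomp.isClosed.isOpen_compl w
    (by rintro ⟨u, hu, rfl⟩; exact h u hu rfl)
  have hnear : ∀ᶠ w' in 𝓝 w, ∀ u ∈ Icc p q, δ / 2 ≤ ‖z u - w'‖ := by
    filter_upwards [Metric.ball_mem_nhds w (half_pos hδ)] with w' hw' u hu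
    by_contra hlt
    refine hball (a := z u) ?_ ⟨u, hu, rfl⟩
    rw [Metric.mem_ball] at hw' ⊢
    have := dist_triangle (z u) w' w
    rw [dist_eq_norm (z u) w'] at this
    linarith
  obtain ⟨C, hC⟩ := isCompact_Icc.exists_bound_of_continuousOn (s := Icc p q)
    (hz.continuous_deriv le_rfl).continuousOn
  unfold windInt
  refine intervalIntegral.continuousAt_of_dominated_interval (bound := fun _ => C / (δ / 2)) ?_ ?_ ?_
    ?_
  · filter_upwards [hnear] with w' hw'
    refine ContinuousOn.aestronglyMeasurable ?_ measurableSet_uIoc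
    refine (continuousOn_windInt_integrand hz fun u hu => ?_).mono
      ((uIoc_of_le hpq).subset.trans Ioc_subset_Icc_self)
    intro heq
    have := hw' u hu
    rw [heq] at this
    simp at this
    linarith
  · filter_upwards [hnear] with w' hw'
    refine Eventually.of_forall fun u hu => ?_
    rw [uIoc_of_le hpq] at hu
    have hu := Ioc_subset_Icc_self hu
    rw [norm_div]
    exact div_le_div₀ ((norm_nonneg _).trans (hC u hu)) (hC u hu) (half_pos hδ) (hw' u hu)
  · exact intervalIntegrable_const
  · refine Eventually.of_forall fun u hu => ?_
    rw [uIoc_of_le hpq] at hu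
    have hu := Ioc_subset_Icc_self hu
    exact continuousAt_const.div (continuousAt_const.sub continuousAt_id)
      (sub_ne_zero.2 (h u hu))

end

/-! ### Winding numbers near crossings and corners. -/

/-- The determinant of two complex numbers as vectors of the plane. -/
def crossC (a b : ℂ) : ℝ := a.re * b.im - a.im * b.re

theorem eventually_norm_sub_le {z : ℝ → ℂ} {a : ℂ} {x : ℝ} (h : HasDerivAt z a x) {ε : ℝ}
    (hε : 0 < ε) : ∃ δ > 0, ∀ u, |u - x| ≤ δ → ‖z u - z x - (u - x) * a‖ ≤ ε * |u - x| := by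
  have h1 := h.hasFDerivAt.isLittleO.def hε
  obtain ⟨δ, hδ, h2⟩ := Metric.eventually_nhds_iff.1 h1
  refine ⟨δ / 2, half_pos hδ, fun u hu => ?_⟩
  have h3 := h2 (y := u) (by rw [Real.dist_eq]; linarith)
  simpa using h3

theorem Complex.log_mul_I_sub_log_neg {w : ℂ} (h : 0 < w.re) :
    Complex.log (Complex.I * w) - Complex.log (-(Complex.I * w)) = Real.pi * Complex.I := by
  have h1 : 0 < (Complex.I * w).im := by simpa using h
  apply Complex.ext
  · simp [Complex.log_re]
  · simp [Complex.log_im, Complex.arg_neg_eq_arg_sub_pi_of_im_pos h1]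

theorem Complex.log_mul_I_sub_log_neg' {w : ℂ} (h : w.re < 0) :
    Complex.log (Complex.I * w) - Complex.log (-(Complex.I * w)) = -(Real.pi * Complex.I) := by
  have h1 : (Complex.I * w).im < 0 := by simpa using h
  apply Complex.ext
  · simp [Complex.log_re]
  · simp [Complex.log_im, Complex.arg_neg_eq_arg_add_pi_of_im_neg h1]

/-- If `w` is close to `x - β y` (with `y ≠ 0` of the appropriate sign), then `τ i w` avoids the
negative real axis. -/
theorem mem_slitPlane_of_near {β w : ℂ} {x y ε τ : ℝ} (hε : 0 < ε) (hε2 : ε ≤ 1 / 2)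
    (hε3 : ε * (2 * ‖β‖ + 2) < |β.im|) (hy : 0 < τ * (y * β.im)) (hτ : τ = 1 ∨ τ = -1)
    (h : ‖w - (x - β * y)‖ ≤ ε * (|x| + |y|)) : (τ : ℂ) * Complex.I * w ∈ Complex.slitPlane := by
  rw [Complex.mem_slitPlane_iff]
  by_contra hcon
  push Not at hcon
  obtain ⟨h1, h2⟩ := hcon
  have e1 : ((τ : ℂ) * Complex.I * w).re = -(τ * w.im) := by simp
  have e2 : ((τ : ℂ) * Complex.I * w).im = τ * w.re := by simp
  rw [e1] at h1
  rw [e2] at h2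
  have hτ0 : τ ≠ 0 := by rcases hτ with h | h <;> simp [h]
  have hre : w.re = 0 := by simpa [hτ0] using h2
  have h3 := (Complex.abs_re_le_norm _).trans h
  have h4 := (Complex.abs_im_le_norm _).trans h
  have e3 : (w - (x - β * y)).re = -(x - β.re * y) := by simp [hre]
  have e4 : (w - (x - β * y)).im = w.im + β.im * y := by simp
  rw [e3, abs_neg] at h3
  rw [e4] at h4
  have h5 : |x| ≤ |x - β.re * y| + |β.re * y| := by
    have := abs_add_le (x - β.re * y) (β.re * y)
    simpa using this
  have h6 : |β.re * y| ≤ ‖β‖ * |y| := by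
    rw [abs_mul]
    exact mul_le_mul_of_nonneg_right (Complex.abs_re_le_norm β) (abs_nonneg y)
  have h7 : |x| ≤ (2 * ‖β‖ + 1) * |y| := by nlinarith [abs_nonneg x, abs_nonneg y]
  have hy0 : y ≠ 0 := by rintro rfl; simp at hy
  have h8 : |w.im + β.im * y| < |β.im| * |y| := by
    have : 0 < |y| := abs_pos.2 hy0
    nlinarith
  have h9 : |β.im| * |y| = τ * (y * β.im) := by
    have : |τ| = 1 := by rcases hτ with h | h <;> simp [h]
    rw [← abs_of_pos hy, abs_mul, abs_mul, this]
    ring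
  have h10 : τ * (w.im + β.im * y) ≤ |w.im + β.im * y| := by
    rcases hτ with h | h
    · rw [h, one_mul]; exact le_abs_self _
    · rw [h, neg_one_mul]; exact neg_le_abs _
  nlinarith

/-- Passing a transverse crossing changes the winding integral by `± 2 π i`. -/
theorem windInt_jump {z : ℝ → ℂ} (hz : ContDiff ℝ 1 z) {p q u₀ v₀ : ℝ} (hu₀ : u₀ ∈ Ioo p q)
    (heq : z u₀ = z v₀) (huniq : ∀ u ∈ Icc p q, z u = z v₀ → u = u₀)
    (hne : 0 < |crossC (deriv z u₀) (deriv z v₀)|) :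
    ∃ ℓ : ℂ, ∀ τ : ℝ, τ = 1 ∨ τ = -1 → ∀ l : Filter ℝ, l ≤ 𝓝 v₀ →
      (∀ᶠ v in l, 0 < τ * ((v - v₀) * crossC (deriv z u₀) (deriv z v₀))) →
      Tendsto (fun v => windInt z p q (z v)) l (𝓝 (ℓ + τ * (Real.pi * Complex.I))) := by
  set a := deriv z u₀ with ha
  set b := deriv z v₀ with hb
  have ha0 : a ≠ 0 := by rintro h; simp [h, crossC] at hne
  have hna : 0 < ‖a‖ ^ 2 := by positivity
  set β := b / a with hβ
  have hβim : β.im * ‖a‖ ^ 2 = crossC a b := by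
    rw [hβ, Complex.div_im, ← Complex.normSq_eq_norm_sq, crossC]
    have : Complex.normSq a ≠ 0 := by simpa using ha0
    field_simp
  have hβ0 : 0 < |β.im| := by
    rw [← hβim, abs_mul, abs_of_pos hna] at hne
    exact pos_of_mul_pos_left hne hna.le
  obtain ⟨ε, hε, hε2, hε3⟩ : ∃ ε : ℝ, 0 < ε ∧ ε ≤ 1 / 2 ∧ ε * (2 * ‖β‖ + 2) < |β.im| := by
    have h0 : 0 < 2 * ‖β‖ + 2 := by positivity
    refine ⟨min (1 / 2) (|β.im| / (2 * ‖β‖ + 2) / 2), by positivity, min_le_left _ _, ?_⟩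
    calc _ ≤ (|β.im| / (2 * ‖β‖ + 2) / 2) * (2 * ‖β‖ + 2) :=
          mul_le_mul_of_nonneg_right (min_le_right _ _) h0.le
      _ = |β.im| / 2 := by field_simp
      _ < _ := by linarith
  have hna1 : 0 < ‖a‖ := norm_pos_iff.2 ha0
  obtain ⟨δ₁, hδ₁, h1⟩ := eventually_norm_sub_le (hasDerivAt_of_contDiff_one hz u₀)
    (mul_pos hε hna1)
  obtain ⟨δ₂, hδ₂, h2⟩ := eventually_norm_sub_le (hasDerivAt_of_contDiff_one hz v₀)
    (mul_pos hε hna1)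
  obtain ⟨δ, hδ, hδδ, hδp, hδq⟩ : ∃ δ > 0, δ ≤ δ₁ ∧ p < u₀ - δ ∧ u₀ + δ < q := by
    refine ⟨min δ₁ (min ((u₀ - p) / 2) ((q - u₀) / 2)), ?_, min_le_left _ _, ?_, ?_⟩
    · have := hu₀.1
      have := hu₀.2
      exact lt_min hδ₁ (lt_min (by linarith) (by linarith))
    · have := hu₀.1
      have : min δ₁ (min ((u₀ - p) / 2) ((q - u₀) / 2)) ≤ (u₀ - p) / 2 :=
        (min_le_right _ _).trans (min_le_left _ _)
      linarith
    · have := hu₀.2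
      have : min δ₁ (min ((u₀ - p) / 2) ((q - u₀) / 2)) ≤ (q - u₀) / 2 :=
        (min_le_right _ _).trans (min_le_right _ _)
      linarith
  have hnear : ∀ u v, |u - u₀| ≤ δ → |v - v₀| ≤ δ₂ →
      ‖(z u - z v) / a - (((u - u₀ : ℝ) : ℂ) - β * ((v - v₀ : ℝ) : ℂ))‖ ≤
        ε * (|u - u₀| + |v - v₀|) := by
    intro u v hu hv
    have e : (z u - z v) / a - (((u - u₀ : ℝ) : ℂ) - β * ((v - v₀ : ℝ) : ℂ)) =
        ((z u - z u₀ - (u - u₀) * a) - (z v - z v₀ - (v - v₀) * b)) / a := by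
      rw [hβ, heq]
      push_cast
      field_simp
      ring
    rw [e, norm_div, div_le_iff₀ hna1]
    calc _ ≤ ‖z u - z u₀ - (u - u₀) * a‖ + ‖z v - z v₀ - (v - v₀) * b‖ := norm_sub_le _ _
      _ ≤ ε * ‖a‖ * |u - u₀| + ε * ‖a‖ * |v - v₀| :=
        add_le_add (h1 u (hu.trans hδδ)) (h2 v hv)
      _ = _ := by ring
  set Wp := (z (u₀ + δ) - z v₀) / a with hWp
  set Wm := (z (u₀ - δ) - z v₀) / a with hWm
  have hWp0 : 0 < Wp.re := by
    have h3 := hnear (u₀ + δ) v₀ (by simp [abs_of_pos hδ]) (by simp [hδ₂.le])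
    have h4 := (Complex.abs_re_le_norm _).trans h3
    simp only [sub_self, Complex.ofReal_zero, mul_zero, sub_zero, add_sub_cancel_left, abs_zero,
      add_zero, abs_of_pos hδ, Complex.sub_re, Complex.ofReal_re] at h4
    rw [← hWp] at h4
    have := (abs_le.1 h4).1
    nlinarith
  have hWm0 : Wm.re < 0 := by
    have h3 := hnear (u₀ - δ) v₀ (by simp [abs_of_pos hδ]) (by simp [hδ₂.le])
    have h4 := (Complex.abs_re_le_norm _).trans h3
    simp only [sub_self, Complex.ofReal_zero, mul_zero, sub_zero, sub_sub_cancel_left, abs_zero,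
      add_zero, abs_neg, abs_of_pos hδ, Complex.sub_re, Complex.ofReal_re] at h4
    rw [← hWm] at h4
    have := (abs_le.1 h4).2
    nlinarith
  have hA1 : ContinuousAt (windInt z p (u₀ - δ)) (z v₀) :=
    continuousAt_windInt hz hδp.le fun u hu h3 => by
      have := huniq u ⟨hu.1, by linarith [hu.2]⟩ h3
      linarith [hu.2]
  have hA2 : ContinuousAt (windInt z (u₀ + δ) q) (z v₀) :=
    continuousAt_windInt hz hδq.le fun u hu h3 => by
      have := huniq u ⟨by linarith [hu.1], hu.2⟩ h3
      linarith [hu.1]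
  set A := windInt z p (u₀ - δ) (z v₀) + windInt z (u₀ + δ) q (z v₀) with hA
  -- This is the mean of the two one-sided limits. On the side `τ` the short arc near `u₀` is
  -- integrated with the branch of the logarithm turned by `τ * I`; its end values on the two sides
  -- differ by `2πi` altogether.
  refine ⟨A + Complex.log (Complex.I * Wp) - Complex.log (Complex.I * Wm) - Real.pi * Complex.I,
    fun τ hτ l hl hlτ => ?_⟩
  have hzl : Tendsto z l (𝓝 (z v₀)) := (hz.continuous.tendsto v₀).mono_left hl
  have hτ0 : (τ : ℂ) ≠ 0 := by rcases hτ with h | h <;> simp [h]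
  set κ : ℂ := τ * Complex.I / a with hκ
  have hκ0 : κ ≠ 0 := by
    rw [hκ]
    exact div_ne_zero (mul_ne_zero hτ0 Complex.I_ne_zero) ha0
  have hκe : ∀ w w', κ * (w - w') = τ * Complex.I * ((w - w') / a) := by
    intro w w'
    rw [hκ]
    ring
  have hev : ∀ᶠ v in l, windInt z p q (z v) = windInt z p (u₀ - δ) (z v) +
      (Complex.log (κ * (z (u₀ + δ) - z v)) - Complex.log (κ * (z (u₀ - δ) - z v))) +
      windInt z (u₀ + δ) q (z v) := by
    have hslit : ∀ᶠ v in l, ∀ u ∈ Icc (u₀ - δ) (u₀ + δ), κ * (z u - z v) ∈ Complex.slitPlane := by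
      have h3 : ∀ᶠ v in l, |v - v₀| ≤ δ₂ := by
        have : ∀ᶠ v in 𝓝 v₀, |v - v₀| < δ₂ := by
          filter_upwards [Metric.ball_mem_nhds v₀ hδ₂] with v hv using by
            simpa [Real.dist_eq] using hv
        exact (this.filter_mono hl).mono fun v hv => hv.le
      filter_upwards [hlτ, h3] with v h4 h5 u hu
      rw [hκe]
      refine mem_slitPlane_of_near hε hε2 hε3 ?_ hτ
        (hnear u v (by rw [abs_le]; constructor <;> linarith [hu.1, hu.2]) h5)
      rw [← hβim] at h4
      have h6 : 0 < (τ * ((v - v₀) * β.im)) * ‖a‖ ^ 2 := by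
        convert h4 using 1
        ring
      exact pos_of_mul_pos_left h6 hna.le
    have hout : ∀ᶠ w in 𝓝 (z v₀), ∀ u ∈ Icc p (u₀ - δ) ∪ Icc (u₀ + δ) q, z u ≠ w := by
      have hcomp : IsCompact (z '' (Icc p (u₀ - δ) ∪ Icc (u₀ + δ) q)) :=
        (isCompact_Icc.union isCompact_Icc).image hz.continuous
      have h3 : ∀ᶠ w in 𝓝 (z v₀), w ∈ (z '' (Icc p (u₀ - δ) ∪ Icc (u₀ + δ) q))ᶜ := by
        refine hcomp.isClosed.isOpen_compl.mem_nhds ?_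
        rintro ⟨u, hu, h4⟩
        rcases hu with hu | hu
        · have := huniq u ⟨hu.1, by linarith [hu.2]⟩ h4
          linarith [hu.2]
        · have := huniq u ⟨by linarith [hu.1], hu.2⟩ h4
          linarith [hu.1]
      filter_upwards [h3] with w hw u hu h4
      exact hw ⟨u, hu, h4⟩
    filter_upwards [hslit, hzl.eventually hout] with v h3 h4
    have h5 : ∀ u ∈ Icc p q, z u ≠ z v := by
      intro u hu
      by_cases h6 : u ∈ Icc (u₀ - δ) (u₀ + δ)
      · intro h7
        have := h3 u h6
        simp [h7] at this
      · refine h4 u ?_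
        rw [mem_Icc, not_and_or, not_le, not_le] at h6
        rcases h6 with h6 | h6
        · exact Or.inl ⟨hu.1, h6.le⟩
        · exact Or.inr ⟨h6.le, hu.2⟩
    rw [windInt_add hz hδp.le (by linarith) h5,
      windInt_add hz (q := u₀ + δ) (by linarith) hδq.le fun u hu => h5 u ⟨by linarith [hu.1], hu.2⟩,
      windInt_eq_log hz (by linarith) hκ0 h3]
    ring
  have him : ∀ W : ℂ, W.re ≠ 0 → τ * Complex.I * W ∈ Complex.slitPlane := by
    intro W hW
    rw [Complex.mem_slitPlane_iff]
    right
    have hτ1 : τ ≠ 0 := by exact_mod_cast hτ0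
    simp [hτ1, hW]
  have hlim : Tendsto (fun v => windInt z p (u₀ - δ) (z v) +
      (Complex.log (κ * (z (u₀ + δ) - z v)) - Complex.log (κ * (z (u₀ - δ) - z v))) +
      windInt z (u₀ + δ) q (z v)) l (𝓝 (windInt z p (u₀ - δ) (z v₀) +
      (Complex.log (κ * (z (u₀ + δ) - z v₀)) - Complex.log (κ * (z (u₀ - δ) - z v₀))) +
      windInt z (u₀ + δ) q (z v₀))) := by
    refine ((hA1.tendsto.comp hzl).add (Tendsto.sub ?_ ?_)).add (hA2.tendsto.comp hzl)
    · refine Tendsto.clog ((tendsto_const_nhds.sub hzl).const_mul κ) ?_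
      rw [hκe]
      exact him _ hWp0.ne'
    · refine Tendsto.clog ((tendsto_const_nhds.sub hzl).const_mul κ) ?_
      rw [hκe]
      exact him _ hWm0.ne
  refine (hlim.congr' (hev.mono fun v hv => hv.symm)).trans (le_of_eq ?_)
  congr 1
  rw [hκe, hκe, ← hWp, ← hWm, hA]
  have e1 := Complex.log_mul_I_sub_log_neg hWp0
  have e2 := Complex.log_mul_I_sub_log_neg' hWm0
  rcases hτ with rfl | rfl
  · simp only [Complex.ofReal_one, one_mul]
    ring
  · simp only [Complex.ofReal_neg, Complex.ofReal_one, neg_mul, one_mul]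
    linear_combination -e1 + e2

theorem HasDerivAt.eventually_gt_right {f : ℝ → ℝ} {d x : ℝ} (h : HasDerivAt f d x) (hd : 0 < d) :
    ∀ᶠ y in 𝓝[>] x, f x < f y := by
  have h1 := (hasDerivAt_iff_tendsto_slope.1 h).eventually_const_lt hd
  filter_upwards [h1.filter_mono (nhdsWithin_mono _ fun v hv => ne_of_gt hv),
    self_mem_nhdsWithin] with y h2 h3
  rw [slope_def_field] at h2
  have h4 : 0 < y - x := sub_pos.2 h3
  have := (div_pos_iff_of_pos_right h4).1 h2
  linarith

theorem HasDerivAt.eventually_lt_left {f : ℝ → ℝ} {d x : ℝ} (h : HasDerivAt f d x) (hd : 0 < d) :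
    ∀ᶠ y in 𝓝[<] x, f y < f x := by
  have h1 := (hasDerivAt_iff_tendsto_slope.1 h).eventually_const_lt hd
  filter_upwards [h1.filter_mono (nhdsWithin_mono _ fun v hv => ne_of_lt hv),
    self_mem_nhdsWithin] with y h2 h3
  rw [slope_def_field] at h2
  have h4 : y - x < 0 := sub_neg.2 h3
  by_contra h5
  have := div_nonpos_of_nonneg_of_nonpos (a := f y - f x) (by linarith) h4.le
  linarith

/-- The limit of the winding integral of a loop when `w` tends to the corner of the loop from the
side of the complementary angle. -/
theorem tendsto_windInt_corner {z : ℝ → ℂ} (hz : ContDiff ℝ 1 z) {p q : ℝ} (hpq : p < q)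
    (heq : z p = z q) (huniq : ∀ u ∈ Ioo p q, z u ≠ z p) {κ : ℂ} (hp : 0 < (κ * deriv z p).re)
    (hq : (κ * deriv z q).re < 0) :
    ∃ ℓ : ℂ, ∀ l : Filter ℝ, Tendsto z l (𝓝 (z p)) → (∀ᶠ v in l, (κ * (z v - z p)).re < 0) →
      Tendsto (fun v => windInt z p q (z v)) l (𝓝 ℓ) := by
  have hκ0 : κ ≠ 0 := by rintro rfl; simp at hp
  have hd : ∀ x, HasDerivAt (fun u => (κ * (z u - z p)).re) (κ * deriv z x).re x := by
    intro x
    have := (((hasDerivAt_of_contDiff_one hz x).sub_const (z p)).const_mul κ)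
    exact Complex.reCLM.hasFDerivAt.comp_hasDerivAt x this
  have hp' := (hd p).eventually_gt_right hp
  -- The loop arrives with velocity in the negative half-plane, hence its points just before the end
  -- lie in the positive one, like those just after the start. A point in the negative half-plane
  -- then sees both end arcs without meeting the branch cut.
  have hq' := ((hd q).neg.eventually_lt_left (by simpa using hq))
  simp only [sub_self, mul_zero, Complex.zero_re] at hp'
  simp only [Pi.neg_apply, ← heq, sub_self, mul_zero, Complex.zero_re, neg_zero, neg_neg_iff_pos]
    at hq'
  obtain ⟨p₁, hp₁, hp₁'⟩ := mem_nhdsGT_iff_exists_Ioc_subset.1 hp'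
  obtain ⟨q₁, hq₁, hq₁'⟩ := mem_nhdsLT_iff_exists_Ico_subset.1 hq'
  obtain ⟨p₂, hpp, hp₂, hp₂'⟩ : ∃ p₂, p < p₂ ∧ p₂ ≤ p₁ ∧ p₂ < (p + q) / 2 := by
    refine ⟨min p₁ ((3 * p + q) / 4), lt_min hp₁ (by linarith), min_le_left _ _, ?_⟩
    exact (min_le_right _ _).trans_lt (by linarith)
  obtain ⟨q₂, hqq, hq₂, hq₂'⟩ : ∃ q₂, q₂ < q ∧ q₁ ≤ q₂ ∧ (p + q) / 2 < q₂ := by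
    refine ⟨max q₁ ((3 * q + p) / 4), max_lt hq₁ (by linarith), le_max_left _ _, ?_⟩
    exact lt_of_lt_of_le (by linarith) (le_max_right _ _)
  have hP : ∀ u ∈ Icc p p₂, 0 ≤ (κ * (z u - z p)).re := by
    intro u hu
    rcases eq_or_lt_of_le hu.1 with rfl | h
    · simp
    · exact le_of_lt (hp₁' ⟨h, hu.2.trans hp₂⟩)
  have hQ : ∀ u ∈ Icc q₂ q, 0 ≤ (κ * (z u - z p)).re := by
    intro u hu
    rcases eq_or_lt_of_le hu.2 with rfl | h
    · simp [heq]
    · exact le_of_lt (hq₁' ⟨hq₂.trans hu.1, h⟩)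
  have hslit : ∀ u w, 0 ≤ (κ * (z u - z p)).re → (κ * (w - z p)).re < 0 →
      κ * (z u - w) ∈ Complex.slitPlane := by
    intro u w h1 h2
    have e : κ * (z u - w) = κ * (z u - z p) - κ * (w - z p) := by ring
    rw [e, Complex.mem_slitPlane_iff, Complex.sub_re]
    left
    linarith
  have hmid : ∀ u ∈ Icc p₂ q₂, z u ≠ z p := fun u hu =>
    huniq u ⟨by linarith [hu.1], by linarith [hu.2]⟩
  have hM : ContinuousAt (windInt z p₂ q₂) (z p) := continuousAt_windInt hz (by linarith) hmid
  refine ⟨Complex.log (κ * (z p₂ - z p)) + windInt z p₂ q₂ (z p) -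
    Complex.log (κ * (z q₂ - z p)), fun l hl hneg => ?_⟩
  have hev : ∀ᶠ v in l, windInt z p q (z v) = Complex.log (κ * (z p₂ - z v)) +
      windInt z p₂ q₂ (z v) - Complex.log (κ * (z q₂ - z v)) := by
    have hout : ∀ᶠ w in 𝓝 (z p), ∀ u ∈ Icc p₂ q₂, z u ≠ w := by
      have hcomp : IsCompact (z '' Icc p₂ q₂) := isCompact_Icc.image hz.continuous
      have h3 : ∀ᶠ w in 𝓝 (z p), w ∈ (z '' Icc p₂ q₂)ᶜ := by
        refine hcomp.isClosed.isOpen_compl.mem_nhds ?_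
        rintro ⟨u, hu, h4⟩
        exact hmid u hu h4
      filter_upwards [h3] with w hw u hu h4
      exact hw ⟨u, hu, h4⟩
    filter_upwards [hneg, hl.eventually hout] with v h1 h2
    have h3 : ∀ u ∈ Icc p p₂, κ * (z u - z v) ∈ Complex.slitPlane :=
      fun u hu => hslit u _ (hP u hu) h1
    have h4 : ∀ u ∈ Icc q₂ q, κ * (z u - z v) ∈ Complex.slitPlane :=
      fun u hu => hslit u _ (hQ u hu) h1
    have h5 : ∀ u ∈ Icc p q, z u ≠ z v := by
      intro u hu h6
      rcases le_total u p₂ with h7 | h7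
      · have := h3 u ⟨hu.1, h7⟩
        simp [h6] at this
      · rcases le_total u q₂ with h8 | h8
        · exact h2 u ⟨h7, h8⟩ h6
        · have := h4 u ⟨h8, hu.2⟩
          simp [h6] at this
    rw [windInt_add hz hpp.le (by linarith) h5,
      windInt_add hz (q := q₂) (by linarith) hqq.le fun u hu => h5 u ⟨by linarith [hu.1], hu.2⟩,
      windInt_eq_log hz hpp.le hκ0 h3, windInt_eq_log hz hqq.le hκ0 h4, ← heq]
    ring
  refine Tendsto.congr' (hev.mono fun v hv => hv.symm) ?_
  refine Tendsto.sub (Tendsto.add ?_ (hM.tendsto.comp hl)) ?_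
  · refine Tendsto.clog ((tendsto_const_nhds.sub hl).const_mul κ) ?_
    rw [Complex.mem_slitPlane_iff]
    exact Or.inl (hp₁' ⟨hpp, hp₂⟩)
  · refine Tendsto.clog ((tendsto_const_nhds.sub hl).const_mul κ) ?_
    rw [Complex.mem_slitPlane_iff]
    exact Or.inl (hq₁' ⟨hq₂, hqq⟩)

/-- The algebraic number of crossings of the two loops of a plane curve at a double point is
zero. -/
theorem sum_sign_crossC_eq_zero {z : ℝ → ℂ} (hz : ContDiff ℝ 1 z) {s t e : ℝ} (hst : s < t)
    (hte : t < e) (h1 : z s = z t) (h2 : z e = z s) (hd : deriv z e = deriv z s)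
    (hcorner : crossC (deriv z s) (deriv z t) ≠ 0) (F : Finset (ℝ × ℝ))
    (hF : ∀ p, p ∈ F ↔ p.1 ∈ Ioo s t ∧ p.2 ∈ Ioo t e ∧ z p.1 = z p.2)
    (htr : ∀ p ∈ F, crossC (deriv z p.1) (deriv z p.2) ≠ 0)
    (hu : ∀ u ∈ Ioo s t, z u ≠ z s) (hv : ∀ v ∈ Ioo t e, z v ≠ z s)
    (hinj : ∀ u ∈ Ioo s t, ∀ u' ∈ Ioo s t, ∀ v ∈ Ioo t e, z u = z v → z u' = z v → u = u') :
    ∑ p ∈ F, (if crossC (deriv z p.1) (deriv z p.2) < 0 then (-1 : ℤ) else 1) = 0 := by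
  -- The two velocities at the corner are independent, so a real linear form with values 1 and -1 on
  -- them exists; `κ` represents it as the real part of a product. Near the corner the first loop
  -- lies on its positive side and the second loop on its negative side.
  obtain ⟨κ, hκs, hκt⟩ : ∃ κ : ℂ, 0 < (κ * deriv z s).re ∧ (κ * deriv z t).re < 0 := by
    set D := crossC (deriv z s) (deriv z t) with hD
    refine ⟨⟨((deriv z t).im + (deriv z s).im) / D, ((deriv z t).re + (deriv z s).re) / D⟩, ?_, ?_⟩
    · have : (deriv z s).re * (deriv z t).im - (deriv z s).im * (deriv z t).re = D := rfl
      have h4 : ((deriv z t).im + (deriv z s).im) / D * (deriv z s).re -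
        ((deriv z t).re + (deriv z s).re) / D * (deriv z s).im = 1 := by
        field_simp
        linear_combination this
      rw [Complex.mul_re]
      linarith
    · have : (deriv z s).re * (deriv z t).im - (deriv z s).im * (deriv z t).re = D := rfl
      have h4 : ((deriv z t).im + (deriv z s).im) / D * (deriv z t).re -
        ((deriv z t).re + (deriv z s).re) / D * (deriv z t).im = -1 := by
        field_simp
        linear_combination -this
      rw [Complex.mul_re]
      linarith
  obtain ⟨ℓ, hℓ⟩ := tendsto_windInt_corner hz hst h1 hu hκs hκt
  have hdκ : ∀ x, HasDerivAt (fun u => (κ * (z u - z s)).re) (κ * deriv z x).re x := by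
    intro x
    have := (((hasDerivAt_of_contDiff_one hz x).sub_const (z s)).const_mul κ)
    exact Complex.reCLM.hasFDerivAt.comp_hasDerivAt x this
  -- The winding integral of the first loop around the moving point of the second loop, continued
  -- outside the second loop by the common limit at the corner.
  set f : ℝ → ℂ := fun v => if t < v ∧ v < e then windInt z s t (z v) else ℓ with hf
  have hfin : ∀ v ∈ Ioo t e, (∀ u, (u, v) ∉ F) → ∀ u ∈ Icc s t, z u ≠ z v := by
    intro v hv' hvF u hu' h3
    rcases eq_or_lt_of_le hu'.1 with rfl | h4
    · exact hv v hv' h3.symm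
    rcases eq_or_lt_of_le hu'.2 with rfl | h5
    · exact hv v hv' (h3.symm.trans h1.symm)
    · exact hvF u ((hF _).2 ⟨⟨h4, h5⟩, hv', h3⟩)
  have hexp : ∀ y, ∀ᶠ v in 𝓝[≠] y, v ∈ Ioo t e → Complex.exp (windInt z s t (z v)) = 1 := by
    intro y
    have h3 : ∀ᶠ v in 𝓝[≠] y, v ∉ (F.image Prod.snd : Finset ℝ) := by
      have h4 : ∀ᶠ v in 𝓝 y, v ∉ ((F.image Prod.snd).erase y : Finset ℝ) :=
        ((F.image Prod.snd).erase y).finite_toSet.isClosed.isOpen_compl.mem_nhds (by simp)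
      filter_upwards [h4.filter_mono nhdsWithin_le_nhds, self_mem_nhdsWithin] with v h5 h6 h7
      exact h5 (Finset.mem_erase.2 ⟨h6, h7⟩)
    filter_upwards [h3] with v h4 h5
    refine exp_windInt hz hst.le (hfin v h5 fun u hu' => h4 ?_) h1
    exact Finset.mem_image.2 ⟨_, hu', rfl⟩
  have hlt : ∀ y : ℝ, 𝓝[<] y ≤ 𝓝[≠] y := fun y => nhdsWithin_mono _ fun v hv => ne_of_lt hv
  have hgt : ∀ y : ℝ, 𝓝[>] y ≤ 𝓝[≠] y := fun y => nhdsWithin_mono _ fun v hv => ne_of_gt hv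
  -- Away from crossings the winding integral is an integral multiple of `2πi`, so a one-sided limit
  -- is already attained near the point.
  have hone : ∀ (y : ℝ) (l : Filter ℝ) [l.NeBot] (m : ℂ), l ≤ 𝓝[≠] y → (∀ᶠ v in l, v ∈ Ioo t e) →
      Tendsto (fun v => windInt z s t (z v)) l (𝓝 m) → ∀ᶠ v in l, f v = m := by
    intro y l _ m hl hl' hm
    have h3 := eventually_eq_of_tendsto_exp_eq_one hm
      (by filter_upwards [(hexp y).filter_mono hl, hl'] with v h4 h5 using h4 h5)
    filter_upwards [h3, hl'] with v h4 h5
    rw [← h4, hf]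
    exact if_pos h5
  have hempty : ∀ y, (∀ u, (u, y) ∉ F) → ∀ j : ℝ × ℝ → ℂ, ∑ i ∈ F with i.2 = y, j i = 0 := by
    intro y hy j
    refine Finset.sum_eq_zero fun i hi => ?_
    rw [Finset.mem_filter] at hi
    obtain ⟨i1, i2⟩ := i
    obtain ⟨h3, rfl⟩ := hi
    exact absurd h3 (hy i1)
  set j : ℝ × ℝ → ℂ := fun p =>
    ((if crossC (deriv z p.1) (deriv z p.2) < 0 then (-1 : ℤ) else 1 : ℤ) : ℂ) *
      (2 * (Real.pi * Complex.I)) with hj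
  have key : ∑ p ∈ F, j p = 0 := by
    refine sum_jumps_eq_zero F Prod.snd j f ℓ ?_ ?_ ?_
    · intro y
      by_cases hy : y ∈ Ioo t e
      · have hmem : ∀ l : Filter ℝ, l ≤ 𝓝[≠] y → ∀ᶠ v in l, v ∈ Ioo t e := fun l hl =>
          Eventually.filter_mono (hl.trans nhdsWithin_le_nhds)
            (Ioo_mem_nhds hy.1 hy.2)
        by_cases hyF : ∃ u, (u, y) ∈ F
        · obtain ⟨u₀, hu₀⟩ := hyF
          have h3 := (hF _).1 hu₀
          have h4 := htr _ hu₀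
          simp only at h3 h4
          obtain ⟨m, hm⟩ := windInt_jump hz (p := s) (q := t) h3.1 h3.2.2 (by
            intro u hu' h5
            rcases eq_or_lt_of_le hu'.1 with rfl | h6
            · exact absurd h5.symm (hv y hy)
            rcases eq_or_lt_of_le hu'.2 with rfl | h7
            · exact absurd (h5.symm.trans h1.symm) (hv y hy)
            · exact hinj u ⟨h6, h7⟩ u₀ h3.1 y hy h5 h3.2.2) (abs_pos.2 h4)
          have hsum : ∑ i ∈ F with i.2 = y, j i = j (u₀, y) := by
            rw [Finset.sum_eq_single_of_mem (u₀, y) (by simp [hu₀])]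
            rintro ⟨u, y'⟩ hi hne
            rw [Finset.mem_filter] at hi
            obtain ⟨h5, h6⟩ := hi
            simp only at h6
            subst h6
            have h7 := (hF _).1 h5
            exact absurd (by rw [hinj u h7.1 u₀ h3.1 _ hy h7.2.2 h3.2.2]) hne
          rw [hsum]
          rcases lt_or_gt_of_ne h4 with h5 | h5
          · refine ⟨m + Real.pi * Complex.I, ?_, ?_⟩
            · refine hone y _ _ (hlt y) (hmem _ (hlt y)) ?_
              have := hm 1 (Or.inl rfl) (𝓝[<] y) nhdsWithin_le_nhds (by
                filter_upwards [self_mem_nhdsWithin] with v hv'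
                rw [one_mul]
                exact mul_pos_of_neg_of_neg (sub_neg.2 hv') h5)
              simpa using this
            · refine hone y _ _ (hgt y) (hmem _ (hgt y)) ?_
              have := hm (-1) (Or.inr rfl) (𝓝[>] y) nhdsWithin_le_nhds (by
                filter_upwards [self_mem_nhdsWithin] with v hv'
                have := mul_neg_of_pos_of_neg (sub_pos.2 hv') h5
                linarith)
              convert this using 2
              simp only [hj, h5, if_true]
              push_cast
              ring
          · refine ⟨m - Real.pi * Complex.I, ?_, ?_⟩
            · refine hone y _ _ (hlt y) (hmem _ (hlt y)) ?_
              have := hm (-1) (Or.inr rfl) (𝓝[<] y) nhdsWithin_le_nhds (by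
                filter_upwards [self_mem_nhdsWithin] with v hv'
                have := mul_neg_of_neg_of_pos (sub_neg.2 hv') h5
                linarith)
              convert this using 2
              push_cast
              ring
            · refine hone y _ _ (hgt y) (hmem _ (hgt y)) ?_
              have := hm 1 (Or.inl rfl) (𝓝[>] y) nhdsWithin_le_nhds (by
                filter_upwards [self_mem_nhdsWithin] with v hv'
                rw [one_mul]
                exact mul_pos (sub_pos.2 hv') h5)
              convert this using 2
              simp only [hj, h5.not_gt, if_false]
              push_cast
              ring
        · push Not at hyF
          have h3 : Tendsto (fun v => windInt z s t (z v)) (𝓝 y) (𝓝 (windInt z s t (z y))) :=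
            (continuousAt_windInt hz hst.le (hfin y hy hyF)).tendsto.comp
              (hz.continuous.tendsto y)
          refine ⟨windInt z s t (z y), ?_, ?_⟩
          · exact hone y _ _ (hlt y) (hmem _ (hlt y)) (h3.mono_left nhdsWithin_le_nhds)
          · rw [hempty y hyF, add_zero]
            exact hone y _ _ (hgt y) (hmem _ (hgt y)) (h3.mono_left nhdsWithin_le_nhds)
      · have hyF : ∀ u, (u, y) ∉ F := fun u hu' => hy ((hF _).1 hu').2.1
        refine ⟨ℓ, ?_, ?_⟩
        · rcases eq_or_ne y e with rfl | hye
          · refine hone y _ _ (hlt y) (Ioo_mem_nhdsLT hte) (hℓ _ ?_ ?_)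
            · rw [← h2]
              exact (hz.continuous.tendsto y).mono_left nhdsWithin_le_nhds
            · have h3 := (hdκ y).eventually_lt_left (by rw [hd]; exact hκs)
              simpa [h2] using h3
          · rcases lt_or_gt_of_ne hye with h3 | h3
            · filter_upwards [self_mem_nhdsWithin] with v hv'
              rw [hf]
              exact if_neg fun h => hy ⟨h.1.trans hv', h3⟩
            · filter_upwards [Ioo_mem_nhdsLT h3] with v hv'
              rw [hf]
              exact if_neg fun h => lt_asymm h.2 hv'.1
        · rw [hempty y hyF, add_zero]
          rcases eq_or_ne y t with rfl | hyt
          · refine hone y _ _ (hgt y) (Ioo_mem_nhdsGT hte) (hℓ _ ?_ ?_)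
            · rw [h1]
              exact (hz.continuous.tendsto y).mono_left nhdsWithin_le_nhds
            · have h3 := (hdκ y).neg.eventually_gt_right (by simpa using hκt)
              simpa [h1] using h3
          · rcases lt_or_gt_of_ne hyt with h3 | h3
            · filter_upwards [Ioo_mem_nhdsGT h3] with v hv'
              rw [hf]
              exact if_neg fun h => lt_asymm h.1 hv'.2
            · filter_upwards [self_mem_nhdsWithin] with v hv'
              rw [hf]
              exact if_neg fun h => hy ⟨h3, lt_trans hv' h.2⟩
    · filter_upwards [eventually_le_atBot t] with v hv'
      rw [hf]
      exact if_neg fun h => absurd h.1 hv'.not_gt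
    · filter_upwards [eventually_ge_atTop e] with v hv'
      rw [hf]
      exact if_neg fun h => absurd h.2 hv'.not_gt
  rw [hj, ← Finset.sum_mul, mul_eq_zero] at key
  rcases key with h3 | h3
  · exact_mod_cast h3
  · exfalso
    have := Real.pi_ne_zero
    simp [this] at h3

/-! ### Transfer from the sphere to the plane. -/

theorem exists_tripleDet_map_eq (R : E3 →ₗ[ℝ] E3) : ∃ d : ℝ, ∀ n v w : E3,
    tripleDet (R n) (R v) (R w) = d * tripleDet n v w := by
  set A : Matrix (Fin 3) (Fin 3) ℝ := Matrix.of fun j i => R (EuclideanSpace.single j 1) i with hA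
  have hR : ∀ (x : E3) (i : Fin 3), R x i = ∑ j, x j * A j i := by
    intro x i
    have hx : x = ∑ j, x j • EuclideanSpace.single j (1 : ℝ) := by
      ext k
      fin_cases k <;> simp [Fin.sum_univ_three]
    conv_lhs => rw [hx]
    simp [hA]
  refine ⟨A.det, fun n v w => ?_⟩
  rw [mul_comm, tripleDet, tripleDet, ← Matrix.det_mul]
  congr 1
  ext i j
  fin_cases i <;> simp [Matrix.mul_apply, hR]

theorem exists_isometry_map_eq_single {n : E3} (hn : ‖n‖ = 1) :
    ∃ R : E3 ≃ₗᵢ[ℝ] E3, R n = EuclideanSpace.single 2 1 := by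
  have h1 : Orthonormal ℝ (({2} : Set (Fin 3)).domRestrict fun _ => n) := by
    constructor
    · intro i
      exact hn
    · rintro ⟨i, hi⟩ ⟨j, hj⟩ hij
      simp only [mem_singleton_iff] at hi hj
      subst hi
      subst hj
      exact absurd rfl hij
  obtain ⟨b, hb⟩ := h1.exists_orthonormalBasis_extension_of_card_eq (by simp)
  refine ⟨b.repr, ?_⟩
  rw [← hb 2 rfl]
  simp

/-- Stereographic projection from the north pole. -/
noncomputable def stereo (x : E3) : ℂ := ⟨x 0 / (1 - x 2), x 1 / (1 - x 2)⟩

theorem stereo_eq (x : E3) : stereo x =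
    ((x 0 / (1 - x 2) : ℝ) : ℂ) + ((x 1 / (1 - x 2) : ℝ) : ℂ) * Complex.I :=
  Complex.mk_eq_add_mul_I _ _

theorem E3_norm_sq (x : E3) : ‖x‖ ^ 2 = x 0 ^ 2 + x 1 ^ 2 + x 2 ^ 2 := by
  rw [EuclideanSpace.real_norm_sq_eq, Fin.sum_univ_three]

theorem stereo_injective {x y : E3} (hx : ‖x‖ = 1) (hy : ‖y‖ = 1) (hx' : x 2 ≠ 1) (hy' : y 2 ≠ 1)
    (h : stereo x = stereo y) : x = y := by
  have hx1 := E3_norm_sq x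
  have hy1 := E3_norm_sq y
  rw [hx] at hx1
  rw [hy] at hy1
  have hx2 : 1 - x 2 ≠ 0 := sub_ne_zero.2 (Ne.symm hx')
  have hy2 : 1 - y 2 ≠ 0 := sub_ne_zero.2 (Ne.symm hy')
  obtain ⟨h0, h1⟩ := Complex.ext_iff.1 h
  simp only [stereo] at h0 h1
  rw [div_eq_div_iff hx2 hy2] at h0 h1
  have key : (1 + x 2) * (1 - y 2) = (1 + y 2) * (1 - x 2) := by
    have e : (x 0 * (1 - y 2)) ^ 2 + (x 1 * (1 - y 2)) ^ 2 =
      (y 0 * (1 - x 2)) ^ 2 + (y 1 * (1 - x 2)) ^ 2 := by rw [h0, h1]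
    apply mul_right_cancel₀ (mul_ne_zero hx2 hy2)
    linear_combination e - (1 - y 2) ^ 2 * (-hx1) + (1 - x 2) ^ 2 * (-hy1)
  have e2 : x 2 = y 2 := by linarith
  rw [e2] at h0 h1
  have e0 := mul_right_cancel₀ hy2 h0
  have e1 := mul_right_cancel₀ hy2 h1
  ext i
  fin_cases i
  · exact e0
  · exact e1
  · exact e2

theorem hasDerivAt_stereo {y : ℝ → E3} {y' : E3} {t : ℝ} (h : HasDerivAt y y' t) (h2 : y t 2 ≠ 1) :
    HasDerivAt (fun t => stereo (y t))
      ⟨(y' 0 * (1 - y t 2) + y t 0 * y' 2) / (1 - y t 2) ^ 2,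
        (y' 1 * (1 - y t 2) + y t 1 * y' 2) / (1 - y t 2) ^ 2⟩ t := by
  have hc : ∀ i, HasDerivAt (fun t => y t i) (y' i) t := by
    intro i
    exact (EuclideanSpace.proj i : E3 →L[ℝ] ℝ).hasFDerivAt.comp_hasDerivAt t h
  have h3 : 1 - y t 2 ≠ 0 := sub_ne_zero.2 (Ne.symm h2)
  have d0 := (hc 0).fun_div ((hc 2).const_sub 1) h3
  have d1 := (hc 1).fun_div ((hc 2).const_sub 1) h3
  simp only [stereo_eq]
  refine (d0.ofReal_comp.add (d1.ofReal_comp.mul_const Complex.I)).congr_deriv ?_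
  rw [Complex.mk_eq_add_mul_I, mul_neg, mul_neg, sub_neg_eq_add, sub_neg_eq_add]

/-- The two vectors in the plane are the images of `v` and `w` given by `hasDerivAt_stereo`.
Projection from the north pole reverses the orientation given by the outward normal, whence the
minus sign. -/
theorem crossC_stereo {x v w : E3} (hx : ‖x‖ = 1) (h2 : x 2 ≠ 1) (hv : inner ℝ x v = (0 : ℝ))
    (hw : inner ℝ x w = (0 : ℝ)) :
    crossC ⟨(v 0 * (1 - x 2) + x 0 * v 2) / (1 - x 2) ^ 2,
        (v 1 * (1 - x 2) + x 1 * v 2) / (1 - x 2) ^ 2⟩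
      ⟨(w 0 * (1 - x 2) + x 0 * w 2) / (1 - x 2) ^ 2,
        (w 1 * (1 - x 2) + x 1 * w 2) / (1 - x 2) ^ 2⟩ =
      -(tripleDet x v w) / (1 - x 2) ^ 2 := by
  have hx1 := E3_norm_sq x
  rw [hx] at hx1
  have h3 : 1 - x 2 ≠ 0 := sub_ne_zero.2 (Ne.symm h2)
  rw [inner_E3] at hv hw
  -- The cross product of two tangent vectors is `tripleDet x v w` times `x`; this is its third
  -- coordinate.
  have key : v 0 * w 1 - v 1 * w 0 = tripleDet x v w * x 2 := by
    rw [tripleDet_eq]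
    linear_combination (v 0 * w 1 - v 1 * w 0) * hx1 -
      (x 1 * w 0 - x 0 * w 1) * hv - (x 0 * v 1 - x 1 * v 0) * hw
  simp only [crossC]
  field_simp
  have h4 : (v 0 * w 1 - v 1 * w 0) - tripleDet x v w = -tripleDet x v w * (1 - x 2) := by
    rw [key]; ring
  rw [tripleDet_eq] at h4 ⊢
  linear_combination (1 - x 2) * h4

namespace SphericalCurve

variable (P : SphericalCurve)

/-- The cone over the curve is a `C¹` image of the plane in three-space, so it has dense complement;
a point off the cone, scaled to length 1, is off the curve. -/
theorem exists_not_mem_range : ∃ n : E3, ‖n‖ = 1 ∧ ∀ t, P.toFun t ≠ n := by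
  have h1 : ContDiff ℝ 1 fun p : ℝ × ℝ => p.1 • P.toFun p.2 :=
    contDiff_fst.smul ((P.smooth.of_le (by simp)).comp contDiff_snd)
  have h2 := h1.dense_compl_range_of_finrank_lt_finrank (by simp)
  obtain ⟨y, hy, -⟩ := h2.exists_mem_open isOpen_univ ⟨0, mem_univ _⟩
  have hy0 : y ≠ 0 := by
    rintro rfl
    exact hy ⟨(0, 0), by simp⟩
  have hn : ‖y‖ ≠ 0 := norm_ne_zero_iff.2 hy0
  refine ⟨‖y‖⁻¹ • y, by rw [norm_smul, norm_inv, norm_norm, inv_mul_cancel₀ hn], fun t ht => ?_⟩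
  refine hy ⟨(‖y‖, t), ?_⟩
  simp only [ht]
  rw [smul_smul, mul_inv_cancel₀ hn, one_smul]

/-- The two loops of a spherical curve at a double point cross each other algebraically zero
times. -/
theorem sum_sgn_eq_zero {s t : ℝ} (hst : s < t) (ht : t < s + 1) (h : P.toFun s = P.toFun t)
    (F : Finset (ℝ × ℝ)) (hF : ∀ p, p ∈ F ↔
      p.1 ∈ Ioo s t ∧ p.2 ∈ Ioo t (s + 1) ∧ P.toFun p.1 = P.toFun p.2) :
    ∑ p ∈ F, P.sgn p.1 p.2 = 0 := by
  have hdbl : ∀ u v, s ≤ u → u < v → v < s + 1 → P.toFun u = P.toFun v → P.IsDoublePair u v :=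
    fun u v h1 h2 h3 h4 => ⟨h4, fun h5 => h2.ne
      (h5.eq_of_abs_sub_lt (by rw [abs_lt]; constructor <;> linarith))⟩
  obtain ⟨n, hn, hnP⟩ := P.exists_not_mem_range
  obtain ⟨R, hR⟩ := exists_isometry_map_eq_single hn
  obtain ⟨d, hd⟩ := exists_tripleDet_map_eq R.toLinearEquiv.toLinearMap
  simp only [LinearEquiv.coe_coe, LinearIsometryEquiv.coe_toLinearEquiv] at hd
  set y : ℝ → E3 := fun t => R (P.toFun t) with hy
  have hy' : ∀ t, HasDerivAt y (R (deriv P.toFun t)) t := fun t =>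
    (R.toContinuousLinearEquiv.toContinuousLinearMap).hasFDerivAt.comp_hasDerivAt t (P.hasDerivAt t)
  have hy1 : ∀ t, ‖y t‖ = 1 := fun t => by rw [hy, LinearIsometryEquiv.norm_map, P.norm_eq_one]
  have hy2 : ∀ t, y t 2 ≠ 1 := by
    intro t h2
    have h3 := E3_norm_sq (y t)
    rw [hy1, h2] at h3
    have h4 : y t 0 = 0 := by nlinarith [sq_nonneg (y t 0), sq_nonneg (y t 1)]
    have h5 : y t 1 = 0 := by nlinarith [sq_nonneg (y t 0), sq_nonneg (y t 1)]
    apply hnP t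
    apply R.injective
    rw [hR]
    ext i
    fin_cases i
    · simpa using h4
    · simpa using h5
    · simpa using h2
  set z : ℝ → ℂ := fun t => stereo (y t) with hz
  have hz' := fun t => hasDerivAt_stereo (hy' t) (hy2 t)
  have hzinj : ∀ u v, z u = z v ↔ P.toFun u = P.toFun v := by
    intro u v
    constructor
    · intro h1
      exact R.injective (stereo_injective (hy1 u) (hy1 v) (hy2 u) (hy2 v) h1)
    · intro h1
      simp only [hz, hy, h1]
  have hycont : ContDiff ℝ 1 y :=
    R.toContinuousLinearEquiv.contDiff.comp (P.smooth.of_le (by simp))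
  have hyc : ∀ i, ContDiff ℝ 1 fun t => y t i := fun i =>
    (EuclideanSpace.proj i : E3 →L[ℝ] ℝ).contDiff.comp hycont
  have hzC : ContDiff ℝ 1 z := by
    have hne : ∀ t, 1 - y t 2 ≠ 0 := fun t => sub_ne_zero.2 (Ne.symm (hy2 t))
    simp only [hz, stereo_eq]
    exact (Complex.ofRealCLM.contDiff.comp ((hyc 0).div (contDiff_const.sub (hyc 2)) hne)).add
      ((Complex.ofRealCLM.contDiff.comp ((hyc 1).div (contDiff_const.sub (hyc 2)) hne)).mul
        contDiff_const)
  have hcross : ∀ u v, P.toFun u = P.toFun v → ∃ k : ℝ, 0 < k ∧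
      crossC (deriv z u) (deriv z v) =
        -(k * d * tripleDet (P.toFun u) (deriv P.toFun u) (deriv P.toFun v)) := by
    intro u v huv
    have huv' : y u = y v := by simp only [hy, huv]
    refine ⟨((1 - y u 2) ^ 2)⁻¹, ?_, ?_⟩
    · have : 1 - y u 2 ≠ 0 := sub_ne_zero.2 (Ne.symm (hy2 u))
      positivity
    · rw [(hz' u).deriv, (hz' v).deriv, ← huv', crossC_stereo (hy1 u) (hy2 u), hy, hd]
      · field_simp
      · rw [hy, LinearIsometryEquiv.inner_map_map, P.inner_deriv]
      · rw [hy, LinearIsometryEquiv.inner_map_map, huv, P.inner_deriv]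
  -- `d` is the determinant of an isometry; if it vanished, applying the inverse would make the
  -- determinant of the standard basis zero.
  have hd0 : d ≠ 0 := by
    rintro rfl
    have h1 := hd (EuclideanSpace.single 0 1) (EuclideanSpace.single 1 1) (EuclideanSpace.single 2 1)
    obtain ⟨d', hd'⟩ := exists_tripleDet_map_eq R.symm.toLinearEquiv.toLinearMap
    have h2 := hd' (R (EuclideanSpace.single 0 1)) (R (EuclideanSpace.single 1 1))
      (R (EuclideanSpace.single 2 1))
    simp only [LinearEquiv.coe_coe, LinearIsometryEquiv.coe_toLinearEquiv,
      LinearIsometryEquiv.symm_apply_apply] at h2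
    rw [h1, zero_mul, mul_zero, tripleDet_eq] at h2
    simp at h2
  have hcross0 : ∀ u v, P.IsDoublePair u v → crossC (deriv z u) (deriv z v) ≠ 0 := by
    intro u v huv
    obtain ⟨k, hk, h1⟩ := hcross u v huv.1
    rw [h1, neg_ne_zero]
    exact mul_ne_zero (mul_ne_zero hk.ne' hd0) huv.tripleDet_ne_zero
  have hs1 : P.toFun (s + 1) = P.toFun s := P.periodic s
  have hds1 : deriv z (s + 1) = deriv z s := by
    have := P.deriv_add_int s 1
    rw [Int.cast_one] at this
    rw [(hz' (s + 1)).deriv, (hz' s).deriv]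
    simp only [hy, hs1, this]
  have main := sum_sign_crossC_eq_zero hzC hst ht ((hzinj _ _).2 h) ((hzinj _ _).2 hs1) hds1
    (hcross0 s t (hdbl s t le_rfl hst ht h)) F (fun p => by rw [hF, hzinj])
    (fun p hp => by
      obtain ⟨h1, h2, h3⟩ := (hF p).1 hp
      exact hcross0 _ _ (hdbl _ _ h1.1.le (h1.2.trans h2.1) h2.2 h3))
    (fun u hu h1 => by
      have h2 := (hdbl s u le_rfl hu.1 (hu.2.trans ht) ((hzinj _ _).1 h1).symm).sameParam_of_left
        (hdbl s t le_rfl hst ht h)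
      exact hu.2.ne (h2.eq_of_abs_sub_lt (by rw [abs_lt]; constructor <;> linarith [hu.1, hu.2])))
    (fun v hv h1 => by
      have h2 := (hdbl s v le_rfl (hst.trans hv.1) hv.2
        ((hzinj _ _).1 h1).symm).sameParam_of_left (hdbl s t le_rfl hst ht h)
      exact hv.1.ne' (h2.eq_of_abs_sub_lt (by rw [abs_lt]; constructor <;> linarith [hv.1, hv.2])))
    (fun u hu u' hu' v hv h1 h2 => by
      have h3 := (hdbl u v hu.1.le (hu.2.trans hv.1) hv.2 ((hzinj _ _).1 h1)).symm.sameParam_of_left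
        (hdbl u' v hu'.1.le (hu'.2.trans hv.1) hv.2 ((hzinj _ _).1 h2)).symm
      exact h3.eq_of_abs_sub_lt
        (by rw [abs_lt]; constructor <;> linarith [hu.1, hu.2, hu'.1, hu'.2]))
  -- Projection and isometry change all signs by one common factor, which is irrelevant for a
  -- vanishing sum.
  have hsgn : ∀ p ∈ F, (if crossC (deriv z p.1) (deriv z p.2) < 0 then (-1 : ℤ) else 1) =
      (if 0 < d then -1 else 1) * P.sgn p.1 p.2 := by
    intro p hp
    obtain ⟨h1, h2, h3⟩ := (hF p).1 hp
    have hp' := hdbl _ _ h1.1.le (h1.2.trans h2.1) h2.2 h3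
    obtain ⟨k, hk, h4⟩ := hcross p.1 p.2 hp'.1
    rw [h4, sgn]
    rcases lt_or_gt_of_ne hd0 with h5 | h5 <;>
      rcases lt_or_gt_of_ne hp'.tripleDet_ne_zero with h6 | h6
    · have := mul_pos_of_neg_of_neg (mul_neg_of_pos_of_neg hk h5) h6
      simp [this, h5.not_gt, h6]
    · have := mul_neg_of_neg_of_pos (mul_neg_of_pos_of_neg hk h5) h6
      simp [this.not_gt, h5.not_gt, h6.not_gt]
    · have := mul_neg_of_pos_of_neg (mul_pos hk h5) h6
      simp [this.le, h5, h6]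
    · have := mul_pos (mul_pos hk h5) h6
      simp [this, h5, h6.not_gt]
  rw [Finset.sum_congr rfl hsgn, ← Finset.mul_sum, mul_eq_zero] at main
  rcases main with h1 | h1
  · split_ifs at h1
    simp at h1
  · exact h1

end SphericalCurve

/-! ### Independence of the base point. -/

theorem crossSum_union_left {S S' T : Finset (ℝ × ℝ)} (h : Disjoint S S') (f : ℝ × ℝ → ℤ) :
    crossSum (S ∪ S') T f = crossSum S T f + crossSum S' T f := by
  classical
  exact Finset.sum_union h

theorem crossSum_union_right {S T T' : Finset (ℝ × ℝ)} (h : Disjoint T T') (f : ℝ × ℝ → ℤ) :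
    crossSum S (T ∪ T') f = crossSum S T f + crossSum S T' f := by
  classical
  unfold crossSum
  rw [← Finset.sum_add_distrib]
  exact Finset.sum_congr rfl fun c _ => Finset.sum_union h

theorem crossSum_union {S N : Finset (ℝ × ℝ)} (h : Disjoint S N) (f : ℝ × ℝ → ℤ) :
    crossSum (S ∪ N) (S ∪ N) f =
      crossSum S S f + (crossSum S N f + crossSum N S f) + crossSum N N f := by
  rw [crossSum_union_left h, crossSum_union_right h, crossSum_union_right h]
  ring

theorem not_interlaced_self (c : ℝ × ℝ) : ¬ Interlaced c c := fun h => lt_irrefl _ h.1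

open Classical in
theorem crossSum_singleton_singleton (c d : ℝ × ℝ) (f : ℝ × ℝ → ℤ) :
    crossSum {c} {d} f = if Interlaced c d then f c * f d else 0 := by
  simp [crossSum]

open Classical in
theorem crossSum_singleton_left (c : ℝ × ℝ) (T : Finset (ℝ × ℝ)) (f : ℝ × ℝ → ℤ) :
    crossSum {c} T f = f c * ∑ d ∈ T with Interlaced c d, f d := by
  simp [crossSum, Finset.sum_filter, Finset.mul_sum]

open Classical in
theorem crossSum_singleton_right (S : Finset (ℝ × ℝ)) (d : ℝ × ℝ) (f : ℝ × ℝ → ℤ) :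
    crossSum S {d} f = f d * ∑ c ∈ S with Interlaced c d, f c := by
  simp [crossSum, Finset.sum_filter, Finset.mul_sum, mul_comm]

namespace SphericalCurve

variable {P : SphericalCurve}

theorem chords_eq_of_forall_not_isDoubleParam {b b' : ℝ} (h : b ≤ b')
    (hd : ∀ t ∈ Icc b b', ¬ P.IsDoubleParam t) : P.chords b' = P.chords b := by
  have hd' : ∀ t ∈ Icc (b + 1) (b' + 1), ¬ P.IsDoubleParam t := by
    intro t ht h1
    refine hd (t - 1) ⟨by linarith [ht.1], by linarith [ht.2]⟩ ?_
    rwa [← isDoubleParam_add_one, sub_add_cancel]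
  ext p
  rw [mem_chords_iff_isDoublePair, mem_chords_iff_isDoublePair]
  constructor
  · rintro ⟨h1, h2, h3, h4⟩
    refine ⟨by linarith, h2, ?_, h4⟩
    by_contra h5
    exact hd' _ ⟨not_lt.1 h5, h3.le⟩ h4.right
  · rintro ⟨h1, h2, h3, h4⟩
    refine ⟨?_, h2, by linarith, h4⟩
    by_contra h5
    exact hd _ ⟨h1.le, not_lt.1 h5⟩ h4.left

/-- The effect on the chords of moving the base point past the endpoint `e` of a chord. -/
theorem exists_chords_eq_union {b b' e : ℝ} (hbe : b < e) (heb : e < b')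
    (hd : ∀ t ∈ Icc b b', P.IsDoubleParam t → t = e) (he : P.IsDoubleParam e) :
    ∃ (e' : ℝ) (C : Finset (ℝ × ℝ)), e' ∈ Ioo b' (b + 1) ∧ P.IsDoublePair e e' ∧
      (∀ p ∈ C, b' < p.1 ∧ p.1 < p.2 ∧ p.2 < b + 1 ∧ P.toFun p.1 = P.toFun p.2) ∧
      Disjoint C {(e, e')} ∧ Disjoint C {(e', e + 1)} ∧
      P.chords b = C ∪ {(e, e')} ∧ P.chords b' = C ∪ {(e', e + 1)} := by
  classical
  have hb : P.IsBase b := fun h => hbe.ne (hd b ⟨le_rfl, by linarith⟩ h)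
  have hd' : ∀ t ∈ Icc (b + 1) (b' + 1), P.IsDoubleParam t → t = e + 1 := by
    intro t ht h1
    have := hd (t - 1) ⟨by linarith [ht.1], by linarith [ht.2]⟩
      (by rwa [← isDoubleParam_add_one, sub_add_cancel])
    linarith
  obtain ⟨e₁, he₁⟩ := he
  obtain ⟨e', he', h1⟩ := hb.exists_sameParam_mem_Ioo he₁.right
  have hee : P.IsDoublePair e e' := he₁.of_sameParam (SameParam.refl e) h1
  have hne : e' ≠ e := by
    rintro rfl
    exact hee.2 (SameParam.refl _)
  have hbe' : b' < e' := by
    by_contra h2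
    exact hne (hd e' ⟨he'.1.le, not_lt.1 h2⟩ hee.right)
  have hmem : (e, e') ∈ P.chords b :=
    mem_chords_iff_isDoublePair.2 ⟨hbe, by simp only; linarith, he'.2, hee⟩
  have key : ∀ p, p ∈ (P.chords b).erase (e, e') ↔
      b' < p.1 ∧ p.1 < p.2 ∧ p.2 < b + 1 ∧ P.toFun p.1 = P.toFun p.2 := by
    rintro ⟨s, t⟩
    rw [Finset.mem_erase, mem_chords_iff_isDoublePair]
    simp only
    constructor
    · rintro ⟨h2, h3, h4, h5, h6⟩
      refine ⟨?_, h4, h5, h6.1⟩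
      by_contra h7
      have h8 : s = e := hd s ⟨h3.le, not_lt.1 h7⟩ h6.left
      subst h8
      apply h2
      rw [(h6.sameParam_of_left hee).eq_of_abs_sub_lt
        (by rw [abs_lt]; constructor <;> linarith [he'.1, he'.2])]
    · rintro ⟨h2, h3, h4, h5⟩
      refine ⟨?_, by linarith, h3, h4, .of_lt (b := b) (by linarith) h3 h4 h5⟩
      rintro h6
      have := (Prod.ext_iff.1 h6).1
      simp only at this
      linarith
  refine ⟨e', (P.chords b).erase (e, e'), ⟨hbe', he'.2⟩, hee, fun p hp => (key p).1 hp, ?_, ?_, ?_,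
    ?_⟩
  · simp
  · rw [Finset.disjoint_singleton_right, key]
    simp only
    intro h2
    linarith
  · ext p
    by_cases h2 : p = (e, e')
    · simp [h2, hmem]
    · simp [h2]
  · ext p
    rw [Finset.mem_union, key, Finset.mem_singleton, mem_chords_iff_isDoublePair]
    obtain ⟨s, t⟩ := p
    simp only [Prod.mk.injEq]
    constructor
    · rintro ⟨h2, h3, h4, h5⟩
      by_cases h6 : t < b + 1
      · exact Or.inl ⟨h2, h3, h6, h5.1⟩
      · have h7 : t = e + 1 := hd' t ⟨not_lt.1 h6, h4.le⟩ h5.right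
        subst h7
        refine Or.inr ⟨?_, rfl⟩
        have h8 : P.IsDoublePair e s := h5.symm.of_sameParam
          (SameParam.symm ⟨1, by simp⟩) (SameParam.refl s)
        refine (h8.sameParam_of_left hee).eq_of_abs_sub_lt ?_
        rw [abs_lt]
        constructor <;> linarith [he'.1, he'.2]
    · rintro (⟨h2, h3, h4, h5⟩ | ⟨rfl, rfl⟩)
      · exact ⟨h2, h3, by linarith, .of_lt (b := b) (by linarith) h3 h4 h5⟩
      · exact ⟨hbe', by linarith [he'.2], by linarith,
          hee.symm.of_sameParam (SameParam.refl _) ⟨1, by simp⟩⟩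

/-- The moved chord `(e, e')` becomes `(e', e + 1)`. In either position it is interlaced with
exactly the chords that separate at `e'`, so only the factor given by its own sign changes, and this
factor multiplies a sum that vanishes. -/
theorem crossSum_step {b b' e : ℝ} (hbe : b < e) (heb : e < b')
    (hd : ∀ t ∈ Icc b b', P.IsDoubleParam t → t = e) :
    crossSum (P.chords b') (P.chords b') (fun _ => 1) =
      crossSum (P.chords b) (P.chords b) (fun _ => 1) ∧
    crossSum (P.chords b') (P.chords b') P.chordSgn =
      crossSum (P.chords b) (P.chords b) P.chordSgn := by
  classical
  by_cases he : P.IsDoubleParam e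
  · obtain ⟨e', C, he', hee, hC, hd1, hd2, h1, h2⟩ := exists_chords_eq_union hbe heb hd he
    have n1 : ∀ c ∈ C, ¬ Interlaced c (e, e') := fun c hc h => by
      have := h.1
      have := (hC c hc).1
      simp only at *
      linarith
    have n2 : ∀ c ∈ C, ¬ Interlaced (e', e + 1) c := fun c hc h => by
      have := h.2.2
      have := (hC c hc).2.2.1
      simp only at *
      linarith
    have n3 : ∀ c ∈ C, (Interlaced (e, e') c ↔ c.1 < e' ∧ e' < c.2) := fun c hc => by
      have := (hC c hc).1
      simp only [Interlaced]
      exact ⟨fun h => h.2, fun h => ⟨by linarith, h⟩⟩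
    have n4 : ∀ c ∈ C, (Interlaced c (e', e + 1) ↔ c.1 < e' ∧ e' < c.2) := fun c hc => by
      have := (hC c hc).2.2.1
      simp only [Interlaced]
      exact ⟨fun h => ⟨h.1, h.2.1⟩, fun h => ⟨h.1, h.2, by linarith⟩⟩
    have hsum : ∀ f : ℝ × ℝ → ℤ,
        crossSum (P.chords b) (P.chords b) f = crossSum C C f +
          f (e, e') * ∑ c ∈ C with c.1 < e' ∧ e' < c.2, f c ∧
        crossSum (P.chords b') (P.chords b') f = crossSum C C f +
          f (e', e + 1) * ∑ c ∈ C with c.1 < e' ∧ e' < c.2, f c := by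
      intro f
      rw [h1, h2, crossSum_union hd1, crossSum_union hd2]
      simp only [crossSum_singleton_left, crossSum_singleton_right]
      rw [Finset.filter_false_of_mem n1, Finset.filter_false_of_mem n2,
        Finset.filter_congr n3, Finset.filter_congr n4]
      simp [Finset.filter_singleton, not_interlaced_self]
    -- The chords interlaced with `(e, e')` are the crossings of the two loops at this double point,
    -- each read from the first loop to the second.
    have hB : ∑ c ∈ C with c.1 < e' ∧ e' < c.2, P.chordSgn c = 0 := by
      refine P.sum_sgn_eq_zero (s := e) (t := e') (by linarith [he'.1]) (by linarith [he'.2]) hee.1 _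
        fun p => ?_
      rw [Finset.mem_filter]
      constructor
      · rintro ⟨h3, h4, h5⟩
        obtain ⟨h6, h7, h8, h9⟩ := hC p h3
        exact ⟨⟨by linarith, h4⟩, ⟨h5, by linarith⟩, h9⟩
      · rintro ⟨h3, h4, h5⟩
        -- A crossing of the loops cannot have its second end beyond `b + 1`: shifted back by one
        -- period, that end would lie in `[b, e)`, where there are no double points.
        have h6 : p.1 < p.2 := h3.2.trans h4.1
        have h7 : P.IsDoublePair p.1 p.2 := .of_lt (b := b) (by linarith [h3.1]) h6 (by
          by_contra h8
          have h9 : P.IsDoubleParam p.2 := ⟨p.1, h5.symm, fun h10 => by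
            have := h10.eq_of_abs_sub_lt (by
              rw [abs_lt]; constructor <;> linarith [h3.1, h4.2])
            linarith⟩
          have h10 := hd (p.2 - 1) ⟨by linarith [not_lt.1 h8], by linarith [h4.2]⟩
            (by rwa [← isDoubleParam_add_one, sub_add_cancel])
          linarith [h4.2]) h5
        have h8 : p.2 < b + 1 := by
          by_contra h8
          have h10 := hd (p.2 - 1) ⟨by linarith [not_lt.1 h8], by linarith [h4.2]⟩
            (by rw [← isDoubleParam_add_one, sub_add_cancel]; exact h7.right)
          linarith [h4.2]
        have h9 : p ∈ P.chords b :=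
          mem_chords.2 ⟨by linarith [h3.1], h6, h8, h5⟩
        rw [h1, Finset.mem_union, Finset.mem_singleton] at h9
        refine ⟨h9.resolve_right ?_, h3.2, h4.1⟩
        rintro rfl
        exact lt_irrefl _ h3.1
    constructor
    · rw [(hsum _).1, (hsum _).2]
    · rw [(hsum _).1, (hsum _).2, hB, mul_zero, mul_zero]
  · rw [chords_eq_of_forall_not_isDoubleParam (hbe.trans heb).le fun t ht h =>
      he (hd t ht h ▸ h)]
    exact ⟨rfl, rfl⟩

/-- Around every parameter the two sums take one value on both sides: by `crossSum_step` across a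
double point, and trivially otherwise. A base point is not a double point, so its own value agrees
with the nearby one. -/
theorem crossSum_chords_eq {b b' : ℝ} (hb : P.IsBase b) (hb' : P.IsBase b') :
    crossSum (P.chords b') (P.chords b') (fun _ => 1) =
      crossSum (P.chords b) (P.chords b) (fun _ => 1) ∧
    crossSum (P.chords b') (P.chords b') P.chordSgn =
      crossSum (P.chords b) (P.chords b) P.chordSgn := by
  set f : ℝ → ℤ × ℤ := fun b => (crossSum (P.chords b) (P.chords b) (fun _ => 1),
    crossSum (P.chords b) (P.chords b) P.chordSgn) with hf
  have hcongr : ∀ {b b' : ℝ}, P.chords b' = P.chords b → f b' = f b := by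
    intro b b' h
    simp only [hf, h]
  have hη : ∀ x : ℝ, ∃ η > 0, η < 1 / 2 ∧
      ∀ y, |y - x| < η → P.IsDoubleParam y → y = x := by
    intro x
    obtain ⟨η, h1, h2⟩ := Metric.eventually_nhds_iff.1
      (eventually_nhdsWithin_iff.1 (P.eventually_not_isDoubleParam x))
    refine ⟨min η (1 / 3), by positivity, (min_le_right _ _).trans_lt (by norm_num), ?_⟩
    intro y hy h3
    by_contra h4
    exact h2 (y := y) (lt_of_lt_of_le hy (min_le_left _ _)) h4 h3
  have h1 : ∀ x, ∃ a, ∀ᶠ y in 𝓝[≠] x, f y = a := by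
    intro x
    obtain ⟨η, h2, h3, h4⟩ := hη x
    refine ⟨f (x - η / 2), ?_⟩
    have h5 : ∀ᶠ y in 𝓝 x, |y - x| < η / 2 := by
      filter_upwards [Metric.ball_mem_nhds x (half_pos h2)] with y hy
      simpa [Real.dist_eq] using hy
    filter_upwards [h5.filter_mono nhdsWithin_le_nhds, self_mem_nhdsWithin] with y hy hyx
    rw [abs_lt] at hy
    rcases lt_or_gt_of_ne hyx with h6 | h6
    · refine hcongr (chords_eq_of_forall_not_isDoubleParam (by linarith) ?_)
      intro t ht h7
      have := h4 t (by rw [abs_lt]; constructor <;> linarith [ht.1, ht.2]) h7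
      linarith [ht.2]
    · have h7 := crossSum_step (P := P) (b := x - η / 2) (b' := y) (e := x) (by linarith) h6
        fun t ht h7 => h4 t (by rw [abs_lt]; constructor <;> linarith [ht.1, ht.2]) h7
      exact Prod.ext h7.1 h7.2
  obtain ⟨a, ha⟩ := exists_eventually_eq_of_punctured h1
  have h2 : ∀ b, P.IsBase b → f b = a := by
    intro b hb
    obtain ⟨η, h3, h4, h5⟩ := hη b
    obtain ⟨y, hy, hy'⟩ := (((ha b).filter_mono
      (nhdsWithin_mono b fun v (hv : v ∈ Ioi b) => ne_of_gt hv)).and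
      (Ioo_mem_nhdsGT (show b < b + η by linarith))).exists
    rw [← hy]
    refine (hcongr (chords_eq_of_forall_not_isDoubleParam hy'.1.le ?_)).symm
    intro t ht h6
    have := h5 t (by rw [abs_lt]; constructor <;> linarith [ht.1, ht.2, hy'.2]) h6
    exact hb (this ▸ h6)
  have h3 := (h2 b' hb').trans (h2 b hb).symm
  exact ⟨congrArg Prod.fst h3, congrArg Prod.snd h3⟩

/-- `x` does not depend on the base point. -/
theorem xTotal_eq_of_isBase {b b' : ℝ} (hb : P.IsBase b) (hb' : P.IsBase b') :
    P.xTotal b' = P.xTotal b := by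
  have := (crossSum_chords_eq hb hb').1
  rw [← xTotal_eq, ← xTotal_eq] at this
  exact_mod_cast this

/-- `μ` does not depend on the base point. -/
theorem mu_eq_of_isBase {b b' : ℝ} (hb : P.IsBase b) (hb' : P.IsBase b') :
    P.mu b' = P.mu b := by
  rw [mu_eq, mu_eq, (crossSum_chords_eq hb hb').2]

end SphericalCurve

/-! ### Reversal of the curve. -/

theorem crossSum_image {S : Finset (ℝ × ℝ)} {g : ℝ × ℝ → ℝ × ℝ} (hg : Function.Injective g)
    {f f' : ℝ × ℝ → ℤ} (hi : ∀ c d, Interlaced (g c) (g d) ↔ Interlaced c d)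
    (hf : ∀ c ∈ S, f' (g c) = f c) : crossSum (S.image g) (S.image g) f' = crossSum S S f := by
  classical
  unfold crossSum
  rw [Finset.sum_image hg.injOn]
  refine Finset.sum_congr rfl fun c hc => ?_
  rw [Finset.sum_image hg.injOn]
  refine Finset.sum_congr rfl fun d hd => ?_
  simp only [hi, hf c hc, hf d hd]

theorem crossSum_image_swap {S : Finset (ℝ × ℝ)} {g : ℝ × ℝ → ℝ × ℝ} (hg : Function.Injective g)
    {f f' : ℝ × ℝ → ℤ} {κ : ℤ} (hκ : κ * κ = 1)
    (hi : ∀ c d, Interlaced (g c) (g d) ↔ Interlaced d c)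
    (hf : ∀ c ∈ S, f' (g c) = κ * f c) : crossSum (S.image g) (S.image g) f' = crossSum S S f := by
  classical
  unfold crossSum
  rw [Finset.sum_image hg.injOn]
  conv_rhs => rw [Finset.sum_comm]
  refine Finset.sum_congr rfl fun c hc => ?_
  rw [Finset.sum_image hg.injOn]
  refine Finset.sum_congr rfl fun d hd => ?_
  simp only [hi, hf c hc, hf d hd]
  congr 1
  linear_combination (f c * f d) * hκ

namespace SphericalCurve

/-- The curve run through in the opposite direction. -/
noncomputable def rev (P : SphericalCurve) : SphericalCurve where
  toFun t := P.toFun (-t)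
  smooth := P.smooth.comp contDiff_neg
  periodic t := by
    have := P.apply_add_int (-t) (-1)
    rw [neg_add]
    simpa using this
  norm_eq_one t := P.norm_eq_one _
  immersion t := by
    rw [deriv_comp_neg, neg_ne_zero]
    exact P.immersion _
  transverse s t h h' := by
    have h1 : ¬ SameParam (-s) (-t) := by
      rintro ⟨n, hn⟩
      exact h' ⟨-n, by push_cast; linarith⟩
    have h2 := P.transverse (-s) (-t) h h1
    rw [LinearIndependent.pair_iff] at h2 ⊢
    intro a b hab
    rw [deriv_comp_neg, deriv_comp_neg] at hab
    have := h2 (-a) (-b) (by rw [← hab]; simp)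
    simpa using this
  no_triple r s t h h' := by
    have key : ∀ x y : ℝ, SameParam (-x) (-y) → SameParam x y := by
      rintro x y ⟨n, hn⟩
      exact ⟨-n, by push_cast; linarith⟩
    exact (P.no_triple (-r) (-s) (-t) h h').imp (key _ _) (Or.imp (key _ _) (key _ _))

variable {P Q : SphericalCurve}

theorem sameParam_neg {s t : ℝ} : SameParam (-s) (-t) ↔ SameParam s t := by
  constructor
  · rintro ⟨n, hn⟩
    exact ⟨-n, by push_cast; linarith⟩
  · rintro ⟨n, hn⟩
    exact ⟨-n, by push_cast; linarith⟩

theorem isDoublePair_rev {s t : ℝ} : P.rev.IsDoublePair s t ↔ P.IsDoublePair (-s) (-t) :=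
  and_congr Iff.rfl (not_congr sameParam_neg.symm)

theorem isDoubleParam_rev {t : ℝ} : P.rev.IsDoubleParam t ↔ P.IsDoubleParam (-t) := by
  constructor
  · rintro ⟨s, hs⟩
    exact ⟨-s, isDoublePair_rev.1 hs⟩
  · rintro ⟨s, hs⟩
    exact ⟨-s, isDoublePair_rev.2 (by rwa [neg_neg])⟩

theorem deriv_rev (t : ℝ) : deriv P.rev.toFun t = -deriv P.toFun (-t) := by
  change deriv (fun t => P.toFun (-t)) t = _
  rw [deriv_comp_neg]

theorem sgn_rev (s t : ℝ) : P.rev.sgn s t = P.sgn (-s) (-t) := by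
  unfold sgn
  rw [deriv_rev, deriv_rev, ← neg_one_smul ℝ, ← neg_one_smul ℝ (deriv P.toFun (-t)),
    tripleDet_smul_smul]
  norm_num
  rfl

theorem chords_rev (b : ℝ) :
    P.rev.chords (-b - 1) = (P.chords b).image fun c => (-c.2, -c.1) := by
  ext ⟨s, t⟩
  simp only [mem_chords, Finset.mem_image, Prod.mk.injEq, Prod.exists]
  constructor
  · rintro ⟨h1, h2, h3, h4⟩
    exact ⟨-t, -s, ⟨by linarith, by linarith, by linarith, h4.symm⟩, by simp⟩
  · rintro ⟨s, t, ⟨h1, h2, h3, h4⟩, rfl, rfl⟩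
    refine ⟨by linarith, by linarith, by linarith, ?_⟩
    change P.toFun (- -t) = P.toFun (- -s)
    rw [neg_neg, neg_neg, h4]

theorem IsBase.rev {b : ℝ} (hb : P.IsBase b) : P.rev.IsBase (-b - 1) := by
  intro h
  rw [isDoubleParam_rev] at h
  have e : -(-b - 1) = b + 1 := by ring
  rw [e, isDoubleParam_add_one] at h
  exact hb h

theorem neg_swap_injective : Function.Injective fun c : ℝ × ℝ => (-c.2, -c.1) := by
  rintro ⟨a, b⟩ ⟨c, d⟩ h
  simp only [Prod.mk.injEq, neg_inj] at h
  rw [h.1, h.2]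

theorem interlaced_neg_swap (c d : ℝ × ℝ) :
    Interlaced (-c.2, -c.1) (-d.2, -d.1) ↔ Interlaced d c := by
  simp only [Interlaced, neg_lt_neg_iff]
  tauto

/-- Negating both velocities does not change a sign, but exchanging the ends of the chord does. All
chord signs change together, and products of two of them stay. The period after `-b - 1` is the
mirror image of the one after `b`. -/
theorem crossSum_chords_rev (b : ℝ) :
    crossSum (P.rev.chords (-b - 1)) (P.rev.chords (-b - 1)) (fun _ => 1) =
      crossSum (P.chords b) (P.chords b) (fun _ => 1) ∧
    crossSum (P.rev.chords (-b - 1)) (P.rev.chords (-b - 1)) P.rev.chordSgn =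
      crossSum (P.chords b) (P.chords b) P.chordSgn := by
  rw [chords_rev]
  constructor
  · exact crossSum_image_swap (κ := 1) neg_swap_injective (by norm_num) interlaced_neg_swap
      fun _ _ => by simp
  · refine crossSum_image_swap (κ := -1) neg_swap_injective (by norm_num) interlaced_neg_swap
      fun c hc => ?_
    rw [chordSgn, sgn_rev, neg_neg, neg_neg, (isDoublePair_of_mem_chords hc).sgn_swap, chordSgn]
    ring

theorem numDouble_rev : P.rev.numDouble = P.numDouble := by
  obtain ⟨b, hb⟩ := P.exists_isBase
  rw [numDouble_eq_card_chords hb, numDouble_eq_card_chords hb.rev, chords_rev,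
    Finset.card_image_of_injective _ neg_swap_injective]

/-- Reversal turns arriving arcs into leaving ones, so an adjacency is mapped to an adjacency with
the two points exchanged. -/
theorem SeifertAdj.neg (hPQ : ∀ s t, P.IsDoublePair s t ↔ Q.IsDoublePair (-s) (-t))
    (hPQ' : ∀ t, P.IsDoubleParam t ↔ Q.IsDoubleParam (-t))
    {t u : {t : ℝ // ¬ P.IsDoubleParam t}} (h : P.SeifertAdj t u) :
    Q.SeifertAdj ⟨-u.1, fun h => u.2 ((hPQ' _).2 h)⟩ ⟨-t.1, fun h => t.2 ((hPQ' _).2 h)⟩ := by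
  have hneg : ∀ v, ¬ P.IsDoubleParam (-v) → ¬ Q.IsDoubleParam v := fun v h h' =>
    h ((hPQ' _).2 (by rwa [neg_neg]))
  rcases h with h | ⟨h1, h2⟩ | ⟨p, q, h1, h2, h3, h4, h5⟩
  · left
    simp only
    linarith
  · refine Or.inr (Or.inl ⟨neg_le_neg h1, fun v hv => hneg v (h2 (-v) ?_)⟩)
    simp only [mem_Icc] at hv ⊢
    constructor <;> linarith
  · refine Or.inr (Or.inr ⟨-q, -p, ((hPQ p q).1 h1).symm, neg_lt_neg h4, fun v hv => hneg v
      (h5 (-v) ?_), neg_lt_neg h2, fun v hv => hneg v (h3 (-v) ?_)⟩)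
    · simp only [mem_Ico, mem_Ioc] at hv ⊢
      constructor <;> linarith
    · simp only [mem_Ico, mem_Ioc] at hv ⊢
      constructor <;> linarith

theorem numSeifert_rev : P.rev.numSeifert = P.numSeifert := by
  have h1 : ∀ s t, P.rev.IsDoublePair s t ↔ P.IsDoublePair (-s) (-t) := fun s t => isDoublePair_rev
  have h2 : ∀ t, P.rev.IsDoubleParam t ↔ P.IsDoubleParam (-t) := fun t => isDoubleParam_rev
  have h3 : ∀ s t, P.IsDoublePair s t ↔ P.rev.IsDoublePair (-s) (-t) := fun s t => by
    rw [h1, neg_neg, neg_neg]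
  have h4 : ∀ t, P.IsDoubleParam t ↔ P.rev.IsDoubleParam (-t) := fun t => by
    rw [h2, neg_neg]
  refine Nat.card_congr ⟨Quot.lift (fun t => Quot.mk _ ⟨-t.1, fun h => t.2 ((h2 _).2 h)⟩) ?_,
    Quot.lift (fun t => Quot.mk _ ⟨-t.1, fun h => t.2 ((h4 _).2 h)⟩) ?_, ?_, ?_⟩
  · exact fun t u h => (Quot.sound (h.neg h1 h2)).symm
  · exact fun t u h => (Quot.sound (h.neg h3 h4)).symm
  · rintro ⟨t⟩
    simp
  · rintro ⟨t⟩
    simp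

/-! ### Increasing reparametrizations -/

section Transport

variable {e : ℝ ≃o ℝ} (he : ∀ t, e (t + 1) = e t + 1)
  (hPQ : ∀ s t, P.IsDoublePair s t ↔ Q.IsDoublePair (e s) (e t))
include hPQ

theorem isDoubleParam_iff_of_transport (t : ℝ) : P.IsDoubleParam t ↔ Q.IsDoubleParam (e t) := by
  constructor
  · rintro ⟨s, hs⟩
    exact ⟨e s, (hPQ _ _).1 hs⟩
  · rintro ⟨s, hs⟩
    exact ⟨e.symm s, (hPQ _ _).2 (by simpa using hs)⟩

theorem isDoublePair_iff_of_transport_symm (s t : ℝ) :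
    Q.IsDoublePair s t ↔ P.IsDoublePair (e.symm s) (e.symm t) := by
  rw [hPQ, OrderIso.apply_symm_apply, OrderIso.apply_symm_apply]

include he

theorem chords_of_transport (b : ℝ) :
    Q.chords (e b) = (P.chords b).image fun c => (e c.1, e c.2) := by
  ext ⟨s, t⟩
  simp only [mem_chords_iff_isDoublePair, Finset.mem_image, Prod.mk.injEq, Prod.exists, ← he]
  constructor
  · rintro ⟨h1, h2, h3, h4⟩
    refine ⟨e.symm s, e.symm t, ⟨?_, ?_, ?_, ?_⟩, by simp⟩
    · rwa [e.lt_symm_apply]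
    · rwa [e.symm.lt_iff_lt]
    · rwa [e.symm_apply_lt]
    · exact (isDoublePair_iff_of_transport_symm hPQ _ _).1 h4
  · rintro ⟨s, t, ⟨h1, h2, h3, h4⟩, rfl, rfl⟩
    exact ⟨e.lt_iff_lt.2 h1, e.lt_iff_lt.2 h2, e.lt_iff_lt.2 h3, (hPQ _ _).1 h4⟩

theorem SeifertAdj.transport {t u : {t : ℝ // ¬ P.IsDoubleParam t}} (h : P.SeifertAdj t u) :
    Q.SeifertAdj ⟨e t.1, fun h => t.2 ((isDoubleParam_iff_of_transport hPQ _).2 h)⟩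
      ⟨e u.1, fun h => u.2 ((isDoubleParam_iff_of_transport hPQ _).2 h)⟩ := by
  have hsymm : ∀ v, ¬ P.IsDoubleParam (e.symm v) → ¬ Q.IsDoubleParam v := fun v h h' =>
    h ((isDoubleParam_iff_of_transport hPQ _).2 (by simpa using h'))
  rcases h with h | ⟨h1, h2⟩ | ⟨p, q, h1, h2, h3, h4, h5⟩
  · left
    simp only [h, he]
  · refine Or.inr (Or.inl ⟨e.monotone h1, fun v hv => hsymm v (h2 _ ?_)⟩)
    exact ⟨e.le_symm_apply.2 hv.1, e.symm_apply_le.2 hv.2⟩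
  · refine Or.inr (Or.inr ⟨e p, e q, (hPQ p q).1 h1, e.lt_iff_lt.2 h2, fun v hv => hsymm v
      (h3 _ ?_), e.lt_iff_lt.2 h4, fun v hv => hsymm v (h5 _ ?_)⟩)
    · exact ⟨e.le_symm_apply.2 hv.1, e.symm_apply_lt.2 hv.2⟩
    · exact ⟨e.lt_symm_apply.2 hv.1, e.symm_apply_le.2 hv.2⟩

theorem numSeifert_of_transport : Q.numSeifert = P.numSeifert := by
  have he' : ∀ t, e.symm (t + 1) = e.symm t + 1 := fun t => by
    apply e.injective
    rw [he]
    simp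
  have hQP := isDoublePair_iff_of_transport_symm hPQ
  refine Nat.card_congr (Equiv.symm ⟨Quot.lift (fun t => Quot.mk _ ⟨e t.1, fun h => t.2
    ((isDoubleParam_iff_of_transport hPQ _).2 h)⟩) ?_, Quot.lift (fun t => Quot.mk _ ⟨e.symm t.1,
    fun h => t.2 ((isDoubleParam_iff_of_transport hQP _).2 h)⟩) ?_, ?_, ?_⟩)
  · exact fun t u h => Quot.sound (h.transport he hPQ)
  · exact fun t u h => Quot.sound (h.transport he' hQP)
  · rintro ⟨t⟩
    simp
  · rintro ⟨t⟩
    simp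

end Transport

/-! ### Invariance under isotopy. -/

/-- Equality of all the invariants of two spherical curves. -/
structure SameInvariants (P Q : SphericalCurve) : Prop where
  xTotal : ∀ b b', P.IsBase b → Q.IsBase b' → Q.xTotal b' = P.xTotal b
  mu : ∀ b b', P.IsBase b → Q.IsBase b' → Q.mu b' = P.mu b
  kappa : Q.kappa = P.kappa

/-- One pair of base points suffices, since the invariants do not depend on them. -/
theorem SameInvariants.of_base {b b' : ℝ} (hb : P.IsBase b) (hb' : Q.IsBase b')
    (h1 : crossSum (Q.chords b') (Q.chords b') (fun _ => 1) =
      crossSum (P.chords b) (P.chords b) (fun _ => 1))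
    (h2 : crossSum (Q.chords b') (Q.chords b') Q.chordSgn =
      crossSum (P.chords b) (P.chords b) P.chordSgn)
    (h3 : Q.numSeifert = P.numSeifert) (h4 : Q.numDouble = P.numDouble) : SameInvariants P Q where
  xTotal c c' hc hc' := by
    rw [xTotal_eq_of_isBase hb hc, xTotal_eq_of_isBase hb' hc']
    rw [← xTotal_eq, ← xTotal_eq] at h1
    exact_mod_cast h1
  mu c c' hc hc' := by
    rw [mu_eq_of_isBase hb hc, mu_eq_of_isBase hb' hc', mu_eq, mu_eq, h2, h3, h4]
  kappa := by rw [SphericalCurve.kappa, SphericalCurve.kappa, h3, h4]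

theorem SameInvariants.trans {R : SphericalCurve} (h : SameInvariants P Q)
    (h' : SameInvariants Q R) : SameInvariants P R := by
  obtain ⟨b, hb⟩ := Q.exists_isBase
  exact ⟨fun c c' hc hc' => (h'.xTotal b c' hb hc').trans (h.xTotal c b hc hb),
    fun c c' hc hc' => (h'.mu b c' hb hc').trans (h.mu c b hc hb), h'.kappa.trans h.kappa⟩

theorem sameInvariants_rev : SameInvariants P P.rev := by
  obtain ⟨b, hb⟩ := P.exists_isBase
  exact .of_base hb hb.rev (crossSum_chords_rev b).1 (crossSum_chords_rev b).2 numSeifert_rev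
    numDouble_rev

theorem sameInvariants_of_transport {e : ℝ ≃o ℝ} (he : ∀ t, e (t + 1) = e t + 1)
    (hPQ : ∀ s t, P.IsDoublePair s t ↔ Q.IsDoublePair (e s) (e t))
    (hsgn : ∀ s t, P.IsDoublePair s t → Q.sgn (e s) (e t) = P.sgn s t) : SameInvariants P Q := by
  obtain ⟨b, hb⟩ := P.exists_isBase
  have hb' : Q.IsBase (e b) := fun h => hb ((isDoubleParam_iff_of_transport hPQ b).2 h)
  have hinj : Function.Injective fun c : ℝ × ℝ => (e c.1, e c.2) := by
    rintro ⟨a, b⟩ ⟨c, d⟩ h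
    simpa using h
  have hi : ∀ c d : ℝ × ℝ, Interlaced (e c.1, e c.2) (e d.1, e d.2) ↔ Interlaced c d := by
    intro c d
    simp [Interlaced]
  refine .of_base hb hb' ?_ ?_ (numSeifert_of_transport he hPQ) ?_
  · rw [chords_of_transport he hPQ]
    exact crossSum_image hinj hi fun _ _ => rfl
  · rw [chords_of_transport he hPQ]
    exact crossSum_image hinj hi fun c hc => hsgn _ _ (isDoublePair_of_mem_chords hc)
  · rw [numDouble_eq_card_chords hb, numDouble_eq_card_chords hb', chords_of_transport he hPQ,
      Finset.card_image_of_injective _ hinj]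

theorem SphereDiffeo_hasFDerivAt (ψ : SphereDiffeo) {x : E3} (hx : x ≠ 0) :
    HasFDerivAt ψ.toFun (fderiv ℝ ψ.toFun x) x :=
  ((ψ.smooth.contDiffAt (isOpen_compl_singleton.mem_nhds hx)).differentiableAt
    (by simp)).hasFDerivAt

/-- By the chain rule the velocities of `Q` are images of those of `P` up to positive factors, and
the diffeomorphism preserves the sign of the determinant; so the Gauss diagrams with signs
correspond. -/
theorem sameInvariants_of_diffeo (ψ : SphereDiffeo) {θ : ℝ → ℝ} (hθ : ContDiff ℝ ∞ θ)
    (hθ' : ∀ t, 0 < deriv θ t) (hθ1 : ∀ t, θ (t + 1) = θ t + 1)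
    (h : ∀ t, Q.toFun (θ t) = ψ.toFun (P.toFun t)) : SameInvariants P Q := by
  have hmono : StrictMono θ := strictMono_of_deriv_pos hθ'
  have hint : ∀ (n : ℤ) t, θ (t + n) = θ t + n := by
    intro n t
    have h1 : Function.Periodic (fun t => θ t - t) 1 := fun t => by
      simp only [hθ1]
      ring
    have h2 := h1.int_mul n t
    simp only [mul_one] at h2
    linarith
  have hsurj : Function.Surjective θ := by
    intro y
    have h1 : y ∈ range θ := by
      refine mem_range_of_exists_le_of_exists_ge hθ.continuous
        ⟨0 + (⌊y - θ 0⌋ : ℤ), ?_⟩ ⟨0 + (⌈y - θ 0⌉ : ℤ), ?_⟩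
      · rw [hint]
        have := Int.floor_le (y - θ 0)
        linarith
      · rw [hint]
        have := Int.le_ceil (y - θ 0)
        linarith
    exact h1
  set e : ℝ ≃o ℝ := hmono.orderIsoOfSurjective θ hsurj with he
  have he' : ∀ t, e t = θ t := fun t => rfl
  have hψ : ∀ s t, ψ.toFun (P.toFun s) = ψ.toFun (P.toFun t) ↔ P.toFun s = P.toFun t := by
    intro s t
    constructor
    · intro h1
      rw [← ψ.left_inv _ (P.norm_eq_one s), h1, ψ.left_inv _ (P.norm_eq_one t)]
    · intro h1
      rw [h1]
  have hdQ : ∀ t, deriv θ t • deriv Q.toFun (θ t) =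
      fderiv ℝ ψ.toFun (P.toFun t) (deriv P.toFun t) := by
    intro t
    have h1 : HasDerivAt (fun t => Q.toFun (θ t)) (deriv θ t • deriv Q.toFun (θ t)) t :=
      (Q.hasDerivAt (θ t)).scomp t (hθ.differentiable (by simp) t).hasDerivAt
    have h2 : HasDerivAt (fun t => Q.toFun (θ t))
        (fderiv ℝ ψ.toFun (P.toFun t) (deriv P.toFun t)) t := by
      simp only [h]
      exact (SphereDiffeo_hasFDerivAt ψ (P.apply_ne_zero t)).comp_hasDerivAt t (P.hasDerivAt t)
    exact h1.unique h2
  refine sameInvariants_of_transport (e := e) hθ1 ?_ ?_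
  · intro s t
    simp only [he', IsDoublePair]
    rw [h, h, hψ]
    refine and_congr Iff.rfl (not_congr ?_)
    constructor
    · rintro ⟨n, rfl⟩
      exact ⟨n, hint n s⟩
    · rintro ⟨n, hn⟩
      rw [← hint] at hn
      exact ⟨n, hmono.injective hn⟩
  · intro s t hst
    simp only [he', sgn]
    have h1 : 0 < deriv θ s * deriv θ t := mul_pos (hθ' s) (hθ' t)
    have h2 : deriv θ s * deriv θ t *
        tripleDet (Q.toFun (θ s)) (deriv Q.toFun (θ s)) (deriv Q.toFun (θ t)) =
        tripleDet (ψ.toFun (P.toFun s)) (fderiv ℝ ψ.toFun (P.toFun s) (deriv P.toFun s))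
          (fderiv ℝ ψ.toFun (P.toFun s) (deriv P.toFun t)) := by
      rw [← tripleDet_smul_smul, hdQ, hdQ, h, hst.1]
    have h3 : inner ℝ (P.toFun s) (deriv P.toFun t) = (0 : ℝ) := by
      rw [hst.1]
      exact P.inner_deriv t
    rcases lt_or_gt_of_ne hst.tripleDet_ne_zero with h4 | h4
    -- The orientation condition speaks of positive bases only, so a negative one is first made
    -- positive by exchanging its vectors.
    · have h5 := ψ.orientation (P.toFun s) _ _ (P.norm_eq_one s) h3 (P.inner_deriv s)
        (by rw [tripleDet_swap]; linarith)
      rw [tripleDet_swap, ← h2] at h5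
      have h6 : tripleDet (Q.toFun (θ s)) (deriv Q.toFun (θ s)) (deriv Q.toFun (θ t)) < 0 := by
        by_contra h6
        have := mul_nonneg h1.le (not_lt.1 h6)
        linarith
      rw [if_pos h4, if_pos h6]
    · have h5 := ψ.orientation (P.toFun s) _ _ (P.norm_eq_one s) (P.inner_deriv s) h3 h4
      rw [← h2] at h5
      have h6 := pos_of_mul_pos_right h5 h1.le
      rw [if_neg h4.not_gt, if_neg h6.not_gt]

/-- The derivative of the reparametrization has no zero, hence one sign. A decreasing
reparametrization is an increasing one of the reversed curve. -/
theorem Isotopic.sameInvariants (h : P.Isotopic Q) : SameInvariants P Q := by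
  obtain ⟨ψ, θ, h⟩ := h
  have hcont : Continuous (deriv θ.toFun) := θ.smooth.continuous_deriv (by simp)
  have hdiff : Differentiable ℝ θ.toFun := θ.smooth.differentiable (by simp)
  have hsign : (∀ t, 0 < deriv θ.toFun t) ∨ ∀ t, deriv θ.toFun t < 0 := by
    by_contra hcon
    push Not at hcon
    obtain ⟨⟨t, ht⟩, u, hu⟩ := hcon
    obtain ⟨v, hv⟩ := mem_range_of_exists_le_of_exists_ge hcont ⟨t, ht⟩ ⟨u, hu⟩
    exact θ.deriv_ne_zero v hv
  rcases hsign with hpos | hneg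
  · have hmono : StrictMono θ.toFun := strictMono_of_deriv_pos hpos
    refine sameInvariants_of_diffeo ψ θ.smooth hpos (θ.map_add_one.resolve_right ?_) h
    intro h1
    have := hmono (show (0 : ℝ) < 0 + 1 by norm_num)
    rw [h1] at this
    linarith
  · have hanti : StrictAnti θ.toFun := strictAnti_of_deriv_neg hneg
    have h2 : ∀ t, θ.toFun (t + 1) = θ.toFun t - 1 := by
      refine θ.map_add_one.resolve_left ?_
      intro h1
      have := hanti (show (0 : ℝ) < 0 + 1 by norm_num)
      rw [h1] at this
      linarith
    refine sameInvariants_rev.trans (sameInvariants_of_diffeo (P := P.rev) ψ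
      (θ := fun t => θ.toFun (-t)) (θ.smooth.comp contDiff_neg) ?_ ?_ fun t => h (-t))
    · intro t
      rw [deriv_comp_neg]
      linarith [hneg (-t)]
    · intro t
      have := h2 (-(t + 1))
      have e : -(t + 1) + 1 = -t := by ring
      rw [e] at this
      linarith

end SphericalCurve

/-! ### Seifert circles through the functions that are constant on them. -/

theorem IsPreconnected.eq_of_eventually_eq {X α : Type*} [TopologicalSpace X] {s : Set X}
    (hs : IsPreconnected s) {φ : X → α} (h : ∀ x ∈ s, ∀ᶠ y in 𝓝[s] x, φ y = φ x) {x y : X}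
    (hx : x ∈ s) (hy : y ∈ s) : φ x = φ y :=
  hs.induction₂ (fun x y => φ x = φ y)
    (fun x hx => (h x hx).mono fun _ hy => hy.symm)
    (fun _ _ _ _ _ _ h h' => h.trans h') (fun _ _ _ _ h => h.symm) hx hy

namespace SphericalCurve

variable {P : SphericalCurve} {α : Type*}

/-- Functions of the non-double points of `P` that factor through the Seifert circles. -/
structure SeifertInv (P : SphericalCurve) (φ : ℝ → α) : Prop where
  per : ∀ t, ¬ P.IsDoubleParam t → φ (t + 1) = φ t
  loc : ∀ t, ¬ P.IsDoubleParam t → ∀ᶠ u in 𝓝 t, φ u = φ t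
  glue : ∀ p q, P.IsDoublePair p q →
    ∃ a, (∀ᶠ t in 𝓝[<] p, φ t = a) ∧ ∀ᶠ t in 𝓝[>] q, φ t = a

theorem SeifertInv.eq_of_ordConnected {φ : ℝ → α} (hφ : P.SeifertInv φ) {s : Set ℝ}
    (hs : s.OrdConnected) (h : ∀ v ∈ s, ¬ P.IsDoubleParam v) {t u : ℝ} (ht : t ∈ s) (hu : u ∈ s) :
    φ t = φ u :=
  hs.isPreconnected.eq_of_eventually_eq
    (fun x hx => (hφ.loc x (h x hx)).filter_mono nhdsWithin_le_nhds) ht hu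

theorem SeifertInv.add_int {φ : ℝ → α} (hφ : P.SeifertInv φ) {t : ℝ} (ht : ¬ P.IsDoubleParam t)
    (n : ℤ) : φ (t + n) = φ t := by
  induction n using Int.induction_on with
  | zero => simp
  | succ n ih =>
    rw [← ih, Int.cast_add, Int.cast_one, ← add_assoc]
    exact hφ.per _ (by rwa [isDoubleParam_add_int])
  | pred n ih =>
    rw [← ih]
    have := hφ.per (t + ((-(n : ℤ) - 1 : ℤ) : ℝ)) (by rwa [isDoubleParam_add_int])
    rw [← this]
    congr 1
    push_cast
    ring

theorem SeifertInv.comp {φ : ℝ → α} (hφ : P.SeifertInv φ) {β : Type*} (g : α → β) :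
    P.SeifertInv fun t => g (φ t) where
  per t ht := by rw [hφ.per t ht]
  loc t ht := (hφ.loc t ht).mono fun _ h => by rw [h]
  glue p q h := by
    obtain ⟨a, h1, h2⟩ := hφ.glue p q h
    exact ⟨g a, h1.mono fun _ h => by rw [h], h2.mono fun _ h => by rw [h]⟩

theorem SeifertInv.eq_of_adj {φ : ℝ → α} (hφ : P.SeifertInv φ)
    {t u : {t : ℝ // ¬ P.IsDoubleParam t}} (h : P.SeifertAdj t u) : φ t = φ u := by
  rcases h with h | ⟨h1, h2⟩ | ⟨p, q, h1, h2, h3, h4, h5⟩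
  · rw [h, hφ.per _ t.2]
  · exact hφ.eq_of_ordConnected ordConnected_Icc h2 ⟨le_rfl, h1⟩ ⟨h1, le_rfl⟩
  · obtain ⟨a, ha, ha'⟩ := hφ.glue p q h1
    obtain ⟨v, hv, hv'⟩ := (ha.and (Ioo_mem_nhdsLT h2)).exists
    obtain ⟨w, hw, hw'⟩ := (ha'.and (Ioo_mem_nhdsGT h4)).exists
    rw [hφ.eq_of_ordConnected ordConnected_Ico h3 ⟨le_rfl, h2⟩ ⟨hv'.1.le, hv'.2⟩, hv, ← hw]
    exact hφ.eq_of_ordConnected ordConnected_Ioc h5 ⟨hw'.1, hw'.2.le⟩ ⟨h4, le_rfl⟩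

/-- The map from Seifert circles given by an invariant function. -/
def SeifertInv.lift {φ : ℝ → α} (hφ : P.SeifertInv φ) : Quot P.SeifertAdj → α :=
  Quot.lift (fun t => φ t.1) fun _ _ h => hφ.eq_of_adj h

open Classical in
/-- The Seifert circle through a non-double point (with a junk value at double points). -/
noncomputable def circle (P : SphericalCurve) (t : ℝ) : Quot P.SeifertAdj :=
  if h : ¬ P.IsDoubleParam t then Quot.mk _ ⟨t, h⟩
  else Quot.mk _ ⟨P.exists_isBase.choose, P.exists_isBase.choose_spec⟩

theorem circle_eq {t : ℝ} (h : ¬ P.IsDoubleParam t) : P.circle t = Quot.mk _ ⟨t, h⟩ := dif_pos h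

theorem SeifertInv.lift_circle {φ : ℝ → α} (hφ : P.SeifertInv φ) {t : ℝ}
    (h : ¬ P.IsDoubleParam t) : hφ.lift (P.circle t) = φ t := by
  rw [circle_eq h]
  rfl

theorem exists_circle_eq (x : Quot P.SeifertAdj) : ∃ t, ¬ P.IsDoubleParam t ∧ P.circle t = x := by
  obtain ⟨t⟩ := x
  exact ⟨t.1, t.2, circle_eq t.2⟩

theorem mk_eq_of_adj {t u : {t : ℝ // ¬ P.IsDoubleParam t}} (h : P.SeifertAdj t u) :
    Quot.mk P.SeifertAdj t = Quot.mk P.SeifertAdj u := Quot.sound h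

theorem circle_eq_of_ordConnected {s : Set ℝ} (hs : s.OrdConnected)
    (h : ∀ v ∈ s, ¬ P.IsDoubleParam v) {t u : ℝ} (ht : t ∈ s) (hu : u ∈ s) :
    P.circle t = P.circle u := by
  rw [circle_eq (h t ht), circle_eq (h u hu)]
  rcases le_total t u with h1 | h1
  · exact mk_eq_of_adj (Or.inr (Or.inl ⟨h1, fun v hv => h v (hs.out ht hu hv)⟩))
  · exact (mk_eq_of_adj (Or.inr (Or.inl ⟨h1, fun v hv => h v (hs.out hu ht hv)⟩))).symm

/-- This is the universal invariant function: all others factor through it by `SeifertInv.lift`. -/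
theorem seifertInv_circle (P : SphericalCurve) : P.SeifertInv P.circle where
  per t ht := by
    rw [circle_eq ht, circle_eq (isDoubleParam_add_one.not.2 ht)]
    exact (mk_eq_of_adj (Or.inl rfl)).symm
  loc t ht := by
    obtain ⟨η, hη, h⟩ := Metric.eventually_nhds_iff_ball.1
      (P.eventually_not_isDoubleParam_of_not ht)
    filter_upwards [Metric.ball_mem_nhds t hη] with u hu
    rw [Real.ball_eq_Ioo] at h hu
    exact circle_eq_of_ordConnected ordConnected_Ioo h hu ⟨by linarith, by linarith⟩
  glue p q hpq := by
    have h1 : ∀ᶠ t in 𝓝[<] p, ¬ P.IsDoubleParam t := (P.eventually_not_isDoubleParam p).filter_mono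
      (nhdsWithin_mono p fun v (hv : v ∈ Iio p) => ne_of_lt hv)
    have h2 : ∀ᶠ t in 𝓝[>] q, ¬ P.IsDoubleParam t := (P.eventually_not_isDoubleParam q).filter_mono
      (nhdsWithin_mono q fun v (hv : v ∈ Ioi q) => ne_of_gt hv)
    obtain ⟨l, hl, hl'⟩ := (mem_nhdsLT_iff_exists_Ioo_subset' (show p - 1 < p by linarith)).1 h1
    obtain ⟨r, hr, hr'⟩ := (mem_nhdsGT_iff_exists_Ioo_subset' (show q < q + 1 by linarith)).1 h2
    obtain ⟨t₀, ht₀⟩ := nonempty_Ioo.2 (show l < p from hl)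
    refine ⟨P.circle t₀, ?_, ?_⟩
    · filter_upwards [Ioo_mem_nhdsLT hl] with t ht
      exact circle_eq_of_ordConnected ordConnected_Ioo hl' ht ht₀
    · filter_upwards [Ioo_mem_nhdsGT hr] with u hu
      rw [circle_eq (hl' ht₀), circle_eq (hr' hu)]
      refine (mk_eq_of_adj (Or.inr (Or.inr ⟨p, q, hpq, ht₀.2, fun v hv => hl' ⟨?_, hv.2⟩, hu.1,
        fun v hv => hr' ⟨hv.1, ?_⟩⟩))).symm
      · exact ht₀.1.trans_le hv.1
      · exact hv.2.trans_lt hu.2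

instance finite_seifertCircles (P : SphericalCurve) : Finite (Quot P.SeifertAdj) := by
  have h0 : ∀ x : Quot P.SeifertAdj, ∃ t ∈ Ico (0 : ℝ) (0 + 1),
      ¬ P.IsDoubleParam t ∧ P.circle t = x := by
    intro x
    obtain ⟨t, ht, rfl⟩ := exists_circle_eq x
    obtain ⟨t', ht', n, rfl⟩ := exists_sameParam_mem_Ico 0 t
    exact ⟨_, ht', by rwa [isDoubleParam_add_int], P.seifertInv_circle.add_int ht n⟩
  choose f hf1 hf2 hf3 using h0
  set D := {t ∈ Icc (0 : ℝ) 1 | P.IsDoubleParam t} with hD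
  have hfin : (𝒫 D).Finite := (P.finite_isDoubleParam 0 1).finite_subsets
  have : Finite (𝒫 D) := hfin
  -- Representatives in one period are separated by the finite set of double points below them; two
  -- representatives with the same set lie on one arc without double points.
  refine Finite.of_injective (β := 𝒫 D) (fun x => ⟨D ∩ Iic (f x), inter_subset_left⟩) ?_
  intro x y hxy
  have key : ∀ x y, D ∩ Iic (f x) = D ∩ Iic (f y) → f x ≤ f y → x = y := by
    intro x y h hle
    rw [← hf3 x, ← hf3 y]
    refine circle_eq_of_ordConnected ordConnected_Icc (s := Icc (f x) (f y)) ?_ ⟨le_rfl, hle⟩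
      ⟨hle, le_rfl⟩
    intro v hv hdv
    have h1 : v ∈ D ∩ Iic (f y) :=
      ⟨⟨⟨(hf1 x).1.trans hv.1, by linarith [(hf1 y).2, hv.2]⟩, hdv⟩, hv.2⟩
    rw [← h] at h1
    have h2 : v = f x := le_antisymm h1.2 hv.1
    exact hf2 x (h2 ▸ hdv)
  have hxy' : D ∩ Iic (f x) = D ∩ Iic (f y) := congrArg Subtype.val hxy
  rcases le_total (f x) (f y) with h | h
  · exact key x y hxy' h
  · exact (key y x hxy'.symm h).symm

end SphericalCurve

/-! ### The part of the curve inside the disk of a move. -/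

/-- Disjoint arcs of radius `r` (with collars up to the radius `R`) on the circle `ℝ / ℤ`. -/
structure Strands (k : ℕ) where
  c : Fin k → ℝ
  r : ℝ
  R : ℝ
  r_pos : 0 < r
  r_lt : r < R
  disj : ∀ (i j : Fin k) (n : ℤ), |c i - (c j + n)| ≤ 2 * R → i = j ∧ n = 0

namespace Strands

variable {k : ℕ} (S : Strands k)

/-- The points that do not lie on one of the arcs. -/
def Outside (t : ℝ) : Prop := ∀ (i : Fin k) (n : ℤ), S.r < |t - (S.c i + n)|

theorem eq_of_abs_sub_le {i j : Fin k} {n m : ℤ} {t : ℝ} (h : |t - (S.c i + n)| ≤ S.R)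
    (h' : |t - (S.c j + m)| ≤ S.R) : i = j ∧ n = m := by
  have h1 : |S.c i - (S.c j + ((m - n : ℤ) : ℝ))| ≤ 2 * S.R := by
    rw [abs_le] at h h' ⊢
    push_cast
    constructor <;> linarith [h.1, h.2, h'.1, h'.2]
  have := S.disj i j _ h1
  exact ⟨this.1, by omega⟩

theorem outside_of_collar {i : Fin k} {n : ℤ} {t : ℝ} (h : S.r < |t - (S.c i + n)|)
    (h' : |t - (S.c i + n)| ≤ S.R) : S.Outside t := by
  intro j m
  by_contra h1
  obtain ⟨rfl, rfl⟩ := S.eq_of_abs_sub_le h' ((not_lt.1 h1).trans S.r_lt.le)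
  exact h1 h

theorem not_outside_iff {t : ℝ} : ¬ S.Outside t ↔ ∃ (i : Fin k) (n : ℤ), |t - (S.c i + n)| ≤ S.r := by
  simp [Outside]

/-- Infinitely many arcs have to be avoided. Inside a collar only the arc of that collar matters;
away from all collars the distance to every arc is at least `R - r`. -/
theorem Outside.eventually {t : ℝ} (h : S.Outside t) : ∀ᶠ u in 𝓝 t, S.Outside u := by
  by_cases h1 : ∃ (i : Fin k) (n : ℤ), |t - (S.c i + n)| < S.R
  · obtain ⟨i, n, h1⟩ := h1
    have hc : Continuous fun u : ℝ => |u - (S.c i + n)| := by fun_prop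
    filter_upwards [hc.continuousAt.eventually_const_lt (h i n),
      hc.continuousAt.eventually_lt_const h1] with u h2 h3
    exact S.outside_of_collar h2 h3.le
  · push Not at h1
    filter_upwards [Metric.ball_mem_nhds t (sub_pos.2 S.r_lt)] with u hu i n
    rw [Metric.mem_ball, Real.dist_eq] at hu
    have h2 := h1 i n
    have h3 := abs_sub_abs_le_abs_sub (t - (S.c i + n)) (u - (S.c i + n))
    rw [sub_sub_sub_cancel_right, abs_sub_comm t u] at h3
    linarith

theorem outside_add_int {t : ℝ} (m : ℤ) : S.Outside (t + m) ↔ S.Outside t := by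
  have key : ∀ (t : ℝ) (m : ℤ), S.Outside t → S.Outside (t + m) := by
    intro t m h i n
    have := h i (n - m)
    push_cast at this
    convert this using 2
    ring
  refine ⟨fun h => ?_, key t m⟩
  have := key _ (-m) h
  simpa using this

end Strands

/-- The double points of `P` on the strands `S` (if there are any) are among the marks `x i b` (two
on each strand), and they are paired by the relation `rel`. -/
structure Picture {k : ℕ} (P : SphericalCurve) (S : Strands k) (x : Fin k → Bool → ℝ)
    (rel : Fin k × Bool → Fin k × Bool → Prop) : Prop where
  lower : ∀ i, S.c i - S.r < x i false
  lt : ∀ i, x i false < x i true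
  upper : ∀ i, x i true < S.c i + S.r
  sep : ∀ s t, S.Outside s → ¬ S.Outside t → ¬ P.IsDoublePair s t
  pairs : ∀ s t, ¬ S.Outside s → ¬ S.Outside t → (P.IsDoublePair s t ↔
    ∃ a b, rel a b ∧ SameParam (x a.1 a.2) s ∧ SameParam (x b.1 b.2) t)

/-- The value of a function on the piece of a strand before a mark. -/
def preVal {k : ℕ} {α : Type*} (I M : Fin k → α) (a : Fin k × Bool) : α :=
  if a.2 then M a.1 else I a.1

/-- The value of a function on the piece of a strand after a mark. -/
def postVal {k : ℕ} {α : Type*} (M O : Fin k → α) (a : Fin k × Bool) : α :=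
  if a.2 then O a.1 else M a.1

/-- The conditions on the values on the three pieces of each strand imposed by Seifert
resolution. -/
def Resolves {k : ℕ} {α : Type*} (rel : Fin k × Bool → Fin k × Bool → Prop) (I M O : Fin k → α) :
    Prop :=
  (∀ a b, rel a b → preVal I M a = postVal M O b) ∧
    ∀ a, (∀ b, ¬ rel a b) → preVal I M a = postVal M O a

namespace Picture

variable {k : ℕ} {P : SphericalCurve} {S : Strands k} {x : Fin k → Bool → ℝ}
  {rel : Fin k × Bool → Fin k × Bool → Prop} (hP : Picture P S x rel)
include hP

theorem abs_mark_lt (i : Fin k) (b : Bool) : |x i b - S.c i| < S.r := by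
  have h1 := hP.lower i
  have h2 := hP.lt i
  have h3 := hP.upper i
  cases b <;> rw [abs_lt] <;> constructor <;> linarith

theorem not_outside_mark (i : Fin k) (b : Bool) (n : ℤ) : ¬ S.Outside (x i b + n) := by
  rw [S.not_outside_iff]
  refine ⟨i, n, ?_⟩
  have := hP.abs_mark_lt i b
  rw [add_sub_add_right_eq_sub]
  exact this.le

theorem exists_mark_of_isDoubleParam {i : Fin k} {n : ℤ} {t : ℝ} (ht : |t - (S.c i + n)| ≤ S.r)
    (hd : P.IsDoubleParam t) : ∃ b, t = x i b + n ∧ ∃ b', rel (i, b) b' := by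
  obtain ⟨s, hs⟩ := hd
  have h1 : ¬ S.Outside t := S.not_outside_iff.2 ⟨i, n, ht⟩
  have h2 : ¬ S.Outside s := fun h => hP.sep s t h h1 hs.symm
  obtain ⟨⟨j, b⟩, b', h3, ⟨m, h4⟩, h5⟩ := (hP.pairs t s h1 h2).1 hs
  simp only at h4
  have h6 : |t - (S.c j + m)| ≤ S.r := by
    rw [h4, add_sub_add_right_eq_sub]
    exact (hP.abs_mark_lt j b).le
  obtain ⟨rfl, rfl⟩ := S.eq_of_abs_sub_le (ht.trans S.r_lt.le) (h6.trans S.r_lt.le)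
  exact ⟨b, h4, b', h3⟩

theorem not_isDoubleParam_of_ne {i : Fin k} {t : ℝ} (ht : |t - S.c i| ≤ S.r)
    (h : ∀ b, t ≠ x i b) : ¬ P.IsDoubleParam t := by
  intro hd
  obtain ⟨b, hb, -⟩ := hP.exists_mark_of_isDoubleParam (n := 0) (by simpa using ht) hd
  exact h b (by simpa using hb)

theorem not_isDoubleParam_mark {a : Fin k × Bool} (h : ∀ b, ¬ rel a b) :
    ¬ P.IsDoubleParam (x a.1 a.2) := by
  intro hd
  obtain ⟨b, hb, b', hb'⟩ := hP.exists_mark_of_isDoubleParam (i := a.1) (n := 0)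
    (by simpa using (hP.abs_mark_lt a.1 a.2).le) hd
  have h1 : a.2 = b := by
    have := hP.lt a.1
    rw [Int.cast_zero, add_zero] at hb
    generalize a.2 = c at *
    cases c <;> cases b
    · rfl
    · exact absurd hb this.ne
    · exact absurd hb.symm this.ne
    · rfl
  subst h1
  exact h b' hb'

theorem not_isDoubleParam_left (i : Fin k) (n : ℤ) : ¬ P.IsDoubleParam (S.c i - S.r + n) := by
  rw [SphericalCurve.isDoubleParam_add_int]
  have h0 := S.r_pos
  refine hP.not_isDoubleParam_of_ne (i := i) ?_ fun b hb => ?_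
  · rw [sub_sub_cancel_left, abs_neg, abs_of_pos h0]
  · have := hP.abs_mark_lt i b
    rw [← hb, sub_sub_cancel_left, abs_neg, abs_of_pos h0] at this
    exact lt_irrefl _ this

theorem not_isDoubleParam_right (i : Fin k) (n : ℤ) : ¬ P.IsDoubleParam (S.c i + S.r + n) := by
  rw [SphericalCurve.isDoubleParam_add_int]
  have h0 := S.r_pos
  refine hP.not_isDoubleParam_of_ne (i := i) ?_ fun b hb => ?_
  · rw [add_sub_cancel_left, abs_of_pos h0]
  · have := hP.abs_mark_lt i b
    rw [← hb, add_sub_cancel_left, abs_of_pos h0] at this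
    exact lt_irrefl _ this

theorem isDoublePair_of_rel {a b : Fin k × Bool} (h : rel a b) :
    P.IsDoublePair (x a.1 a.2) (x b.1 b.2) := by
  have h1 := hP.not_outside_mark a.1 a.2 0
  have h2 := hP.not_outside_mark b.1 b.2 0
  rw [Int.cast_zero, add_zero] at h1 h2
  exact (hP.pairs _ _ h1 h2).2 ⟨a, b, h, SameParam.refl _, SameParam.refl _⟩

/-! ### Restriction of invariant functions to the strands -/

variable {α : Type*} {φ : ℝ → α}

theorem eq_left (hφ : P.SeifertInv φ) {i : Fin k} {t : ℝ} (h1 : S.c i - S.r ≤ t)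
    (h2 : t < x i false) : φ t = φ (S.c i - S.r) := by
  refine hφ.eq_of_ordConnected ordConnected_Ico (s := Ico (S.c i - S.r) (x i false)) ?_ ⟨h1, h2⟩
    ⟨le_rfl, hP.lower i⟩
  intro v hv
  have h3 := hP.lt i
  have h4 := hP.upper i
  refine hP.not_isDoubleParam_of_ne (i := i) ?_ fun b hb => ?_
  · rw [abs_le]
    constructor <;> linarith [hv.1, hv.2]
  · cases b <;> linarith [hv.2]

theorem eq_mid (hφ : P.SeifertInv φ) {i : Fin k} {t : ℝ} (h1 : x i false < t)
    (h2 : t < x i true) : φ t = φ ((x i false + x i true) / 2) := by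
  have h3 := hP.lt i
  have h4 := hP.upper i
  have h5 := hP.lower i
  refine hφ.eq_of_ordConnected ordConnected_Ioo (s := Ioo (x i false) (x i true)) ?_ ⟨h1, h2⟩
    ⟨by linarith, by linarith⟩
  intro v hv
  refine hP.not_isDoubleParam_of_ne (i := i) ?_ fun b hb => ?_
  · rw [abs_le]
    constructor <;> linarith [hv.1, hv.2]
  · cases b <;> linarith [hv.1, hv.2]

theorem eq_right (hφ : P.SeifertInv φ) {i : Fin k} {t : ℝ} (h1 : x i true < t)
    (h2 : t ≤ S.c i + S.r) : φ t = φ (S.c i + S.r) := by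
  refine hφ.eq_of_ordConnected ordConnected_Ioc (s := Ioc (x i true) (S.c i + S.r)) ?_ ⟨h1, h2⟩
    ⟨hP.upper i, le_rfl⟩
  intro v hv
  have h3 := hP.lt i
  have h4 := hP.lower i
  refine hP.not_isDoubleParam_of_ne (i := i) ?_ fun b hb => ?_
  · rw [abs_le]
    constructor <;> linarith [hv.1, hv.2]
  · cases b <;> linarith [hv.1]

theorem eventually_pre (hφ : P.SeifertInv φ) (a : Fin k × Bool) :
    ∀ᶠ t in 𝓝[<] (x a.1 a.2), φ t = preVal (fun i => φ (S.c i - S.r))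
      (fun i => φ ((x i false + x i true) / 2)) a := by
  obtain ⟨i, b⟩ := a
  cases b
  · filter_upwards [Ioo_mem_nhdsLT (hP.lower i)] with t ht
    exact hP.eq_left hφ ht.1.le ht.2
  · filter_upwards [Ioo_mem_nhdsLT (hP.lt i)] with t ht
    exact hP.eq_mid hφ ht.1 ht.2

theorem eventually_post (hφ : P.SeifertInv φ) (a : Fin k × Bool) :
    ∀ᶠ t in 𝓝[>] (x a.1 a.2), φ t = postVal (fun i => φ ((x i false + x i true) / 2))
      (fun i => φ (S.c i + S.r)) a := by
  obtain ⟨i, b⟩ := a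
  cases b
  · filter_upwards [Ioo_mem_nhdsGT (hP.lt i)] with t ht
    exact hP.eq_mid hφ ht.1 ht.2
  · filter_upwards [Ioo_mem_nhdsGT (hP.upper i)] with t ht
    exact hP.eq_right hφ ht.1 ht.2.le

/-- Close to a mark the function takes the values of the adjacent pieces; gluing at a double point,
or local constancy at an unpaired mark, identifies them. -/
theorem resolves (hφ : P.SeifertInv φ) : Resolves rel (fun i => φ (S.c i - S.r))
    (fun i => φ ((x i false + x i true) / 2)) (fun i => φ (S.c i + S.r)) := by
  constructor
  · intro a b hab
    obtain ⟨v, h1, h2⟩ := hφ.glue _ _ (hP.isDoublePair_of_rel hab)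
    obtain ⟨t, h3, h4⟩ := (h1.and (hP.eventually_pre hφ a)).exists
    obtain ⟨u, h5, h6⟩ := (h2.and (hP.eventually_post hφ b)).exists
    rw [← h4, h3, ← h6, h5]
  · intro a ha
    have h0 := hφ.loc _ (hP.not_isDoubleParam_mark ha)
    obtain ⟨t, h3, h4⟩ :=
      ((h0.filter_mono nhdsWithin_le_nhds).and (hP.eventually_pre hφ a)).exists
    obtain ⟨u, h5, h6⟩ :=
      ((h0.filter_mono nhdsWithin_le_nhds).and (hP.eventually_post hφ a)).exists
    rw [← h4, h3, ← h6, h5]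

/-- The end of a strand is not itself an outside point, but the nearby points of its collar are, and
both functions are constant there. -/
theorem exists_outside_left (i : Fin k) {φ ψ : ℝ → α} (hφ : P.SeifertInv φ)
    (hψ : P.SeifertInv ψ) : ∃ t, S.Outside t ∧ ¬ P.IsDoubleParam t ∧ φ (S.c i - S.r) = φ t ∧
      ψ (S.c i - S.r) = ψ t := by
  have h0 := hP.not_isDoubleParam_left i 0
  rw [Int.cast_zero, add_zero] at h0
  have h1 := (((hφ.loc _ h0).and (hψ.loc _ h0)).and
    (P.eventually_not_isDoubleParam_of_not h0)).filter_mono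
    (nhdsWithin_le_nhds (s := Iio (S.c i - S.r)))
  obtain ⟨t, ⟨⟨h2, h3⟩, h4⟩, h5⟩ := (h1.and (Ioo_mem_nhdsLT
    (show S.c i - S.R < S.c i - S.r by linarith [S.r_lt]))).exists
  refine ⟨t, S.outside_of_collar (i := i) (n := 0) ?_ ?_, h4, h2.symm, h3.symm⟩
  · rw [Int.cast_zero, add_zero, lt_abs]
    right
    linarith [h5.2]
  · rw [Int.cast_zero, add_zero, abs_le]
    constructor <;> linarith [h5.1, h5.2, S.r_lt, S.r_pos]

theorem exists_outside_right (i : Fin k) {φ ψ : ℝ → α} (hφ : P.SeifertInv φ)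
    (hψ : P.SeifertInv ψ) : ∃ t, S.Outside t ∧ ¬ P.IsDoubleParam t ∧ φ (S.c i + S.r) = φ t ∧
      ψ (S.c i + S.r) = ψ t := by
  have h0 := hP.not_isDoubleParam_right i 0
  rw [Int.cast_zero, add_zero] at h0
  have h1 := (((hφ.loc _ h0).and (hψ.loc _ h0)).and
    (P.eventually_not_isDoubleParam_of_not h0)).filter_mono
    (nhdsWithin_le_nhds (s := Ioi (S.c i + S.r)))
  obtain ⟨t, ⟨⟨h2, h3⟩, h4⟩, h5⟩ := (h1.and (Ioo_mem_nhdsGT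
    (show S.c i + S.r < S.c i + S.R by linarith [S.r_lt]))).exists
  refine ⟨t, S.outside_of_collar (i := i) (n := 0) ?_ ?_, h4, h2.symm, h3.symm⟩
  · rw [Int.cast_zero, add_zero, lt_abs]
    left
    linarith [h5.1]
  · rw [Int.cast_zero, add_zero, abs_le]
    constructor <;> linarith [h5.1, h5.2, S.r_lt, S.r_pos]

/-- Two invariant functions are equal if they agree outside the strands and on the middle pieces
of the strands. -/
theorem eq_of_eq_outside {φ ψ : ℝ → α} (hφ : P.SeifertInv φ) (hψ : P.SeifertInv ψ)
    (h : ∀ t, S.Outside t → ¬ P.IsDoubleParam t → φ t = ψ t)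
    (hmid : ∀ i, φ ((x i false + x i true) / 2) = ψ ((x i false + x i true) / 2))
    {t : ℝ} (ht : ¬ P.IsDoubleParam t) : φ t = ψ t := by
  by_cases hout : S.Outside t
  · exact h t hout ht
  obtain ⟨i, n, hin⟩ := S.not_outside_iff.1 hout
  have hl : φ (S.c i - S.r) = ψ (S.c i - S.r) := by
    obtain ⟨u, h1, h2, h3, h4⟩ := hP.exists_outside_left i hφ hψ
    rw [h3, h4, h u h1 h2]
  have hr : φ (S.c i + S.r) = ψ (S.c i + S.r) := by
    obtain ⟨u, h1, h2, h3, h4⟩ := hP.exists_outside_right i hφ hψ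
    rw [h3, h4, h u h1 h2]
  set τ := t - n with hτ
  have htτ : t = τ + n := by rw [hτ]; ring
  have hdτ : ¬ P.IsDoubleParam τ := by
    rwa [htτ, SphericalCurve.isDoubleParam_add_int] at ht
  rw [htτ, hφ.add_int hdτ, hψ.add_int hdτ]
  rw [htτ, add_sub_add_right_eq_sub, abs_le] at hin
  rcases lt_trichotomy τ (x i false) with h1 | h1 | h1
  · rw [hP.eq_left hφ (by linarith) h1, hP.eq_left hψ (by linarith) h1, hl]
  -- A mark that is not a double point inherits the value from the piece next to it.
  · have h2 := (hP.resolves hφ).2 (i, false)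
    have h3 := (hP.resolves hψ).2 (i, false)
    obtain ⟨u, ⟨h4, h5⟩, h6⟩ := ((((hφ.loc τ hdτ).and (hψ.loc τ hdτ)).filter_mono
      (nhdsWithin_le_nhds (s := Iio τ))).and (Ioo_mem_nhdsLT (show S.c i - S.r < τ by
        rw [h1]; exact hP.lower i))).exists
    rw [← h4, ← h5, hP.eq_left hφ h6.1.le (h1 ▸ h6.2), hP.eq_left hψ h6.1.le (h1 ▸ h6.2), hl]
  rcases lt_trichotomy τ (x i true) with h2 | h2 | h2
  · rw [hP.eq_mid hφ h1 h2, hP.eq_mid hψ h1 h2, hmid]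
  · obtain ⟨u, ⟨h4, h5⟩, h6⟩ := ((((hφ.loc τ hdτ).and (hψ.loc τ hdτ)).filter_mono
      (nhdsWithin_le_nhds (s := Ioi τ))).and (Ioo_mem_nhdsGT (show τ < S.c i + S.r by
        rw [h2]; exact hP.upper i))).exists
    rw [← h4, ← h5, hP.eq_right hφ (h2 ▸ h6.1) h6.2.le, hP.eq_right hψ (h2 ▸ h6.1) h6.2.le, hr]
  · rw [hP.eq_right hφ h2 (by linarith), hP.eq_right hψ h2 (by linarith), hr]

end Picture

/-! ### Extension of invariant functions over the strands -/

section Extension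

variable {k : ℕ} {α : Type*}

/-- The piecewise constant function on the `i`-th strand. -/
noncomputable def strandPiece (x : Fin k → Bool → ℝ) (I M O : Fin k → α) (i : Fin k) (t : ℝ) : α :=
  if t < x i false then I i else if t < x i true then M i else O i

open Classical in
/-- The function `φ` outside the strands, and a piecewise constant function on the strands. -/
noncomputable def strandExt (S : Strands k) (x : Fin k → Bool → ℝ) (φ : ℝ → α) (I M O : Fin k → α)
    (t : ℝ) : α :=
  if h : ∃ p : Fin k × ℤ, |t - (S.c p.1 + p.2)| ≤ S.r then
    strandPiece x I M O h.choose.1 (t - h.choose.2)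
  else φ t

variable {S : Strands k} {x : Fin k → Bool → ℝ} {φ : ℝ → α} {I M O : Fin k → α}

theorem strandPiece_left {i : Fin k} {t : ℝ} (h : t < x i false) :
    strandPiece x I M O i t = I i := if_pos h

theorem strandPiece_mid {i : Fin k} {t : ℝ} (h : x i false ≤ t) (h' : t < x i true) :
    strandPiece x I M O i t = M i := (if_neg h.not_gt).trans (if_pos h')

theorem strandPiece_right {i : Fin k} {t : ℝ} (h : x i false ≤ x i true) (h' : x i true ≤ t) :
    strandPiece x I M O i t = O i := (if_neg (h.trans h').not_gt).trans (if_neg h'.not_gt)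

theorem strandExt_of_outside {t : ℝ} (h : S.Outside t) : strandExt S x φ I M O t = φ t := by
  refine dif_neg ?_
  rintro ⟨p, hp⟩
  exact absurd (h p.1 p.2) (not_lt.2 hp)

theorem strandExt_of_inside {t : ℝ} {i : Fin k} {n : ℤ} (h : |t - (S.c i + n)| ≤ S.r) :
    strandExt S x φ I M O t = strandPiece x I M O i (t - n) := by
  have h1 : ∃ p : Fin k × ℤ, |t - (S.c p.1 + p.2)| ≤ S.r := ⟨(i, n), h⟩
  unfold strandExt
  rw [dif_pos h1]
  obtain ⟨h2, h3⟩ := S.eq_of_abs_sub_le (h.trans S.r_lt.le) (h1.choose_spec.trans S.r_lt.le)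
  rw [← h2, ← h3]

theorem eventually_strandExt_eq {t : ℝ} {i : Fin k} {n : ℤ} (h : |t - (S.c i + n)| < S.r) :
    ∀ᶠ u in 𝓝 t, strandExt S x φ I M O u = strandPiece x I M O i (u - n) := by
  have hc : Continuous fun u : ℝ => |u - (S.c i + n)| := by fun_prop
  filter_upwards [hc.continuousAt.eventually_lt_const h] with u hu
  exact strandExt_of_inside hu.le

variable {P P' : SphericalCurve} {rel rel' : Fin k × Bool → Fin k × Bool → Prop}
  {x' : Fin k → Bool → ℝ}

theorem Picture.eventually_piece_pre (hP : Picture P S x rel) (a : Fin k × Bool) :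
    ∀ᶠ t in 𝓝[<] (x a.1 a.2), strandPiece x I M O a.1 t = preVal I M a := by
  obtain ⟨i, b⟩ := a
  cases b
  · filter_upwards [self_mem_nhdsWithin] with t ht
    exact strandPiece_left ht
  · filter_upwards [Ioo_mem_nhdsLT (hP.lt i)] with t ht
    exact strandPiece_mid ht.1.le ht.2

theorem Picture.eventually_piece_post (hP : Picture P S x rel) (a : Fin k × Bool) :
    ∀ᶠ t in 𝓝[≥] (x a.1 a.2), strandPiece x I M O a.1 t = postVal M O a := by
  obtain ⟨i, b⟩ := a
  cases b
  · filter_upwards [Ico_mem_nhdsGE (hP.lt i)] with t ht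
    exact strandPiece_mid ht.1 ht.2
  · filter_upwards [self_mem_nhdsWithin] with t ht
    exact strandPiece_right (hP.lt i).le ht

theorem Picture.eventually_piece_eq (hP : Picture P S x rel) (hres : Resolves rel I M O) {i : Fin k}
    {t : ℝ} (h : ∀ b, t = x i b → ∀ b', ¬ rel (i, b) b') :
    ∀ᶠ u in 𝓝 t, strandPiece x I M O i u = strandPiece x I M O i t := by
  by_cases hb : ∃ b, t = x i b
  · obtain ⟨b, rfl⟩ := hb
    have h1 : preVal I M (i, b) = postVal M O (i, b) := hres.2 _ (h b rfl)
    have h2 := hP.eventually_piece_pre (I := I) (M := M) (O := O) (i, b)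
    have h3 := hP.eventually_piece_post (I := I) (M := M) (O := O) (i, b)
    have h4 : strandPiece x I M O i (x i b) = postVal M O (i, b) := h3.self_of_nhdsWithin self_mem_Ici
    rw [← nhdsLT_sup_nhdsGE, eventually_sup]
    refine ⟨h2.mono fun u hu => ?_, h3.mono fun u hu => ?_⟩
    · rw [hu, h4, h1]
    · rw [hu, h4]
  · push Not at hb
    rcases lt_or_gt_of_ne (hb false) with h1 | h1
    · filter_upwards [Iio_mem_nhds h1] with u hu
      rw [strandPiece_left hu, strandPiece_left h1]
    rcases lt_or_gt_of_ne (hb true) with h2 | h2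
    · filter_upwards [Ioo_mem_nhds h1 h2] with u hu
      rw [strandPiece_mid hu.1.le hu.2, strandPiece_mid h1.le h2]
    · filter_upwards [Ioi_mem_nhds h2] with u hu
      rw [strandPiece_right (hP.lt i).le (le_of_lt hu), strandPiece_right (hP.lt i).le h2.le]

/-- The data of a local replacement: `P` and `P'` agree outside the strands. -/
structure SameOutside (P P' : SphericalCurve) (S : Strands k) : Prop where
  isDoublePair_iff : ∀ s t, S.Outside s → S.Outside t → (P.IsDoublePair s t ↔ P'.IsDoublePair s t)
  sgn_eq : ∀ s t, S.Outside s → S.Outside t → P'.sgn s t = P.sgn s t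

theorem SameOutside.symm (h : SameOutside P P' S) : SameOutside P' P S where
  isDoublePair_iff s t hs ht := (h.isDoublePair_iff s t hs ht).symm
  sgn_eq s t hs ht := (h.sgn_eq s t hs ht).symm

theorem Picture.outside_of_isDoublePair (hP : Picture P S x rel) {s t : ℝ} (hs : S.Outside s)
    (h : P.IsDoublePair s t) : S.Outside t := by
  by_contra ht
  exact hP.sep s t hs ht h

theorem SameOutside.isDoubleParam_iff (h : SameOutside P P' S) (hP : Picture P S x rel)
    (hP' : Picture P' S x' rel') {t : ℝ} (ht : S.Outside t) :
    P.IsDoubleParam t ↔ P'.IsDoubleParam t := by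
  constructor
  · rintro ⟨s, hs⟩
    exact ⟨s, (h.isDoublePair_iff t s ht (hP.outside_of_isDoublePair ht hs)).1 hs⟩
  · rintro ⟨s, hs⟩
    exact ⟨s, (h.isDoublePair_iff t s ht (hP'.outside_of_isDoublePair ht hs)).2 hs⟩

/-- The equations `Resolves` are all that is needed to continue an invariant function of `P'` from
the outside over the strands of `P`: they give the gluing at paired marks and local constancy at the
others, and the prescribed end values give continuity across the collars. -/
theorem Picture.seifertInv_strandExt (hP : Picture P S x rel) (hP' : Picture P' S x' rel')
    (hout : SameOutside P P' S) (hφ : P'.SeifertInv φ) (hI : ∀ i, φ (S.c i - S.r) = I i)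
    (hO : ∀ i, φ (S.c i + S.r) = O i) (hres : Resolves rel I M O) :
    P.SeifertInv (strandExt S x φ I M O) := by
  have hr := S.r_pos
  have hrR := S.r_lt
  refine ⟨fun t ht => ?_, fun t ht => ?_, fun p q hpq => ?_⟩
  · by_cases hin : S.Outside t
    · have h1 : S.Outside (t + 1) := by
        have := (S.outside_add_int (t := t) 1).2 hin
        rwa [Int.cast_one] at this
      rw [strandExt_of_outside hin, strandExt_of_outside h1]
      exact hφ.per t ((hout.isDoubleParam_iff hP hP' hin).not.1 ht)
    · obtain ⟨i, n, h1⟩ := S.not_outside_iff.1 hin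
      have h2 : |t + 1 - (S.c i + ((n + 1 : ℤ) : ℝ))| ≤ S.r := by
        convert h1 using 2
        push_cast
        ring
      rw [strandExt_of_inside h1, strandExt_of_inside h2]
      congr 1
      push_cast
      ring
  · by_cases hin : S.Outside t
    · have h1 := hφ.loc t ((hout.isDoubleParam_iff hP hP' hin).not.1 ht)
      filter_upwards [h1, Strands.Outside.eventually S hin] with u h2 h3
      rw [strandExt_of_outside h3, strandExt_of_outside hin, h2]
    · obtain ⟨i, n, h1⟩ := S.not_outside_iff.1 hin
      rcases lt_or_eq_of_le h1 with h2 | h2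
      · have h3 : ∀ b, t - n = x i b → ∀ b', ¬ rel (i, b) b' := by
          intro b hb b' hr
          have h4 := (hP.isDoublePair_of_rel hr).left
          simp only [← hb] at h4
          rw [← SphericalCurve.isDoubleParam_add_int n, sub_add_cancel] at h4
          exact ht h4
        have h4 := hP.eventually_piece_eq (I := I) (M := M) (O := O) hres h3
        have h5 : Tendsto (fun u : ℝ => u - n) (𝓝 t) (𝓝 (t - n)) :=
          (continuous_id.sub continuous_const).tendsto t
        filter_upwards [h5.eventually h4, eventually_strandExt_eq h2] with u h6 h7
        rw [h7, h6, strandExt_of_inside h1]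
      -- At an end of a strand the constant end piece on one side has to agree with `φ` on the
      -- collar on the other side.
      · rcases eq_or_eq_neg_of_abs_eq h2 with h3 | h3
        · have ht' : t = S.c i + S.r + n := by linarith
          have hd : ¬ P'.IsDoubleParam t := by
            rw [ht']
            exact hP'.not_isDoubleParam_right i n
          have hval : strandExt S x φ I M O t = O i := by
            rw [strandExt_of_inside h1, ht', add_sub_cancel_right]
            exact strandPiece_right (hP.lt i).le (hP.upper i).le
          have hφt : φ t = O i := by
            rw [ht', hφ.add_int, hO]
            rwa [ht', SphericalCurve.isDoubleParam_add_int] at hd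
          have e1 : x i true + n < t := by
            rw [ht']
            linarith [hP.upper i]
          filter_upwards [hφ.loc t hd, Ioo_mem_nhds e1
            (show t < S.c i + S.R + n by linarith)] with u h4 h5
          rw [hval]
          rcases le_or_gt u t with h6 | h6
          · have h7 : |u - (S.c i + n)| ≤ S.r := by
              rw [abs_le]
              constructor <;> linarith [h5.1, hP.lower i, hP.lt i]
            rw [strandExt_of_inside h7]
            exact strandPiece_right (hP.lt i).le (by linarith [h5.1])
          · rw [strandExt_of_outside, h4, hφt]
            refine S.outside_of_collar (i := i) (n := n) ?_ ?_
            · rw [lt_abs]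
              left
              linarith
            · rw [abs_le]
              constructor <;> linarith [h5.2]
        · have ht' : t = S.c i - S.r + n := by linarith
          have hd : ¬ P'.IsDoubleParam t := by
            rw [ht']
            exact hP'.not_isDoubleParam_left i n
          have hval : strandExt S x φ I M O t = I i := by
            rw [strandExt_of_inside h1, ht', add_sub_cancel_right]
            exact strandPiece_left (hP.lower i)
          have hφt : φ t = I i := by
            rw [ht', hφ.add_int, hI]
            rwa [ht', SphericalCurve.isDoubleParam_add_int] at hd
          have e1 : t < x i false + n := by
            rw [ht']
            linarith [hP.lower i]
          filter_upwards [hφ.loc t hd, Ioo_mem_nhds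
            (show S.c i - S.R + n < t by linarith) e1] with u h4 h5
          rw [hval]
          rcases le_or_gt t u with h6 | h6
          · have h7 : |u - (S.c i + n)| ≤ S.r := by
              rw [abs_le]
              constructor <;> linarith [h5.2, hP.upper i, hP.lt i]
            rw [strandExt_of_inside h7]
            exact strandPiece_left (by linarith [h5.2])
          · rw [strandExt_of_outside, h4, hφt]
            refine S.outside_of_collar (i := i) (n := n) ?_ ?_
            · rw [lt_abs]
              right
              linarith
            · rw [abs_le]
              constructor <;> linarith [h5.1]
  · by_cases hp : S.Outside p
    · have hq := hP.outside_of_isDoublePair hp hpq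
      obtain ⟨a, h1, h2⟩ := hφ.glue p q ((hout.isDoublePair_iff p q hp hq).1 hpq)
      refine ⟨a, ?_, ?_⟩
      · filter_upwards [h1, (Strands.Outside.eventually S hp).filter_mono nhdsWithin_le_nhds]
          with u h3 h4
        rw [strandExt_of_outside h4, h3]
      · filter_upwards [h2, (Strands.Outside.eventually S hq).filter_mono nhdsWithin_le_nhds]
          with u h3 h4
        rw [strandExt_of_outside h4, h3]
    · have hq : ¬ S.Outside q := fun hq => hp (hP.outside_of_isDoublePair hq hpq.symm)
      obtain ⟨a, b, hab, ⟨n, rfl⟩, ⟨m, rfl⟩⟩ := (hP.pairs p q hp hq).1 hpq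
      refine ⟨preVal I M a, ?_, ?_⟩
      · have h1 : |x a.1 a.2 + n - (S.c a.1 + n)| < S.r := by
          rw [add_sub_add_right_eq_sub]
          exact hP.abs_mark_lt a.1 a.2
        have h2 : Tendsto (fun u : ℝ => u - n) (𝓝[<] (x a.1 a.2 + n)) (𝓝[<] (x a.1 a.2)) := by
          refine tendsto_nhdsWithin_iff.2 ⟨?_, ?_⟩
          · have : Tendsto (fun u : ℝ => u - n) (𝓝 (x a.1 a.2 + n)) (𝓝 (x a.1 a.2 + n - n)) :=
              (continuous_id.sub continuous_const).tendsto _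
            rw [add_sub_cancel_right] at this
            exact this.mono_left nhdsWithin_le_nhds
          · filter_upwards [self_mem_nhdsWithin] with u hu
            have h3 : u < x a.1 a.2 + n := hu
            exact sub_lt_iff_lt_add.2 h3
        filter_upwards [h2.eventually (hP.eventually_piece_pre (I := I) (M := M) (O := O) a),
          (eventually_strandExt_eq h1).filter_mono nhdsWithin_le_nhds] with u h3 h4
        rw [h4, h3]
      · have h1 : |x b.1 b.2 + m - (S.c b.1 + m)| < S.r := by
          rw [add_sub_add_right_eq_sub]
          exact hP.abs_mark_lt b.1 b.2
        have h2 : Tendsto (fun u : ℝ => u - m) (𝓝[>] (x b.1 b.2 + m)) (𝓝[≥] (x b.1 b.2)) := by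
          refine tendsto_nhdsWithin_iff.2 ⟨?_, ?_⟩
          · have : Tendsto (fun u : ℝ => u - m) (𝓝 (x b.1 b.2 + m)) (𝓝 (x b.1 b.2 + m - m)) :=
              (continuous_id.sub continuous_const).tendsto _
            rw [add_sub_cancel_right] at this
            exact this.mono_left nhdsWithin_le_nhds
          · filter_upwards [self_mem_nhdsWithin] with u hu
            have h3 : x b.1 b.2 + m < u := hu
            exact (lt_sub_iff_add_lt.2 h3).le
        filter_upwards [h2.eventually (hP.eventually_piece_post (I := I) (M := M) (O := O) b),
          (eventually_strandExt_eq h1).filter_mono nhdsWithin_le_nhds] with u h3 h4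
        rw [h4, h3, hres.1 a b hab]

theorem Picture.strandExt_mid (hP : Picture P S x rel) (i : Fin k) :
    strandExt S x φ I M O ((x i false + x i true) / 2) = M i := by
  have h1 := hP.lower i
  have h2 := hP.lt i
  have h3 := hP.upper i
  have h4 : |(x i false + x i true) / 2 - (S.c i + ((0 : ℤ) : ℝ))| ≤ S.r := by
    rw [Int.cast_zero, add_zero, abs_le]
    constructor <;> linarith
  rw [strandExt_of_inside h4, Int.cast_zero, sub_zero]
  exact strandPiece_mid (by linarith) (by linarith)

theorem Picture.not_isDoubleParam_mid (hP : Picture P S x rel) (i : Fin k) :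
    ¬ P.IsDoubleParam ((x i false + x i true) / 2) := by
  have h1 := hP.lower i
  have h2 := hP.lt i
  have h3 := hP.upper i
  refine hP.not_isDoubleParam_of_ne (i := i) ?_ fun b hb => ?_
  · rw [abs_le]
    constructor <;> linarith
  · cases b <;> linarith

/-- If the strands of `P` and `P'` impose the same conditions after Seifert resolution, and there
is no circle inside the disk, then the numbers of Seifert circles are equal. -/
theorem numSeifert_eq_of_resolves (hP : Picture P S x rel) (hP' : Picture P' S x' rel')
    (hout : SameOutside P P' S)
    (hsol : ∀ (α : Type) (I O : Fin k → α),
      (∃ M, Resolves rel I M O) ↔ ∃ M, Resolves rel' I M O)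
    (huniq : ∀ (α : Type) (I O M M' : Fin k → α), Resolves rel I M O → Resolves rel I M' O → M = M')
    (huniq' : ∀ (α : Type) (I O M M' : Fin k → α), Resolves rel' I M O → Resolves rel' I M' O →
      M = M') : P'.numSeifert = P.numSeifert := by
  -- The values of the circle map of `P'` at the ends of the strands solve the equations of `P'`,
  -- hence those of `P`; so this map continues from the outside to an invariant function of `P`.
  have key : ∀ {P P' : SphericalCurve} {x x' : Fin k → Bool → ℝ}
      {rel rel' : Fin k × Bool → Fin k × Bool → Prop}, Picture P S x rel → Picture P' S x' rel' →
      SameOutside P P' S →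
      (∀ (α : Type) (I O : Fin k → α), (∃ M, Resolves rel' I M O) → ∃ M, Resolves rel I M O) →
      ∃ φ : ℝ → Quot P'.SeifertAdj, P.SeifertInv φ ∧ ∀ t, S.Outside t → φ t = P'.circle t := by
    intro P P' x x' rel rel' hP hP' hout h
    obtain ⟨M, hM⟩ := h _ _ _ ⟨_, hP'.resolves P'.seifertInv_circle⟩
    exact ⟨_, hP.seifertInv_strandExt hP' hout P'.seifertInv_circle (fun _ => rfl) (fun _ => rfl) hM,
      fun t ht => strandExt_of_outside ht⟩
  obtain ⟨φ, hφ, hφ'⟩ := key hP hP' hout fun α I O => (hsol α I O).2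
  obtain ⟨ψ, hψ, hψ'⟩ := key hP' hP hout.symm fun α I O => (hsol α I O).1
  -- The two induced maps between the sets of circles are inverse to each other: the composite is
  -- the identity outside, and on the middle pieces because these are determined by the ends.
  have key2 : ∀ {P P' : SphericalCurve} {x x' : Fin k → Bool → ℝ}
      {rel rel' : Fin k × Bool → Fin k × Bool → Prop}, Picture P S x rel → Picture P' S x' rel' →
      SameOutside P P' S →
      (∀ (α : Type) (I O M M' : Fin k → α), Resolves rel I M O → Resolves rel I M' O → M = M') →
      ∀ {φ : ℝ → Quot P'.SeifertAdj} {ψ : ℝ → Quot P.SeifertAdj} (hφ : P.SeifertInv φ)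
      (hψ : P'.SeifertInv ψ), (∀ t, S.Outside t → φ t = P'.circle t) →
      (∀ t, S.Outside t → ψ t = P.circle t) → Function.LeftInverse hψ.lift hφ.lift := by
    intro P P' x x' rel rel' hP hP' hout hu φ ψ hφ hψ hφ' hψ' q
    obtain ⟨t, ht, rfl⟩ := SphericalCurve.exists_circle_eq q
    rw [hφ.lift_circle ht]
    have h1 := hφ.comp hψ.lift
    have h2 : ∀ t, S.Outside t → ¬ P.IsDoubleParam t → hψ.lift (φ t) = P.circle t := by
      intro t ht hd
      rw [hφ' t ht, hψ.lift_circle ((hout.isDoubleParam_iff hP hP' ht).not.1 hd), hψ' t ht]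
    refine hP.eq_of_eq_outside h1 P.seifertInv_circle h2 (fun i => ?_) ht
    have hl : (fun i => hψ.lift (φ (S.c i - S.r))) = fun i => P.circle (S.c i - S.r) := by
      ext i
      obtain ⟨u, h3, h4, h5, h6⟩ := hP.exists_outside_left i h1 P.seifertInv_circle
      rw [h5, h6, h2 u h3 h4]
    have hr : (fun i => hψ.lift (φ (S.c i + S.r))) = fun i => P.circle (S.c i + S.r) := by
      ext i
      obtain ⟨u, h3, h4, h5, h6⟩ := hP.exists_outside_right i h1 P.seifertInv_circle
      rw [h5, h6, h2 u h3 h4]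
    have h3 := hP.resolves h1
    rw [hl, hr] at h3
    exact congrFun (hu _ _ _ _ _ h3 (hP.resolves P.seifertInv_circle)) i
  exact Nat.card_congr ⟨hψ.lift, hφ.lift, key2 hP' hP hout.symm huniq' hψ hφ hψ' hφ',
    key2 hP hP' hout huniq hφ hψ hφ' hψ'⟩

end Extension

/-- A kink on a strand produces one additional Seifert circle. -/
theorem numSeifert_of_kink {S : Strands 1} {P P' : SphericalCurve} {x x' : Fin 1 → Bool → ℝ}
    (hP : Picture P S x fun _ _ => False) (hP' : Picture P' S x' fun a b => a.2 ≠ b.2)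
    (hout : SameOutside P P' S) : P'.numSeifert = P.numSeifert + 1 := by
  have hres : ∀ {α : Type} (I M : Fin 1 → α), Resolves (fun a b => a.2 ≠ b.2) I M I := by
    intro α I M
    constructor
    · rintro ⟨i, b⟩ ⟨j, b'⟩ h
      obtain rfl : i = j := Subsingleton.elim _ _
      cases b <;> cases b' <;> simp_all [preVal, postVal]
    · rintro ⟨i, b⟩ h
      exact absurd (h (i, !b)) (by simp)
  have hres0 : ∀ {α : Type} (I : Fin 1 → α), Resolves (fun _ _ : Fin 1 × Bool => False) I I I := by
    intro α I
    refine ⟨fun _ _ h => h.elim, ?_⟩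
    rintro ⟨i, b⟩ -
    cases b <;> rfl
  -- the two ends of the strand are joined, in both curves
  have e1 : (fun i => some (P.circle (S.c i + S.r))) = fun i => some (P.circle (S.c i - S.r)) := by
    ext1 i
    have h1 := (hP.resolves P.seifertInv_circle).2 (i, false) fun _ h => h
    have h2 := (hP.resolves P.seifertInv_circle).2 (i, true) fun _ h => h
    simp only [preVal, postVal, if_true] at h1 h2
    exact congrArg some (by simpa using (h2.symm.trans h1.symm))
  have e2 : (fun i => P'.circle (S.c i + S.r)) = fun i => P'.circle (S.c i - S.r) := by
    ext1 i
    have h1 := (hP'.resolves P'.seifertInv_circle).1 (i, false) (i, true) (by simp)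
    simpa [preVal, postVal] using h1.symm
  -- The middle piece of the kink is subject to no condition from outside: it is the new circle, to
  -- which the value `none` is given.
  have hφ := hP'.seifertInv_strandExt (I := fun i => some (P.circle (S.c i - S.r)))
    (O := fun i => some (P.circle (S.c i - S.r))) (M := fun _ => none) hP hout.symm
    (P.seifertInv_circle.comp some) (fun _ => rfl) (fun i => congrFun e1 i) (hres _ _)
  have hψ := hP.seifertInv_strandExt (I := fun i => P'.circle (S.c i - S.r))
    (O := fun i => P'.circle (S.c i - S.r)) (M := fun i => P'.circle (S.c i - S.r)) hP' hout
    P'.seifertInv_circle (fun _ => rfl) (fun i => congrFun e2 i) (hres0 _)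
  set φ := strandExt S x' (fun t => some (P.circle t)) (fun i => some (P.circle (S.c i - S.r)))
    (fun _ => none) (fun i => some (P.circle (S.c i - S.r))) with hφdef
  set ψ := strandExt S x P'.circle (fun i => P'.circle (S.c i - S.r))
    (fun i => P'.circle (S.c i - S.r)) (fun i => P'.circle (S.c i - S.r)) with hψdef
  set m := (x' 0 false + x' 0 true) / 2 with hm
  have hdm : ¬ P'.IsDoubleParam m := hP'.not_isDoubleParam_mid 0
  let G : Option (Quot P.SeifertAdj) → Quot P'.SeifertAdj := fun o =>
    o.elim (P'.circle m) hψ.lift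
  have h1 : Function.LeftInverse G hφ.lift := by
    intro q
    obtain ⟨t, ht, rfl⟩ := SphericalCurve.exists_circle_eq q
    rw [hφ.lift_circle ht]
    refine hP'.eq_of_eq_outside (hφ.comp G) P'.seifertInv_circle (fun t ht hd => ?_) (fun i => ?_) ht
    · rw [hφdef, strandExt_of_outside ht]
      have hd' := (hout.isDoubleParam_iff hP hP' ht).not.2 hd
      change hψ.lift (P.circle t) = _
      rw [hψ.lift_circle hd', hψdef, strandExt_of_outside ht]
    · rw [hφdef, hP'.strandExt_mid]
      obtain rfl : i = 0 := Subsingleton.elim _ _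
      rfl
  have h2 : Function.RightInverse G hφ.lift := by
    rintro (_ | q)
    · change hφ.lift (P'.circle m) = none
      rw [hφ.lift_circle hdm, hφdef, hm, hP'.strandExt_mid]
    · change hφ.lift (hψ.lift q) = some q
      obtain ⟨t, ht, rfl⟩ := SphericalCurve.exists_circle_eq q
      rw [hψ.lift_circle ht]
      have h3 : ∀ t, S.Outside t → ¬ P.IsDoubleParam t → hφ.lift (ψ t) = some (P.circle t) := by
        intro t ht hd
        have hd' := (hout.isDoubleParam_iff hP hP' ht).not.1 hd
        rw [hψdef, strandExt_of_outside ht, hφ.lift_circle hd', hφdef, strandExt_of_outside ht]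
      have h4 := hψ.comp hφ.lift
      have h5 := P.seifertInv_circle.comp some
      refine hP.eq_of_eq_outside h4 h5 h3 (fun i => ?_) ht
      have h6 := (hP.resolves h4).2 (i, false) fun _ h => h
      have h7 := (hP.resolves h5).2 (i, false) fun _ h => h
      simp only [preVal, postVal] at h6 h7
      obtain ⟨u, h8, h9, h10, h11⟩ := hP.exists_outside_left i h4 h5
      simp only [Bool.false_eq_true, if_false] at h6 h7
      rw [← h6, ← h7, h10, h11, h3 u h8 h9]
  have h3 : P'.numSeifert = Nat.card (Option (Quot P.SeifertAdj)) :=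
    Nat.card_congr ⟨hφ.lift, G, h1, h2⟩
  rw [h3, Finite.card_option]
  rfl

/-! ### Chords with ends on the strands. -/

namespace Strands

variable {k : ℕ} {S : Strands (k + 1)}

/-- All strands lie in the period that starts with the strand `0`. -/
def Normalized (S : Strands (k + 1)) : Prop :=
  ∀ i, i ≠ 0 → S.c 0 + S.r < S.c i - S.r ∧ S.c i + S.r < S.c 0 - S.r + 1

theorem two_mul_r_lt (S : Strands (k + 1)) : 2 * S.r < 1 := by
  by_contra h
  have := S.disj 0 0 1 (by
    rw [Int.cast_one, sub_add_cancel_left, abs_neg, abs_one]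
    linarith [S.r_lt])
  exact one_ne_zero this.2

theorem Normalized.arc (h : S.Normalized) (i : Fin (k + 1)) :
    S.c 0 - S.r ≤ S.c i - S.r ∧ S.c i + S.r < S.c 0 - S.r + 1 := by
  have h1 := S.two_mul_r_lt
  have h2 := S.r_pos
  by_cases hi : i = 0
  · subst hi
    constructor <;> linarith
  · have := h i hi
    constructor <;> linarith

/-- A point outside the strands is on the same side of any two points of a strand. -/
theorem Outside.lt_iff {t : ℝ} (h : S.Outside t) {i : Fin (k + 1)} {y y' : ℝ}
    (hy : |y - S.c i| < S.r) (hy' : |y' - S.c i| < S.r) :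
    (t < y ↔ t < y') ∧ (y < t ↔ y' < t) := by
  have h1 := h i 0
  rw [Int.cast_zero, add_zero] at h1
  rw [abs_lt] at hy hy'
  rcases lt_abs.1 h1 with h2 | h2
  · exact ⟨⟨fun _ => by linarith, fun _ => by linarith⟩, ⟨fun _ => by linarith, fun _ => by linarith⟩⟩
  · exact ⟨⟨fun _ => by linarith, fun _ => by linarith⟩, ⟨fun _ => by linarith, fun _ => by linarith⟩⟩

/-- Sliding the ends of a chord along strands does not move them past an end of an outer chord. -/
theorem interlaced_congr {d n n' : ℝ × ℝ} (hd : S.Outside d.1 ∧ S.Outside d.2) {i j : Fin (k + 1)}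
    (h1 : |n.1 - S.c i| < S.r) (h1' : |n'.1 - S.c i| < S.r) (h2 : |n.2 - S.c j| < S.r)
    (h2' : |n'.2 - S.c j| < S.r) :
    (Interlaced d n ↔ Interlaced d n') ∧ (Interlaced n d ↔ Interlaced n' d) := by
  have a1 := hd.1.lt_iff h1 h1'
  have a2 := hd.2.lt_iff h1 h1'
  have a3 := hd.1.lt_iff h2 h2'
  have a4 := hd.2.lt_iff h2 h2'
  unfold Interlaced
  exact ⟨by rw [a1.1, a2.2, a4.1], by rw [a1.2, a3.1, a4.2]⟩

end Strands

section Chords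

variable {k : ℕ} {S : Strands (k + 1)} {P P' : SphericalCurve} {x x' : Fin (k + 1) → Bool → ℝ}
  {rel rel' : Fin (k + 1) × Bool → Fin (k + 1) × Bool → Prop}

open Classical in
/-- The chords with endpoints outside the strands. -/
noncomputable def outerChords (P : SphericalCurve) (S : Strands (k + 1)) : Finset (ℝ × ℝ) :=
  (P.chords (S.c 0 - S.r)).filter fun p => S.Outside p.1 ∧ S.Outside p.2

theorem outside_of_mem_outerChords {p : ℝ × ℝ} (h : p ∈ outerChords P S) :
    S.Outside p.1 ∧ S.Outside p.2 := by
  classical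
  exact (Finset.mem_filter.1 h).2

theorem SameOutside.outerChords_eq (h : SameOutside P P' S) : outerChords P' S = outerChords P S := by
  classical
  ext p
  simp only [outerChords, Finset.mem_filter, SphericalCurve.mem_chords_iff_isDoublePair]
  constructor
  · rintro ⟨⟨h1, h2, h3, h4⟩, h5, h6⟩
    exact ⟨⟨h1, h2, h3, (h.isDoublePair_iff _ _ h5 h6).2 h4⟩, h5, h6⟩
  · rintro ⟨⟨h1, h2, h3, h4⟩, h5, h6⟩
    exact ⟨⟨h1, h2, h3, (h.isDoublePair_iff _ _ h5 h6).1 h4⟩, h5, h6⟩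

namespace Picture

theorem isBase (hP : Picture P S x rel) : P.IsBase (S.c 0 - S.r) := by
  have := hP.not_isDoubleParam_left 0 0
  rwa [Int.cast_zero, add_zero] at this

/-- No chord joins a strand to the outside, and normalized strands lie in the period after the base
point, so that marks can be compared as real numbers. -/
theorem chords_eq (hP : Picture P S x rel) (hS : S.Normalized) {N : Finset (ℝ × ℝ)}
    (hN : ∀ p, p ∈ N ↔ ∃ a a', rel a a' ∧ x a.1 a.2 < x a'.1 a'.2 ∧ p = (x a.1 a.2, x a'.1 a'.2)) :
    P.chords (S.c 0 - S.r) = outerChords P S ∪ N ∧ Disjoint (outerChords P S) N := by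
  classical
  have hx : ∀ i b, S.c 0 - S.r < x i b ∧ x i b < S.c 0 - S.r + 1 := by
    intro i b
    have h1 := hS.arc i
    have h2 := abs_lt.1 (hP.abs_mark_lt i b)
    constructor <;> linarith
  constructor
  · ext ⟨s, t⟩
    rw [Finset.mem_union, hN, outerChords, Finset.mem_filter,
      SphericalCurve.mem_chords_iff_isDoublePair]
    constructor
    · rintro ⟨h1, h2, h3, h4⟩
      simp only at h1 h2 h3 h4
      by_cases hs : S.Outside s
      · exact Or.inl ⟨⟨h1, h2, h3, h4⟩, hs, hP.outside_of_isDoublePair hs h4⟩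
      · have ht : ¬ S.Outside t := fun ht => hs (hP.outside_of_isDoublePair ht h4.symm)
        obtain ⟨a, a', h5, h6, h7⟩ := (hP.pairs s t hs ht).1 h4
        have h8 := hx a.1 a.2
        have h9 := hx a'.1 a'.2
        have e1 := h6.eq_of_abs_sub_lt (by rw [abs_lt]; constructor <;> linarith)
        have e2 := h7.eq_of_abs_sub_lt (by rw [abs_lt]; constructor <;> linarith)
        exact Or.inr ⟨a, a', h5, by rwa [e1, e2], by rw [e1, e2]⟩
    · rintro (h | ⟨a, a', h1, h2, h3⟩)
      · exact h.1
      · obtain ⟨rfl, rfl⟩ := Prod.ext_iff.1 h3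
        exact ⟨(hx _ _).1, h2, (hx _ _).2, hP.isDoublePair_of_rel h1⟩
  · rw [Finset.disjoint_left]
    intro p hp hpN
    obtain ⟨a, a', -, -, rfl⟩ := (hN p).1 hpN
    have h1 := (outside_of_mem_outerChords hp).1
    have h2 := hP.not_outside_mark a.1 a.2 0
    rw [Int.cast_zero, add_zero] at h2
    exact h2 h1

end Picture

theorem crossSum_congr {A B : Finset (ℝ × ℝ)} {f f' : ℝ × ℝ → ℤ} (hA : ∀ c ∈ A, f' c = f c)
    (hB : ∀ c ∈ B, f' c = f c) : crossSum A B f' = crossSum A B f := by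
  classical
  unfold crossSum
  refine Finset.sum_congr rfl fun c hc => Finset.sum_congr rfl fun d hd => ?_
  rw [hA c hc, hB d hd]

theorem SameOutside.chordSgn_eq (h : SameOutside P P' S) {c : ℝ × ℝ} (hc : c ∈ outerChords P S) :
    P'.chordSgn c = P.chordSgn c :=
  h.sgn_eq _ _ (outside_of_mem_outerChords hc).1 (outside_of_mem_outerChords hc).2

/-! ### The move RI -/

/-- The chord of a kink has both ends on one strand and is interlaced with no other chord, so the
cross sum is unchanged; `s` and `c` both grow by 1. -/
theorem mu_eq_of_kink {S : Strands 1} {x x' : Fin 1 → Bool → ℝ} (hS : S.Normalized)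
    (hP : Picture P S x fun _ _ => False) (hP' : Picture P' S x' fun a b => a.2 ≠ b.2)
    (hout : SameOutside P P' S) :
    P'.mu (S.c 0 - S.r) = P.mu (S.c 0 - S.r) ∧ P'.kappa = P.kappa := by
  classical
  have h1 := (hP.chords_eq hS (N := ∅) (by simp)).1
  rw [Finset.union_empty] at h1
  set n : ℝ × ℝ := (x' 0 false, x' 0 true) with hn
  have hlt := hP'.lt 0
  have h2 := hP'.chords_eq hS (N := {n}) (by
    intro p
    rw [Finset.mem_singleton]
    constructor
    · rintro rfl
      exact ⟨(0, false), (0, true), by simp, hlt, rfl⟩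
    · rintro ⟨⟨i, b⟩, ⟨j, b'⟩, h, h', rfl⟩
      obtain rfl : i = 0 := Fin.ext (by omega)
      obtain rfl : j = 0 := Fin.ext (by omega)
      cases b <;> cases b'
      · exact absurd rfl h
      · rfl
      · exact absurd h' hlt.not_gt
      · exact absurd rfl h)
  rw [hout.outerChords_eq, ← h1] at h2
  have hC : ∀ c ∈ P.chords (S.c 0 - S.r), S.Outside c.1 ∧ S.Outside c.2 := fun c hc => by
    rw [h1] at hc
    exact outside_of_mem_outerChords hc
  have hn1 : ∀ c ∈ P.chords (S.c 0 - S.r), ¬ Interlaced c n := by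
    rintro c hc ⟨h3, h4, h5⟩
    have := ((hC c hc).2.lt_iff (hP'.abs_mark_lt 0 false) (hP'.abs_mark_lt 0 true)).2.1 h4
    exact lt_asymm h5 this
  have hn2 : ∀ c ∈ P.chords (S.c 0 - S.r), ¬ Interlaced n c := by
    rintro c hc ⟨h3, h4, h5⟩
    have := ((hC c hc).1.lt_iff (hP'.abs_mark_lt 0 false) (hP'.abs_mark_lt 0 true)).2.1 h3
    exact lt_asymm h4 this
  have hsum : crossSum (P'.chords (S.c 0 - S.r)) (P'.chords (S.c 0 - S.r)) P'.chordSgn =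
      crossSum (P.chords (S.c 0 - S.r)) (P.chords (S.c 0 - S.r)) P.chordSgn := by
    rw [h2.1, crossSum_union h2.2, crossSum_singleton_left, crossSum_singleton_right,
      crossSum_singleton_singleton, Finset.filter_false_of_mem hn1,
      Finset.filter_false_of_mem hn2, if_neg (not_interlaced_self n)]
    simp only [Finset.sum_empty, mul_zero, add_zero]
    exact crossSum_congr (fun c hc => hout.chordSgn_eq (h1 ▸ hc))
      fun c hc => hout.chordSgn_eq (h1 ▸ hc)
  have hs := numSeifert_of_kink hP hP' hout
  have hc : P'.numDouble = P.numDouble + 1 := by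
    rw [SphericalCurve.numDouble_eq_card_chords hP.isBase,
      SphericalCurve.numDouble_eq_card_chords hP'.isBase, h2.1, Finset.card_union_of_disjoint h2.2,
      Finset.card_singleton]
  constructor
  · rw [SphericalCurve.mu_eq, SphericalCurve.mu_eq, hsum, hs, hc]
    push_cast
    ring
  · rw [SphericalCurve.kappa, SphericalCurve.kappa, hs, hc]
    push_cast
    ring

/-! ### The weak move RII -/

/-- For strands running in the same direction, resolving both crossings exchanges the middle pieces
only: each end is joined to the other end of its own strand, as before, and no circle arises in the
bigon. -/
theorem numSeifert_of_bigon {S : Strands 2} {x x' : Fin 2 → Bool → ℝ}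
    (hP : Picture P S x fun _ _ => False) (hP' : Picture P' S x' fun a b => a.1 ≠ b.1 ∧ a.2 = b.2)
    (hout : SameOutside P P' S) : P'.numSeifert = P.numSeifert := by
  have h0 : ∀ {α : Type} (I M O : Fin 2 → α), Resolves (fun _ _ : Fin 2 × Bool => False) I M O ↔
      (I 0 = M 0 ∧ M 0 = O 0) ∧ I 1 = M 1 ∧ M 1 = O 1 := by
    intro α I M O
    simp [Resolves, preVal, postVal, Prod.forall]
  have h1 : ∀ {α : Type} (I M O : Fin 2 → α),
      Resolves (fun a b : Fin 2 × Bool => a.1 ≠ b.1 ∧ a.2 = b.2) I M O ↔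
      (I 0 = M 1 ∧ I 1 = M 0) ∧ M 0 = O 1 ∧ M 1 = O 0 := by
    intro α I M O
    constructor
    · rintro ⟨h, -⟩
      exact ⟨⟨h (0, false) (1, false) (by simp), h (1, false) (0, false) (by simp)⟩,
        h (0, true) (1, true) (by simp), h (1, true) (0, true) (by simp)⟩
    · rintro ⟨⟨h1, h2⟩, h3, h4⟩
      constructor
      · rintro ⟨i, b⟩ ⟨j, b'⟩ ⟨h5, h6⟩
        simp only at h5 h6
        subst h6
        fin_cases i <;> fin_cases j <;> cases b <;> simp_all [preVal, postVal]
      · rintro ⟨i, b⟩ h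
        exfalso
        fin_cases i
        · exact h (1, b) (by simp)
        · exact h (0, b) (by simp)
  refine numSeifert_eq_of_resolves hP hP' hout ?_ ?_ ?_
  · intro α I O
    simp only [h0, h1]
    constructor
    · rintro ⟨M, ⟨h2, h3⟩, h4, h5⟩
      exact ⟨![I 1, I 0], by simp [← h3, ← h5, h2, h4]⟩
    · rintro ⟨M, ⟨h2, h3⟩, h4, h5⟩
      exact ⟨![I 0, I 1], by simp [h2, h3, h4, h5]⟩
  · intro α I O M M' h h'
    rw [h0] at h h'
    ext i
    fin_cases i
    · exact h.1.1.symm.trans h'.1.1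
    · exact h.2.1.symm.trans h'.2.1
  · intro α I O M M' h h'
    rw [h1] at h h'
    ext i
    fin_cases i
    · exact h.1.2.symm.trans h'.1.2
    · exact h.1.1.symm.trans h'.1.1

/-- The two chords have their ends on the same two strands and opposite signs, so their products
with all outer chords cancel. They are interlaced with each other, with product -1. The cross sum
drops by 1, which adds 2 to `mu` and balances the two new double points. -/
theorem mu_eq_of_bigon {S : Strands 2} {x x' : Fin 2 → Bool → ℝ} (hS : S.Normalized)
    (hP : Picture P S x fun _ _ => False) (hP' : Picture P' S x' fun a b => a.1 ≠ b.1 ∧ a.2 = b.2)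
    (hout : SameOutside P P' S)
    (hsgn : P'.sgn (x' 0 true) (x' 1 true) = -P'.sgn (x' 0 false) (x' 1 false)) :
    P'.mu (S.c 0 - S.r) = P.mu (S.c 0 - S.r) := by
  classical
  have h1 := (hP.chords_eq hS (N := ∅) (by simp)).1
  rw [Finset.union_empty] at h1
  set n : Bool → ℝ × ℝ := fun b => (x' 0 b, x' 1 b) with hn
  have hx := hP'.abs_mark_lt
  simp only [abs_lt] at hx
  have hlt : ∀ b b', x' 0 b < x' 1 b' := by
    intro b b'
    have h2 := hx 0 b
    have h3 := hx 1 b'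
    have h4 := hS 1 (by simp)
    linarith
  have h2 := hP'.chords_eq hS (N := {n false} ∪ {n true}) (by
    intro p
    rw [Finset.mem_union, Finset.mem_singleton, Finset.mem_singleton]
    constructor
    · rintro (rfl | rfl)
      · exact ⟨(0, false), (1, false), by simp, hlt _ _, rfl⟩
      · exact ⟨(0, true), (1, true), by simp, hlt _ _, rfl⟩
    · rintro ⟨⟨i, b⟩, ⟨j, b'⟩, ⟨h, h''⟩, h', rfl⟩
      simp only at h h' h''
      subst h''
      fin_cases i <;> fin_cases j
      · exact absurd rfl h
      · cases b
        · exact Or.inl rfl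
        · exact Or.inr rfl
      · exact absurd h' (hlt _ _).not_gt
      · exact absurd rfl h)
  rw [hout.outerChords_eq, ← h1] at h2
  have hC : ∀ c ∈ P.chords (S.c 0 - S.r), S.Outside c.1 ∧ S.Outside c.2 := fun c hc => by
    rw [h1] at hc
    exact outside_of_mem_outerChords hc
  have hne : n false ≠ n true := fun h => (hP'.lt 0).ne (Prod.ext_iff.1 h).1
  have hd : Disjoint ({n false} : Finset (ℝ × ℝ)) {n true} := by simpa using hne
  have hi := fun c (hc : c ∈ P.chords (S.c 0 - S.r)) =>
    Strands.interlaced_congr (n := n true) (n' := n false) (hC c hc) (hP'.abs_mark_lt 0 true)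
      (hP'.abs_mark_lt 0 false) (hP'.abs_mark_lt 1 true) (hP'.abs_mark_lt 1 false)
  have hsgn' : P'.chordSgn (n true) = -P'.chordSgn (n false) := hsgn
  have hNN : Interlaced (n false) (n true) := ⟨hP'.lt 0, hlt _ _, hP'.lt 1⟩
  have hNN' : ¬ Interlaced (n true) (n false) := fun h => lt_asymm h.1 (hP'.lt 0)
  have hsum : crossSum (P'.chords (S.c 0 - S.r)) (P'.chords (S.c 0 - S.r)) P'.chordSgn =
      crossSum (P.chords (S.c 0 - S.r)) (P.chords (S.c 0 - S.r)) P.chordSgn - 1 := by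
    rw [h2.1, crossSum_union h2.2, crossSum_union hd, crossSum_union_left hd,
      crossSum_union_right hd]
    simp only [crossSum_singleton_singleton, if_pos hNN, if_neg hNN', if_neg (not_interlaced_self _)]
    simp only [crossSum_singleton_left, crossSum_singleton_right]
    rw [Finset.filter_congr fun c hc => (hi c hc).1, Finset.filter_congr fun c hc => (hi c hc).2,
      hsgn']
    have h3 : P'.chordSgn (n false) * P'.chordSgn (n false) = 1 := P'.sgn_mul_self _ _
    have h4 : crossSum (P.chords (S.c 0 - S.r)) (P.chords (S.c 0 - S.r)) P'.chordSgn =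
        crossSum (P.chords (S.c 0 - S.r)) (P.chords (S.c 0 - S.r)) P.chordSgn :=
      crossSum_congr (fun c hc => hout.chordSgn_eq (h1 ▸ hc))
        fun c hc => hout.chordSgn_eq (h1 ▸ hc)
    rw [h4]
    linear_combination -h3
  have hc : P'.numDouble = P.numDouble + 2 := by
    rw [SphericalCurve.numDouble_eq_card_chords hP.isBase,
      SphericalCurve.numDouble_eq_card_chords hP'.isBase, h2.1, Finset.card_union_of_disjoint h2.2,
      Finset.card_union_of_disjoint hd, Finset.card_singleton, Finset.card_singleton]
  rw [SphericalCurve.mu_eq, SphericalCurve.mu_eq, hsum, numSeifert_of_bigon hP hP' hout, hc]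
  push_cast
  ring

end Chords

/-! ### The weak move RIII. -/

/-- The pairing of the marks of three strands that cross pairwise; `E` tells the direction of the
strands. -/
def TriangleRel (E : Fin 3 → Bool) (a b : Fin 3 × Bool) : Prop :=
  (a = (0, E 0) ∧ b = (1, !E 1)) ∨ (a = (1, !E 1) ∧ b = (0, E 0)) ∨
  (a = (0, !E 0) ∧ b = (2, !E 2)) ∨ (a = (2, !E 2) ∧ b = (0, !E 0)) ∨
  (a = (1, E 1) ∧ b = (2, E 2)) ∨ (a = (2, E 2) ∧ b = (1, E 1))

section Resolution

variable {α : Type*} {E : Fin 3 → Bool} {I M M' O : Fin 3 → α}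

theorem resolves_triangleRel : Resolves (TriangleRel E) I M O ↔
    (preVal I M (0, E 0) = postVal M O (1, !E 1) ∧ preVal I M (1, !E 1) = postVal M O (0, E 0)) ∧
    (preVal I M (0, !E 0) = postVal M O (2, !E 2) ∧ preVal I M (2, !E 2) = postVal M O (0, !E 0)) ∧
    (preVal I M (1, E 1) = postVal M O (2, E 2) ∧ preVal I M (2, E 2) = postVal M O (1, E 1)) := by
  constructor
  · rintro ⟨h, -⟩
    refine ⟨⟨h _ _ ?_, h _ _ ?_⟩, ⟨h _ _ ?_, h _ _ ?_⟩, h _ _ ?_, h _ _ ?_⟩ <;>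
      simp [TriangleRel]
  · rintro ⟨⟨h1, h2⟩, ⟨h3, h4⟩, h5, h6⟩
    constructor
    · rintro a b (⟨rfl, rfl⟩ | ⟨rfl, rfl⟩ | ⟨rfl, rfl⟩ | ⟨rfl, rfl⟩ | ⟨rfl, rfl⟩ | ⟨rfl, rfl⟩) <;>
        assumption
    · rintro ⟨i, b⟩ h
      exfalso
      fin_cases i
      · rcases Bool.eq_or_eq_not b (E 0) with rfl | rfl
        · exact h (1, !E 1) (by simp [TriangleRel])
        · exact h (2, !E 2) (by simp [TriangleRel])
      · rcases Bool.eq_or_eq_not b (E 1) with rfl | rfl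
        · exact h (2, E 2) (by simp [TriangleRel])
        · exact h (0, E 0) (by simp [TriangleRel])
      · rcases Bool.eq_or_eq_not b (E 2) with rfl | rfl
        · exact h (1, E 1) (by simp [TriangleRel])
        · exact h (0, !E 0) (by simp [TriangleRel])

/-- If the triangle is not coherently oriented, each middle piece is joined to an incoming end,
possibly through another middle piece; this dictates the new middle values. The connection between
incoming and outgoing ends is the same for both triangles. In the excluded cases the middle pieces
would close up to a circle. -/
theorem Resolves.triangleRel_not (hE : ¬ (E 0 = E 1 ∧ E 2 = !E 0))
    (h : Resolves (TriangleRel E) I M O) : ∃ M', Resolves (TriangleRel fun i => !E i) I M' O := by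
  rw [resolves_triangleRel] at h
  simp only [resolves_triangleRel]
  cases h0 : E 0 <;> cases h1 : E 1 <;> cases h2 : E 2 <;>
    simp only [h0, h1, h2, preVal, postVal, Bool.not_true, Bool.not_false, if_true, if_false,
      Bool.false_eq_true, not_true, not_false_iff, and_self, and_true, and_false, reduceCtorEq] at h hE ⊢
  · exact ⟨![I 2, I 2, I 0], by simp only [Matrix.cons_val]; grind⟩
  · exact ⟨![I 2, I 0, I 0], by simp only [Matrix.cons_val]; grind⟩
  · exact ⟨![I 1, I 2, I 1], by simp only [Matrix.cons_val]; grind⟩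
  · exact ⟨![I 1, I 0, I 1], by simp only [Matrix.cons_val]; grind⟩
  · exact ⟨![I 1, I 0, I 0], by simp only [Matrix.cons_val]; grind⟩
  · exact ⟨![I 2, I 2, I 1], by simp only [Matrix.cons_val]; grind⟩

theorem Resolves.triangleRel_unique (hE : ¬ (E 0 = E 1 ∧ E 2 = !E 0))
    (h : Resolves (TriangleRel E) I M O) (h' : Resolves (TriangleRel E) I M' O) : M = M' := by
  rw [resolves_triangleRel] at h h'
  have key : M 0 = M' 0 ∧ M 1 = M' 1 ∧ M 2 = M' 2 := by
    cases h0 : E 0 <;> cases h1 : E 1 <;> cases h2 : E 2 <;>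
      simp only [h0, h1, h2, preVal, postVal, Bool.not_true, Bool.not_false, if_true, if_false,
        Bool.false_eq_true, not_true, not_false_iff, and_self, and_true, and_false, reduceCtorEq] at h h' hE <;>
      grind
  ext i
  fin_cases i
  exacts [key.1, key.2.1, key.2.2]

end Resolution

theorem crossSum_union_triple {O : Finset (ℝ × ℝ)} {A B C : ℝ × ℝ} (hAB : A ≠ B) (hAC : A ≠ C)
    (hBC : B ≠ C) (hd : Disjoint O ({A} ∪ {B} ∪ {C})) (f : ℝ × ℝ → ℤ) :
    crossSum (O ∪ ({A} ∪ {B} ∪ {C})) (O ∪ ({A} ∪ {B} ∪ {C})) f = crossSum O O f +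
      ((crossSum O {A} f + crossSum {A} O f) + (crossSum O {B} f + crossSum {B} O f) +
        (crossSum O {C} f + crossSum {C} O f)) +
      ((crossSum {A} {B} f + crossSum {B} {A} f) + (crossSum {A} {C} f + crossSum {C} {A} f) +
        (crossSum {B} {C} f + crossSum {C} {B} f)) := by
  have h1 : Disjoint ({A} : Finset (ℝ × ℝ)) {B} := by simpa using hAB
  have h2 : Disjoint ({A} ∪ {B} : Finset (ℝ × ℝ)) {C} := by
    simpa [Finset.disjoint_left] using ⟨hAC, hBC⟩
  have h0 : ∀ n : ℝ × ℝ, crossSum {n} {n} f = 0 := fun n => by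
    rw [crossSum_singleton_singleton, if_neg (not_interlaced_self n)]
  rw [crossSum_union hd, crossSum_union h2, crossSum_union h1, crossSum_union_left h2,
    crossSum_union_right h2, crossSum_union_left h1, crossSum_union_right h1,
    crossSum_union_left h1, crossSum_union_right h1, h0, h0, h0]
  ring

/-- The part of a cross sum that belongs to a chord with its endpoints on two strands depends only
on these strands. -/
theorem crossSum_singleton_congr {k : ℕ} {S : Strands (k + 1)} {O : Finset (ℝ × ℝ)}
    {n n' : ℝ × ℝ} {f f' : ℝ × ℝ → ℤ} (hO : ∀ d ∈ O, S.Outside d.1 ∧ S.Outside d.2)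
    (hf : ∀ d ∈ O, f' d = f d) (hn : f' n' = f n) {i j : Fin (k + 1)}
    (h1 : |n'.1 - S.c i| < S.r) (h1' : |n.1 - S.c i| < S.r) (h2 : |n'.2 - S.c j| < S.r)
    (h2' : |n.2 - S.c j| < S.r) :
    crossSum O {n'} f' + crossSum {n'} O f' = crossSum O {n} f + crossSum {n} O f := by
  classical
  simp only [crossSum_singleton_left, crossSum_singleton_right]
  have hi := fun d hd => Strands.interlaced_congr (hO d hd) h1 h1' h2 h2'
  rw [Finset.filter_congr fun d hd => (hi d hd).1, Finset.filter_congr fun d hd => (hi d hd).2, hn,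
    Finset.sum_congr rfl fun d hd => hf d (Finset.mem_filter.1 hd).1,
    Finset.sum_congr rfl fun d hd => hf d (Finset.mem_filter.1 hd).1]

section Triangle

variable {S : Strands 3} {P : SphericalCurve} {x : Fin 3 → Bool → ℝ} {E : Fin 3 → Bool}

-- Strand 0 comes first, but strands 1 and 2 may follow in either order, and `C` is read
-- accordingly. Any two of the three chords have ends on one common strand, and they are interlaced
-- for exactly one of the two orders of these ends; the move reverses all three orders.
open Classical in
theorem Picture.triangle_chords (hP : Picture P S x (TriangleRel E)) (hS : S.Normalized)
    {A B C : ℝ × ℝ} (hA : A = (x 0 (E 0), x 1 (!E 1))) (hB : B = (x 0 (!E 0), x 2 (!E 2)))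
    (hC : C = if S.c 1 < S.c 2 then (x 1 (E 1), x 2 (E 2)) else (x 2 (E 2), x 1 (E 1))) :
    P.chords (S.c 0 - S.r) = outerChords P S ∪ ({A} ∪ {B} ∪ {C}) ∧
    Disjoint (outerChords P S) ({A} ∪ {B} ∪ {C}) ∧ A ≠ B ∧ A ≠ C ∧ B ≠ C ∧
    ∀ f, (crossSum {A} {B} f + crossSum {B} {A} f) + (crossSum {A} {C} f + crossSum {C} {A} f) +
      (crossSum {B} {C} f + crossSum {C} {B} f) = if S.c 1 < S.c 2 then
        (if E 0 then 0 else f A * f B) + (if E 1 then 0 else f A * f C) +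
          (if E 2 then f B * f C else 0)
      else (if E 0 then f A * f B else 0) + (if E 1 then f A * f C else 0) +
          (if E 2 then 0 else f B * f C) := by
  have hx := hP.abs_mark_lt
  simp only [abs_lt] at hx
  have h01 : ∀ b b', x 0 b < x 1 b' := fun b b' => by
    linarith [hx 0 b, hx 1 b', hS 1 (by decide)]
  have h02 : ∀ b b', x 0 b < x 2 b' := fun b b' => by
    linarith [hx 0 b, hx 2 b', hS 2 (by decide)]
  have hlt := hP.lt
  have hne : ∀ i, x i (E i) ≠ x i (!E i) := fun i => by
    cases E i
    exacts [(hlt i).ne, (hlt i).ne']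
  have hne1 : ∀ b b', x 0 b ≠ x 1 b' := fun b b' => (h01 b b').ne
  have hne2 : ∀ b b', x 0 b ≠ x 2 b' := fun b b' => (h02 b b').ne
  by_cases h12 : S.c 1 < S.c 2
  · have h12' : ∀ b b', x 1 b < x 2 b' := fun b b' => by
      have h3 := mt (S.disj 1 2 0) (by decide)
      rw [Int.cast_zero, add_zero, abs_of_neg (by linarith), not_le] at h3
      linarith [hx 1 b, hx 2 b', S.r_lt]
    rw [if_pos h12] at hC
    have hN := hP.chords_eq hS (N := {A} ∪ {B} ∪ {C}) (by
      intro p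
      simp only [Finset.mem_union, Finset.mem_singleton]
      constructor
      · rintro ((rfl | rfl) | rfl)
        · exact ⟨(0, E 0), (1, !E 1), by simp [TriangleRel], h01 _ _, hA⟩
        · exact ⟨(0, !E 0), (2, !E 2), by simp [TriangleRel], h02 _ _, hB⟩
        · exact ⟨(1, E 1), (2, E 2), by simp [TriangleRel], h12' _ _, hC⟩
      · rintro ⟨a, a', h, h', rfl⟩
        rcases h with ⟨rfl, rfl⟩ | ⟨rfl, rfl⟩ | ⟨rfl, rfl⟩ | ⟨rfl, rfl⟩ | ⟨rfl, rfl⟩ | ⟨rfl, rfl⟩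
        · exact Or.inl (Or.inl hA.symm)
        · exact absurd h' (h01 _ _).not_gt
        · exact Or.inl (Or.inr hB.symm)
        · exact absurd h' (h02 _ _).not_gt
        · exact Or.inr hC.symm
        · exact absurd h' (h12' _ _).not_gt)
    refine ⟨hN.1, hN.2, ?_, ?_, ?_, fun f => ?_⟩
    · rw [hA, hB]
      exact fun h => hne 0 (Prod.ext_iff.1 h).1
    · rw [hA, hC]
      exact fun h => hne1 _ _ (Prod.ext_iff.1 h).1
    · rw [hB, hC]
      exact fun h => hne1 _ _ (Prod.ext_iff.1 h).1
    · simp only [crossSum_singleton_singleton, Interlaced, if_pos h12]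
      subst hA hB hC
      have k0 := hlt 0
      have k1 := hlt 1
      have k2 := hlt 2
      simp only [h01, h02, h12', (h01 _ _).not_gt, (h12' _ _).not_gt]
      cases h0 : E 0 <;> cases h1 : E 1 <;> cases h2 : E 2 <;>
        simp [k0, k1, k2, k0.not_gt, k1.not_gt, k2.not_gt]
  · have h12' : ∀ b b', x 2 b < x 1 b' := fun b b' => by
      have h3 := mt (S.disj 1 2 0) (by decide)
      rw [Int.cast_zero, add_zero, abs_of_nonneg (by linarith), not_le] at h3
      linarith [hx 2 b, hx 1 b', S.r_lt]
    rw [if_neg h12] at hC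
    have hN := hP.chords_eq hS (N := {A} ∪ {B} ∪ {C}) (by
      intro p
      simp only [Finset.mem_union, Finset.mem_singleton]
      constructor
      · rintro ((rfl | rfl) | rfl)
        · exact ⟨(0, E 0), (1, !E 1), by simp [TriangleRel], h01 _ _, hA⟩
        · exact ⟨(0, !E 0), (2, !E 2), by simp [TriangleRel], h02 _ _, hB⟩
        · exact ⟨(2, E 2), (1, E 1), by simp [TriangleRel], h12' _ _, hC⟩
      · rintro ⟨a, a', h, h', rfl⟩
        rcases h with ⟨rfl, rfl⟩ | ⟨rfl, rfl⟩ | ⟨rfl, rfl⟩ | ⟨rfl, rfl⟩ | ⟨rfl, rfl⟩ | ⟨rfl, rfl⟩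
        · exact Or.inl (Or.inl hA.symm)
        · exact absurd h' (h01 _ _).not_gt
        · exact Or.inl (Or.inr hB.symm)
        · exact absurd h' (h02 _ _).not_gt
        · exact absurd h' (h12' _ _).not_gt
        · exact Or.inr hC.symm)
    refine ⟨hN.1, hN.2, ?_, ?_, ?_, fun f => ?_⟩
    · rw [hA, hB]
      exact fun h => hne 0 (Prod.ext_iff.1 h).1
    · rw [hA, hC]
      exact fun h => hne2 _ _ (Prod.ext_iff.1 h).1
    · rw [hB, hC]
      exact fun h => hne2 _ _ (Prod.ext_iff.1 h).1
    · simp only [crossSum_singleton_singleton, Interlaced, if_neg h12]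
      subst hA hB hC
      have k0 := hlt 0
      have k1 := hlt 1
      have k2 := hlt 2
      simp only [h01, h02, h12', (h02 _ _).not_gt, (h12' _ _).not_gt]
      cases h0 : E 0 <;> cases h1 : E 1 <;> cases h2 : E 2 <;>
        simp [k0, k1, k2, k0.not_gt, k1.not_gt, k2.not_gt, mul_comm]

/-- A weak RIII changes the cross sum of the constant `1` and that of the signs by the same sign. -/
theorem exists_crossSum_triangle {P' : SphericalCurve} {x' : Fin 3 → Bool → ℝ} (hS : S.Normalized)
    (hE : ¬ (E 0 = E 1 ∧ E 2 = !E 0)) (hP : Picture P S x (TriangleRel E))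
    (hP' : Picture P' S x' (TriangleRel fun i => !E i)) (hout : SameOutside P P' S) {J : ℤ}
    (hJ : J = 1 ∨ J = -1)
    {e : Fin 3 → ℤ} (he : ∀ i, e i = if E i then 1 else -1)
    (hA : P.sgn (x 0 (E 0)) (x 1 (!E 1)) = -J * e 0 * e 1)
    (hB : P.sgn (x 0 (!E 0)) (x 2 (!E 2)) = -J * e 0 * e 2)
    (hC : P.sgn (x 1 (E 1)) (x 2 (E 2)) = J * e 1 * e 2)
    (hA' : P'.sgn (x' 0 (!E 0)) (x' 1 (E 1)) = -J * e 0 * e 1)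
    (hB' : P'.sgn (x' 0 (E 0)) (x' 2 (E 2)) = -J * e 0 * e 2)
    (hC' : P'.sgn (x' 1 (!E 1)) (x' 2 (!E 2)) = J * e 1 * e 2) :
    P'.numDouble = P.numDouble ∧ ∃ δ : ℤ, (δ = 1 ∨ δ = -1) ∧
      crossSum (P'.chords (S.c 0 - S.r)) (P'.chords (S.c 0 - S.r)) (fun _ => 1) =
        crossSum (P.chords (S.c 0 - S.r)) (P.chords (S.c 0 - S.r)) (fun _ => 1) + δ ∧
      crossSum (P'.chords (S.c 0 - S.r)) (P'.chords (S.c 0 - S.r)) P'.chordSgn =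
        crossSum (P.chords (S.c 0 - S.r)) (P.chords (S.c 0 - S.r)) P.chordSgn + δ := by
  classical
  obtain ⟨h1, h2, h3, h4, h5, h6⟩ := hP.triangle_chords hS rfl rfl rfl
  obtain ⟨h1', h2', h3', h4', h5', h6'⟩ := hP'.triangle_chords hS rfl rfl rfl
  rw [hout.outerChords_eq] at h1' h2'
  set O := outerChords P S
  have hO : ∀ d ∈ O, S.Outside d.1 ∧ S.Outside d.2 := fun d hd => outside_of_mem_outerChords hd
  have hx := hP.abs_mark_lt
  have hx' := hP'.abs_mark_lt
  constructor
  · rw [SphericalCurve.numDouble_eq_card_chords hP.isBase,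
      SphericalCurve.numDouble_eq_card_chords hP'.isBase, h1, h1', Finset.card_union_of_disjoint h2,
      Finset.card_union_of_disjoint h2']
    congr 1
    have h7 : ∀ {A B C : ℝ × ℝ}, A ≠ B → A ≠ C → B ≠ C → ({A} ∪ {B} ∪ {C} : Finset _).card = 3 :=
      fun {A B C} h h' h'' => Finset.card_eq_three.2 ⟨A, B, C, h, h', h'', by ext; simp⟩
    rw [h7 h3 h4 h5, h7 h3' h4' h5']
  have hCC' : ∀ f f' : ℝ × ℝ → ℤ, (∀ d ∈ O, f' d = f d) →
      (if S.c 1 < S.c 2 then f' (x' 1 (!E 1), x' 2 (!E 2)) = f (x 1 (E 1), x 2 (E 2))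
        else f' (x' 2 (!E 2), x' 1 (!E 1)) = f (x 2 (E 2), x 1 (E 1))) →
      let C := if S.c 1 < S.c 2 then (x 1 (E 1), x 2 (E 2)) else (x 2 (E 2), x 1 (E 1))
      let C' := if S.c 1 < S.c 2 then (x' 1 (!E 1), x' 2 (!E 2)) else (x' 2 (!E 2), x' 1 (!E 1))
      f' C' = f C ∧
      crossSum O {C'} f' + crossSum {C'} O f' = crossSum O {C} f + crossSum {C} O f := by
    intro f f' hf h
    by_cases h12 : S.c 1 < S.c 2
    · simp only [if_pos h12] at h ⊢
      exact ⟨h, crossSum_singleton_congr hO hf h (hx' _ _) (hx _ _) (hx' _ _) (hx _ _)⟩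
    · simp only [if_neg h12] at h ⊢
      exact ⟨h, crossSum_singleton_congr hO hf h (hx' _ _) (hx _ _) (hx' _ _) (hx _ _)⟩
  -- The interactions of the three chords with the outer ones cancel. Among the three chords, each
  -- strand turns one pair from interlaced to not interlaced or conversely, with a sign depending on
  -- the direction of the strand and on the order of strands 1 and 2.
  have key : ∀ f f' : ℝ × ℝ → ℤ, (∀ d ∈ O, f' d = f d) →
      f' (x' 0 (!E 0), x' 1 (!!E 1)) = f (x 0 (E 0), x 1 (!E 1)) →
      f' (x' 0 (!!E 0), x' 2 (!!E 2)) = f (x 0 (!E 0), x 2 (!E 2)) →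
      (if S.c 1 < S.c 2 then f' (x' 1 (!E 1), x' 2 (!E 2)) = f (x 1 (E 1), x 2 (E 2))
        else f' (x' 2 (!E 2), x' 1 (!E 1)) = f (x 2 (E 2), x 1 (E 1))) →
      crossSum (P'.chords (S.c 0 - S.r)) (P'.chords (S.c 0 - S.r)) f' =
        crossSum (P.chords (S.c 0 - S.r)) (P.chords (S.c 0 - S.r)) f +
        (if S.c 1 < S.c 2 then 1 else -1) *
        (e 0 * (f (x 0 (E 0), x 1 (!E 1)) * f (x 0 (!E 0), x 2 (!E 2))) +
          e 1 * (f (x 0 (E 0), x 1 (!E 1)) *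
            if S.c 1 < S.c 2 then f (x 1 (E 1), x 2 (E 2)) else f (x 2 (E 2), x 1 (E 1))) -
          e 2 * (f (x 0 (!E 0), x 2 (!E 2)) *
            if S.c 1 < S.c 2 then f (x 1 (E 1), x 2 (E 2)) else f (x 2 (E 2), x 1 (E 1)))) := by
    intro f f' hf hfA hfB hfC
    obtain ⟨hfC1, hfC2⟩ := hCC' f f' hf hfC
    rw [h1, h1', crossSum_union_triple h3 h4 h5 h2, crossSum_union_triple h3' h4' h5' h2', h6, h6',
      crossSum_singleton_congr hO hf hfA (hx' _ _) (hx _ _) (hx' _ _) (hx _ _),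
      crossSum_singleton_congr hO hf hfB (hx' _ _) (hx _ _) (hx' _ _) (hx _ _), hfC2, hfC1, hfA, hfB,
      crossSum_congr hf hf, he, he, he]
    by_cases h12 : S.c 1 < S.c 2
    · simp only [if_pos h12]
      cases E 0 <;> cases E 1 <;> cases E 2 <;> simp <;> ring
    · simp only [if_neg h12]
      cases E 0 <;> cases E 1 <;> cases E 2 <;> simp <;> ring
  -- With weights 1 the change is, up to the order factor, `e 0 + e 1 - e 2`; three signs that are
  -- not all equal have a sum equal to minus their product, here applied to `e 0`, `e 1`, `-e 2`.
  refine ⟨(if S.c 1 < S.c 2 then 1 else -1) * (e 0 * e 1 * e 2), ?_, ?_, ?_⟩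
  · rw [he, he, he]
    by_cases h12 : S.c 1 < S.c 2 <;> simp only [h12, if_true, if_false] <;>
      cases E 0 <;> cases E 1 <;> cases E 2 <;> simp
  · rw [key (fun _ => 1) (fun _ => 1) (fun _ _ => rfl) rfl rfl (by simp)]
    rw [he, he, he]
    congr 1
    congr 1
    simp only [ite_self, mul_one]
    revert hE
    cases E 0 <;> cases E 1 <;> cases E 2 <;> simp
  · have d := hP.isDoublePair_of_rel (a := (1, E 1)) (b := (2, E 2)) (by simp [TriangleRel])
    have d' := hP'.isDoublePair_of_rel (a := (1, !E 1)) (b := (2, !E 2)) (by simp [TriangleRel])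
    rw [key P.chordSgn P'.chordSgn (fun d hd => hout.chordSgn_eq hd) ?_ ?_ ?_]
    · congr 1
      congr 1
      -- After inserting the signs, every one of the three terms is `e 0 * e 1 * e 2` up to sign:
      -- two of them positive and one negative, whichever of strands 1 and 2 comes first.
      simp only [SphericalCurve.chordSgn, hA, hB, d.sgn_swap, hC]
      rw [he, he, he]
      by_cases h12 : S.c 1 < S.c 2 <;> simp only [h12, if_true, if_false] <;>
      rcases hJ with rfl | rfl <;> revert hE <;>
      cases E 0 <;> cases E 1 <;> cases E 2 <;> simp
    · simp only [SphericalCurve.chordSgn, Bool.not_not, hA, hA']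
    · simp only [SphericalCurve.chordSgn, Bool.not_not, hB, hB']
    · simp only [SphericalCurve.chordSgn, d.sgn_swap, d'.sgn_swap, hC, hC', ite_self]

/-- The plain cross sum is `x` and the signed one enters `mu` with factor -2, so a common change by
`δ` gives both assertions; the connection of the ends in the disk is the same, so `s` is unchanged.
-/
theorem change_of_triangle {P' : SphericalCurve} {x' : Fin 3 → Bool → ℝ} (hS : S.Normalized)
    (hE : ¬ (E 0 = E 1 ∧ E 2 = !E 0)) (hP : Picture P S x (TriangleRel E))
    (hP' : Picture P' S x' (TriangleRel fun i => !E i)) (hout : SameOutside P P' S) {J : ℤ}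
    (hJ : J = 1 ∨ J = -1)
    {e : Fin 3 → ℤ} (he : ∀ i, e i = if E i then 1 else -1)
    (hA : P.sgn (x 0 (E 0)) (x 1 (!E 1)) = -J * e 0 * e 1)
    (hB : P.sgn (x 0 (!E 0)) (x 2 (!E 2)) = -J * e 0 * e 2)
    (hC : P.sgn (x 1 (E 1)) (x 2 (E 2)) = J * e 1 * e 2)
    (hA' : P'.sgn (x' 0 (!E 0)) (x' 1 (E 1)) = -J * e 0 * e 1)
    (hB' : P'.sgn (x' 0 (E 0)) (x' 2 (E 2)) = -J * e 0 * e 2)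
    (hC' : P'.sgn (x' 1 (!E 1)) (x' 2 (!E 2)) = J * e 1 * e 2) :
    ((P.xTotal (S.c 0 - S.r) < P'.xTotal (S.c 0 - S.r) ∧
        P'.mu (S.c 0 - S.r) = P.mu (S.c 0 - S.r) - 2) ∨
      (P'.xTotal (S.c 0 - S.r) < P.xTotal (S.c 0 - S.r) ∧
        P.mu (S.c 0 - S.r) = P'.mu (S.c 0 - S.r) - 2)) ∧
    P'.kappa = P.kappa := by
  obtain ⟨hc, δ, hδ, h1, h2⟩ :=
    exists_crossSum_triangle hS hE hP hP' hout hJ he hA hB hC hA' hB' hC'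
  have hE' : ¬ ((!E 0) = (!E 1) ∧ (!E 2) = !!E 0) := by
    revert hE
    cases E 0 <;> cases E 1 <;> cases E 2 <;> simp
  have hs : P'.numSeifert = P.numSeifert := by
    refine numSeifert_eq_of_resolves hP hP' hout (fun α I O => ⟨?_, ?_⟩)
      (fun α I O M M' h h' => h.triangleRel_unique hE h')
      (fun α I O M M' h h' => h.triangleRel_unique hE' h')
    · rintro ⟨M, hM⟩
      exact hM.triangleRel_not hE
    · rintro ⟨M, hM⟩
      simpa using hM.triangleRel_not hE'
  rw [← SphericalCurve.xTotal_eq, ← SphericalCurve.xTotal_eq] at h1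
  rw [SphericalCurve.mu_eq, SphericalCurve.mu_eq, SphericalCurve.kappa, SphericalCurve.kappa, hs, hc,
    h2]
  refine ⟨?_, rfl⟩
  rcases hδ with rfl | rfl
  · exact Or.inl ⟨by omega, by ring⟩
  · exact Or.inr ⟨by omega, by ring⟩

end Triangle

/-! ### Charts of the sphere: orientation and regularity of strands. -/

namespace SphereChart

variable (Φ : SphereChart)

theorem hasStrictFDerivAt (x : ℝ × ℝ) : HasStrictFDerivAt Φ.toFun (fderiv ℝ Φ.toFun x) x :=
  Φ.smooth.contDiffAt.hasStrictFDerivAt (by simp)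

theorem continuous : Continuous Φ.toFun := Φ.smooth.continuous

theorem inner_fderiv (x v : ℝ × ℝ) : inner ℝ (Φ.toFun x) (fderiv ℝ Φ.toFun x v) = (0 : ℝ) := by
  have h1 := (Φ.hasStrictFDerivAt x).hasFDerivAt.inner ℝ (Φ.hasStrictFDerivAt x).hasFDerivAt
  have h2 : (fun y => inner ℝ (Φ.toFun y) (Φ.toFun y)) = fun _ => (1 : ℝ) := by
    ext y
    rw [real_inner_self_eq_norm_sq, Φ.norm_eq_one, one_pow]
  rw [h2] at h1
  have h3 := congrArg (fun L => L v) (h1.unique (hasFDerivAt_const _ _))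
  simp [fderivInnerCLM_apply, real_inner_comm] at h3
  linarith [real_inner_comm (Φ.toFun x) (fderiv ℝ Φ.toFun x v)]

/-- The Jacobian of the chart. -/
noncomputable def jac (x : ℝ × ℝ) : ℝ :=
  tripleDet (Φ.toFun x) (fderiv ℝ Φ.toFun x (1, 0)) (fderiv ℝ Φ.toFun x (0, 1))

theorem tripleDet_fderiv (x v w : ℝ × ℝ) :
    tripleDet (Φ.toFun x) (fderiv ℝ Φ.toFun x v) (fderiv ℝ Φ.toFun x w) =
      Φ.jac x * (v.1 * w.2 - v.2 * w.1) := by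
  have h : ∀ v : ℝ × ℝ, fderiv ℝ Φ.toFun x v =
      v.1 • fderiv ℝ Φ.toFun x (1, 0) + v.2 • fderiv ℝ Φ.toFun x (0, 1) := by
    intro v
    rw [← map_smul, ← map_smul, ← map_add]
    simp
  rw [h v, h w, jac]
  simp only [tripleDet_eq, PiLp.add_apply, PiLp.smul_apply, smul_eq_mul]
  ring

theorem jac_ne_zero (x : ℝ × ℝ) : Φ.jac x ≠ 0 := by
  refine tripleDet_ne_zero ?_ (Φ.inner_fderiv _ _) (Φ.inner_fderiv _ _) ?_
  · intro h
    simpa [h] using Φ.norm_eq_one x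
  · rw [LinearIndependent.pair_iff]
    intro s t h
    rw [← map_smul, ← map_smul, ← map_add, ← map_zero (fderiv ℝ Φ.toFun x)] at h
    simpa using Φ.immersion x h

theorem continuous_jac : Continuous Φ.jac := by
  have h1 : Continuous fun x => fderiv ℝ Φ.toFun x := Φ.smooth.continuous_fderiv (by simp)
  have h2 := fun v : ℝ × ℝ => h1.clm_apply (continuous_const (y := v))
  have h3 := Φ.continuous
  unfold jac
  simp only [tripleDet_eq]
  have h4 := h2 (1, 0)
  have h5 := h2 (0, 1)
  fun_prop

/-- The orientation of a chart. -/
theorem exists_orientation : ∃ J : ℤ, (J = 1 ∨ J = -1) ∧ ∀ x, 0 < (J : ℝ) * Φ.jac x := by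
  have h1 : ∀ x, 0 < Φ.jac x * Φ.jac 0 := by
    intro x
    by_contra h
    have h2 : Continuous fun y => Φ.jac y * Φ.jac 0 := Φ.continuous_jac.mul continuous_const
    obtain ⟨y, hy⟩ := mem_range_of_exists_le_of_exists_ge h2 ⟨x, not_lt.1 h⟩
      ⟨0, mul_self_nonneg _⟩
    exact mul_ne_zero (Φ.jac_ne_zero y) (Φ.jac_ne_zero 0) hy
  rcases (Φ.jac_ne_zero 0).lt_or_gt with h0 | h0
  · exact ⟨-1, Or.inr rfl, fun x => by push_cast; nlinarith [h1 x]⟩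
  · exact ⟨1, Or.inl rfl, fun x => by push_cast; nlinarith [h1 x]⟩

variable {Φ}

/-- The strands of a move are given as bare functions. Their continuity is recovered from that of
the curve, since a chart restricted to a compact set is a closed embedding. -/
theorem continuousOn_of_comp {β : ℝ → ℝ × ℝ} {s : Set ℝ} {K : Set (ℝ × ℝ)} (hK : IsCompact K)
    (hβ : ∀ u ∈ s, β u ∈ K) (h : ContinuousOn (fun u => Φ.toFun (β u)) s) : ContinuousOn β s := by
  have := isCompact_iff_compactSpace.1 hK
  have h1 : IsClosedEmbedding fun x : K => Φ.toFun x :=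
    (Φ.continuous.comp continuous_subtype_val).isClosedEmbedding
      (Φ.injective.comp Subtype.val_injective)
  rw [continuousOn_iff_continuous_domRestrict] at h ⊢
  have h2 : Continuous fun u : s => (⟨β u, hβ u u.2⟩ : K) := h1.isInducing.continuous_iff.2 h
  exact continuous_subtype_val.comp h2

/-- Differentiability of a strand is recovered in the same way: a linear left inverse of the
derivative turns the chart into a local diffeomorphism of the plane, whose inverse expresses the
strand through the curve. -/
theorem hasDerivAt_of_comp {β : ℝ → ℝ × ℝ} {u : ℝ} {γ : ℝ → E3} {γ' : E3} (hβ : ContinuousAt β u)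
    (h : ∀ᶠ v in 𝓝 u, γ v = Φ.toFun (β v)) (hγ : HasDerivAt γ γ' u) :
    ∃ w, HasDerivAt β w u ∧ fderiv ℝ Φ.toFun (β u) w = γ' := by
  obtain ⟨L, hL⟩ := LinearMap.exists_leftInverse_of_injective
    (fderiv ℝ Φ.toFun (β u)).toLinearMap (LinearMap.ker_eq_bot.2 (Φ.immersion (β u)))
  have hL' : ∀ v, L (fderiv ℝ Φ.toFun (β u) v) = v := fun v => LinearMap.congr_fun hL v
  set M := LinearMap.toContinuousLinearMap L
  have h1 : HasStrictFDerivAt (fun x => M (Φ.toFun x))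
      ((ContinuousLinearEquiv.refl ℝ (ℝ × ℝ) : (ℝ × ℝ) ≃L[ℝ] (ℝ × ℝ)) : (ℝ × ℝ) →L[ℝ] (ℝ × ℝ))
      (β u) := by
    have h2 := M.hasStrictFDerivAt.comp (β u) (Φ.hasStrictFDerivAt (β u))
    have h3 : M ∘L fderiv ℝ Φ.toFun (β u) =
        ((ContinuousLinearEquiv.refl ℝ (ℝ × ℝ) : (ℝ × ℝ) ≃L[ℝ] (ℝ × ℝ)) : (ℝ × ℝ) →L[ℝ] (ℝ × ℝ)) :=
      ContinuousLinearMap.ext hL'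
    rw [h3] at h2
    exact h2
  have h2 := h1.to_localInverse
  have h3 := hβ.eventually h1.eventually_left_inverse
  have h4 : (fun v => h1.localInverse _ _ _ (M (γ v))) =ᶠ[𝓝 u] β := by
    filter_upwards [h, h3] with v h5 h6
    rw [h5, h6]
  have h5 := h.self_of_nhds
  have h6 : HasDerivAt (fun v => M (γ v)) (M γ') u := M.hasFDerivAt.comp_hasDerivAt u hγ
  rw [← h5] at h2
  have h7 := (h2.hasFDerivAt.comp_hasDerivAt u h6).congr_of_eventuallyEq h4.symm
  refine ⟨_, h7, ?_⟩
  have h8 := (Φ.hasStrictFDerivAt (β u)).hasFDerivAt.comp_hasDerivAt u h7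
  exact (h8.congr_of_eventuallyEq h).unique hγ

end SphereChart

/-- A function that is positive before its first zero decreases there. -/
theorem HasDerivAt.neg_of_first_zero {f : ℝ → ℝ} {a b d : ℝ} (hab : a < b)
    (hf : ContinuousOn f (Icc a b)) (h0 : ∀ u ∈ Ico a b, f u ≠ 0) (ha : 0 < f a) (hb : f b = 0)
    (hd : HasDerivAt f d b) (hd0 : d ≠ 0) : d < 0 := by
  by_contra h
  have h1 : 0 < d := lt_of_le_of_ne (not_lt.1 h) hd0.symm
  obtain ⟨u, h2, h3⟩ := ((hd.eventually_lt_left h1).and (Ioo_mem_nhdsLT hab)).exists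
  obtain ⟨v, hv, hv0⟩ := intermediate_value_Icc' h3.1.le
    (hf.mono (Icc_subset_Icc_right h3.2.le)) ⟨(hb ▸ h2).le, ha.le⟩
  exact h0 v ⟨hv.1, hv.2.trans_lt h3.2⟩ hv0

/-! ### From local replacements to pictures. -/

/-- The parameter on the curve of the point with parameter `u` on the strand `i`. -/
def Strands.param {k : ℕ} (S : Strands k) (ε : Fin k → ℤˣ) (i : Fin k) (u : ℝ) : ℝ :=
  S.c i + ((ε i : ℤ) : ℝ) * S.r * u

/-- The image of a chart meets the curve `P` in the strands `Φ ∘ β i`. -/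
structure OnStrands {k : ℕ} (Φ : SphereChart) (S : Strands k) (ε : Fin k → ℤˣ)
    (β : Fin k → ℝ → ℝ × ℝ) (P : SphericalCurve) : Prop where
  apply : ∀ i, ∀ u ∈ Icc (-1 : ℝ) 1, P.toFun (S.param ε i u) = Φ.toFun (β i u)
  mem : ∀ i, ∀ u ∈ Icc (-1 : ℝ) 1, β i u ∈ closedSquare
  off : ∀ t, S.Outside t → P.toFun t ∉ Φ.toFun '' closedSquare

theorem unit_cast_cases (e : ℤˣ) : ((e : ℤ) : ℝ) = 1 ∨ ((e : ℤ) : ℝ) = -1 := by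
  rcases Int.units_eq_one_or e with rfl | rfl <;> simp

theorem sameOutside_of_eq {k : ℕ} {S : Strands k} {P P' : SphericalCurve}
    (h : ∀ t, S.Outside t → P.toFun t = P'.toFun t) : SameOutside P P' S := by
  have hd : ∀ t, S.Outside t → deriv P.toFun t = deriv P'.toFun t := fun t ht =>
    Filter.EventuallyEq.deriv_eq ((Strands.Outside.eventually S ht).mono h)
  constructor
  · intro s t hs ht
    rw [SphericalCurve.IsDoublePair, SphericalCurve.IsDoublePair, h s hs, h t ht]
  · intro s t hs ht
    rw [SphericalCurve.sgn, SphericalCurve.sgn, h s hs, hd s hs, hd t ht]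

/-- Disjoint arcs are disjoint from slightly longer ones. -/
theorem exists_collar {k : ℕ} {c : Fin k → ℝ} {r : ℝ}
    (h : ∀ (i j : Fin k) (n : ℤ), |c i - (c j + n)| ≤ 2 * r → i = j ∧ n = 0)
    (hc : ∀ i j, |c i - c j| < 1) (h1 : 2 * r < 1) :
    ∃ R, r < R ∧ ∀ (i j : Fin k) (n : ℤ), |c i - (c j + n)| ≤ 2 * R → i = j ∧ n = 0 := by
  -- The centres differ by less than 1, so only the translates by -1, 0 and 1 can come near; this
  -- leaves finitely many strict inequalities to keep.
  have h2 : ∀ᶠ R in 𝓝[>] r, 2 * R < 1 ∧ ∀ i j : Fin k, ∀ n ∈ Finset.Icc (-1 : ℤ) 1,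
      |c i - (c j + n)| ≤ 2 * R → i = j ∧ n = 0 := by
    have hcont : Tendsto (fun R : ℝ => 2 * R) (𝓝[>] r) (𝓝 (2 * r)) :=
      ((continuous_const.mul continuous_id).tendsto r).mono_left nhdsWithin_le_nhds
    refine (hcont.eventually_lt_const h1).and ?_
    refine eventually_all.2 fun i => eventually_all.2 fun j =>
      (Filter.eventually_all_finset _).2 fun n _ => ?_
    by_cases h3 : |c i - (c j + n)| ≤ 2 * r
    · exact Eventually.of_forall fun R _ => h i j n h3
    · filter_upwards [hcont.eventually_lt_const (not_le.1 h3)] with R h4 h5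
      exact absurd h4 h5.not_gt
  obtain ⟨R, ⟨h3, h4⟩, h5⟩ := (h2.and self_mem_nhdsWithin).exists
  refine ⟨R, h5, fun i j n h6 => h4 i j n ?_ h6⟩
  have h7 := abs_lt.1 (hc i j)
  have h8 := abs_le.1 h6
  have h9 : (n : ℝ) < 2 := by linarith
  have h10 : (-2 : ℝ) < n := by linarith
  have h11 : n < 2 := by exact_mod_cast h9
  have h12 : -2 < n := by exact_mod_cast h10
  rw [Finset.mem_Icc]
  omega

/-- The centres are shifted by integers into the period that starts at the first one, and collars
are added. The second square condition may use that the new strands have the same ends as the old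
ones, which follows from the replacement itself. -/
theorem IsLocalReplacement.exists_strands {k : ℕ} {Φ : SphereChart}
    {β β' : Fin (k + 1) → ℝ → ℝ × ℝ} {ε : Fin (k + 1) → ℤˣ} {P P' : SphericalCurve}
    (h : IsLocalReplacement Φ β β' ε P P')
    (hβ : ∀ i, ∀ u ∈ Icc (-1 : ℝ) 1, β i u ∈ closedSquare)
    (hβ' : (∀ i, β' i (-1) = β i (-1) ∧ β' i 1 = β i 1) →
      ∀ i, ∀ u ∈ Icc (-1 : ℝ) 1, β' i u ∈ closedSquare) :
    ∃ S : Strands (k + 1), S.Normalized ∧ OnStrands Φ S ε β P ∧ OnStrands Φ S ε β' P' ∧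
      SameOutside P P' S ∧ ∀ i, β' i (-1) = β i (-1) ∧ β' i 1 = β i 1 := by
  obtain ⟨c, r, hr, hdisj, happ, hout, hoff⟩ := h
  have hr1 : 2 * r < 1 := by
    by_contra h1
    have := hdisj 0 0 1 (by
      rw [Int.cast_one, sub_add_cancel_left, abs_neg, abs_one]
      linarith)
    exact one_ne_zero this.2
  choose c' hc' m hm using fun i => SphericalCurve.exists_sameParam_mem_Ico (c 0) (c i)
  have hdisj' : ∀ (i j : Fin (k + 1)) (n : ℤ), |c' i - (c' j + n)| ≤ 2 * r → i = j ∧ n = 0 := by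
    intro i j n h1
    have h2 := hdisj i j (n + m j - m i) (by
      rw [hm, hm] at h1
      convert h1 using 2
      push_cast
      ring)
    obtain ⟨rfl, h2⟩ := h2
    exact ⟨rfl, by omega⟩
  have hlt : ∀ i j, |c' i - c' j| < 1 := fun i j => by
    rw [abs_lt]
    constructor <;> linarith [(hc' i).1, (hc' i).2, (hc' j).1, (hc' j).2]
  obtain ⟨R, hR, hdisjR⟩ := exists_collar hdisj' hlt hr1
  let S : Strands (k + 1) := ⟨c', r, R, hr, hR, hdisjR⟩
  have hc0 : c' 0 = c 0 := by
    refine (SameParam.eq_of_abs_sub_lt ⟨m 0, hm 0⟩ ?_).symm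
    rw [abs_lt]
    constructor <;> linarith [(hc' 0).1, (hc' 0).2]
  have hS : S.Normalized := by
    intro i hi
    have h1 := mt (hdisj' i 0 0) (fun h => hi h.1)
    have h2 := mt (hdisj' i 0 1) (fun h => hi h.1)
    rw [Int.cast_zero, add_zero, hc0, abs_of_nonneg (by linarith [(hc' i).1]), not_le] at h1
    rw [Int.cast_one, hc0, abs_of_neg (by linarith [(hc' i).2]), not_le] at h2
    change c' 0 + r < c' i - r ∧ c' i + r < c' 0 - r + 1
    rw [hc0]
    constructor <;> linarith
  have hoc : ∀ t (i : Fin (k + 1)) (n : ℤ), t - (c i + n) = t - (c' i + ((n - m i : ℤ) : ℝ)) := by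
    intro t i n
    rw [hm]
    push_cast
    ring
  have hpar : ∀ (Q : SphericalCurve) i u,
      Q.toFun (S.param ε i u) = Q.toFun (c i + ((ε i : ℤ) : ℝ) * r * u) := by
    intro Q i u
    have h1 : S.param ε i u = c i + ((ε i : ℤ) : ℝ) * r * u + m i := by
      change c' i + _ = _
      rw [hm]
      ring
    rw [h1, SphericalCurve.apply_add_int]
  have heq : ∀ t, (∀ (i : Fin (k + 1)) (n : ℤ), r ≤ |t - (c' i + n)|) → P.toFun t = P'.toFun t :=
    fun t ht => hout t fun i n => by
      rw [hoc]
      exact ht _ _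
  have heq' : ∀ t, S.Outside t → P.toFun t = P'.toFun t := fun t ht => heq t fun i n => (ht i n).le
  have hoffP : ∀ t, S.Outside t → P.toFun t ∉ Φ.toFun '' closedSquare := fun t ht =>
    hoff t fun i n => by
      rw [hoc]
      exact ht _ _
  -- An end of a strand has distance at least `r` from all translated centres, so the two curves
  -- agree there, and the chart is injective.
  have hend : ∀ i u, |u| = 1 → β' i u = β i u := by
    intro i u hu
    have hu' : u ∈ Icc (-1 : ℝ) 1 := abs_le.1 hu.le
    have h1 := happ i u hu'
    rw [← hpar, ← hpar] at h1
    apply Φ.injective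
    rw [← h1.1, ← h1.2]
    refine (heq _ fun j n => ?_).symm
    have h2 : |S.param ε i u - c' i| = r := by
      rw [Strands.param]
      change |c' i + ((ε i : ℤ) : ℝ) * r * u - c' i| = r
      rw [add_sub_cancel_left, abs_mul, hu, mul_one, abs_mul, abs_of_pos hr]
      rcases unit_cast_cases (ε i) with h3 | h3 <;> rw [h3] <;> simp
    by_contra h3
    rw [not_le] at h3
    have h4 := hdisj' i j n (by
      have := abs_sub_le (c' i) (S.param ε i u) (c' j + n)
      rw [abs_sub_comm (c' i) (S.param ε i u), h2] at this
      linarith)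
    obtain ⟨rfl, rfl⟩ := h4
    rw [Int.cast_zero, add_zero, h2] at h3
    exact lt_irrefl _ h3
  have hend' : ∀ i, β' i (-1) = β i (-1) ∧ β' i 1 = β i 1 := fun i =>
    ⟨hend i (-1) (by simp), hend i 1 (by simp)⟩
  exact ⟨S, hS, ⟨fun i u hu => (hpar P i u).trans (happ i u hu).1, hβ, hoffP⟩,
    ⟨fun i u hu => (hpar P' i u).trans (happ i u hu).2, hβ' hend',
      fun t ht => heq' t ht ▸ hoffP t ht⟩, sameOutside_of_eq heq', hend'⟩

namespace OnStrands

variable {k : ℕ} {Φ : SphereChart} {S : Strands k} {ε : Fin k → ℤˣ} {β : Fin k → ℝ → ℝ × ℝ}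
  {P : SphericalCurve}

theorem _root_.Strands.abs_param_sub (S : Strands k) (ε : Fin k → ℤˣ) (i : Fin k) (u : ℝ) :
    |S.param ε i u - S.c i| = S.r * |u| := by
  rw [Strands.param, add_sub_cancel_left, abs_mul, abs_mul, abs_of_pos S.r_pos]
  rcases unit_cast_cases (ε i) with h | h <;> rw [h] <;> simp

theorem _root_.Strands.exists_param_of_not_outside (S : Strands k) (ε : Fin k → ℤˣ) {t : ℝ}
    (ht : ¬ S.Outside t) : ∃ i, ∃ u ∈ Icc (-1 : ℝ) 1, SameParam (S.param ε i u) t := by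
  obtain ⟨i, n, h⟩ := S.not_outside_iff.1 ht
  have hr := S.r_pos
  refine ⟨i, ((ε i : ℤ) : ℝ) * (t - (S.c i + n)) / S.r, abs_le.1 ?_, n, ?_⟩
  · rw [abs_div, abs_mul, abs_of_pos hr, div_le_one hr]
    rcases unit_cast_cases (ε i) with h1 | h1 <;> rw [h1] <;> simpa using h
  · rw [Strands.param]
    rcases unit_cast_cases (ε i) with h1 | h1 <;> rw [h1] <;> field_simp <;> ring

theorem _root_.Strands.sameParam_param_iff (S : Strands k) (ε : Fin k → ℤˣ) {i j : Fin k} {u v : ℝ}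
    (hu : u ∈ Icc (-1 : ℝ) 1) (hv : v ∈ Icc (-1 : ℝ) 1) :
    SameParam (S.param ε i u) (S.param ε j v) ↔ i = j ∧ u = v := by
  have hr := S.r_pos
  constructor
  · rintro ⟨n, hn⟩
    have h1 := S.abs_param_sub ε i u
    have h2 := S.abs_param_sub ε j v
    have h3 : S.r * |u| ≤ S.r := mul_le_of_le_one_right hr.le (abs_le.2 hu)
    have h4 : S.r * |v| ≤ S.r := mul_le_of_le_one_right hr.le (abs_le.2 hv)
    have h5 := S.eq_of_abs_sub_le (i := i) (j := j) (n := 0) (m := -n) (t := S.param ε i u)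
      (by rw [Int.cast_zero, add_zero, h1]; linarith [S.r_lt]) (by
        have h6 : S.param ε i u - (S.c j + ((-n : ℤ) : ℝ)) = S.param ε j v - S.c j := by
          rw [hn]
          push_cast
          ring
        rw [h6, h2]
        linarith [S.r_lt])
    obtain ⟨rfl, h5⟩ := h5
    obtain rfl : n = 0 := by omega
    refine ⟨rfl, ?_⟩
    rw [Int.cast_zero, add_zero, Strands.param, Strands.param, add_right_inj] at hn
    refine (mul_left_cancel₀ ?_ hn).symm
    rcases unit_cast_cases (ε i) with h1 | h1 <;> rw [h1] <;> simp [hr.ne']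
  · rintro ⟨rfl, rfl⟩
    exact SameParam.refl _

theorem isDoublePair_param_iff (h : OnStrands Φ S ε β P) {i j : Fin k} {u v : ℝ}
    (hu : u ∈ Icc (-1 : ℝ) 1) (hv : v ∈ Icc (-1 : ℝ) 1) :
    P.IsDoublePair (S.param ε i u) (S.param ε j v) ↔ β i u = β j v ∧ ¬ (i = j ∧ u = v) := by
  rw [SphericalCurve.IsDoublePair, S.sameParam_param_iff ε hu hv, h.apply i u hu, h.apply j v hv,
    Φ.injective.eq_iff]

/-- The marks on the curve that belong to marks on the strands. -/
def _root_.markParam (S : Strands k) (ε : Fin k → ℤˣ) (y : Fin k → Bool → ℝ) (i : Fin k) (b : Bool) :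
    ℝ := S.param ε i (y i (b == decide (ε i = 1)))

/-- Labels of marks are turned from the order of the strand parameter to the order along the curve:
comparison with `decide (ε i = 1)` exchanges the two labels on a strand run backwards. -/
theorem picture (h : OnStrands Φ S ε β P) {y : Fin k → Bool → ℝ}
    {rel : Fin k × Bool → Fin k × Bool → Prop} (hy0 : ∀ i, -1 < y i false)
    (hy : ∀ i, y i false < y i true) (hy1 : ∀ i, y i true < 1)
    (hrel : ∀ i j, ∀ u ∈ Icc (-1 : ℝ) 1, ∀ v ∈ Icc (-1 : ℝ) 1,
      (β i u = β j v ∧ ¬ (i = j ∧ u = v) ↔ ∃ b b', rel (i, b) (j, b') ∧ y i b = u ∧ y j b' = v)) :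
    Picture P S (markParam S ε y) fun a a' =>
      rel (a.1, a.2 == decide (ε a.1 = 1)) (a'.1, a'.2 == decide (ε a'.1 = 1)) := by
  have hr := S.r_pos
  have hyI : ∀ i b, y i b ∈ Icc (-1 : ℝ) 1 := by
    intro i b
    have := hy0 i
    have := hy i
    have := hy1 i
    cases b <;> constructor <;> linarith
  refine ⟨fun i => ?_, fun i => ?_, fun i => ?_, fun s t hs ht hd => ?_, fun s t hs ht => ?_⟩
  · rw [markParam, Strands.param]
    rcases Int.units_eq_one_or (ε i) with h1 | h1 <;> simp [h1] <;> nlinarith [hy0 i, hy1 i, hy i]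
  · rw [markParam, markParam, Strands.param, Strands.param]
    rcases Int.units_eq_one_or (ε i) with h1 | h1 <;> simp [h1] <;> nlinarith [hy0 i, hy1 i, hy i]
  · rw [markParam, Strands.param]
    rcases Int.units_eq_one_or (ε i) with h1 | h1 <;> simp [h1] <;> nlinarith [hy0 i, hy1 i, hy i]
  · obtain ⟨i, u, hu, hut⟩ := S.exists_param_of_not_outside ε ht
    refine h.off s hs ⟨β i u, h.mem i u hu, ?_⟩
    rw [← h.apply i u hu, P.apply_eq_of_sameParam hut, hd.1]
  · obtain ⟨i, u, hu, hus⟩ := S.exists_param_of_not_outside ε hs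
    obtain ⟨j, v, hv, hvt⟩ := S.exists_param_of_not_outside ε ht
    rw [← SphericalCurve.isDoublePair_iff_of_sameParam hus hvt, h.isDoublePair_param_iff hu hv,
      hrel i j u hu v hv]
    constructor
    · rintro ⟨b, b', h1, rfl, rfl⟩
      refine ⟨(i, b == decide (ε i = 1)), (j, b' == decide (ε j = 1)), ?_, ?_, ?_⟩
      · simpa using h1
      · simpa [markParam] using hus
      · simpa [markParam] using hvt
    · rintro ⟨⟨i', b⟩, ⟨j', b'⟩, h1, h2, h3⟩
      have h4 := (S.sameParam_param_iff ε (hyI _ _) hu).1 (h2.trans hus.symm)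
      have h5 := (S.sameParam_param_iff ε (hyI _ _) hv).1 (h3.trans hvt.symm)
      simp only at h4 h5
      obtain ⟨rfl, h4⟩ := h4
      obtain ⟨rfl, h5⟩ := h5
      exact ⟨_, _, h1, h4, h5⟩

theorem continuousOn (h : OnStrands Φ S ε β P) (i : Fin k) : ContinuousOn (β i) (Icc (-1) 1) := by
  refine SphereChart.continuousOn_of_comp (Φ := Φ) (K := closedSquare)
    (isCompact_Icc.prod isCompact_Icc) (h.mem i) ?_
  refine ContinuousOn.congr (f := fun u => P.toFun (S.param ε i u)) ?_ fun u hu => (h.apply i u hu).symm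
  have := P.continuous
  unfold Strands.param
  fun_prop

theorem exists_hasDerivAt (h : OnStrands Φ S ε β P) (i : Fin k) {u : ℝ} (hu : u ∈ Ioo (-1 : ℝ) 1) :
    ∃ w, HasDerivAt (β i) w u ∧ fderiv ℝ Φ.toFun (β i u) w =
      (((ε i : ℤ) : ℝ) * S.r) • deriv P.toFun (S.param ε i u) := by
  refine SphereChart.hasDerivAt_of_comp (γ := fun u => P.toFun (S.param ε i u))
    ((h.continuousOn i).continuousAt (Icc_mem_nhds hu.1 hu.2)) ?_ ?_
  · filter_upwards [Icc_mem_nhds hu.1 hu.2] with v hv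
    exact h.apply i v hv
  · have h1 : HasDerivAt (S.param ε i) (((ε i : ℤ) : ℝ) * S.r) u := by
      unfold Strands.param
      simpa using ((hasDerivAt_id u).const_mul (((ε i : ℤ) : ℝ) * S.r)).const_add (S.c i)
    exact (P.hasDerivAt _).scomp u h1

/-- The sign of a double point on two strands. -/
theorem sgn_eq (h : OnStrands Φ S ε β P) {J : ℤ} (hJ : J = 1 ∨ J = -1)
    (hJ' : ∀ x, 0 < (J : ℝ) * Φ.jac x) {i j : Fin k} {u v : ℝ} (hu : u ∈ Ioo (-1 : ℝ) 1)
    (hv : v ∈ Ioo (-1 : ℝ) 1) (he : β i u = β j v) (hne : ¬ (i = j ∧ u = v)) {w w' : ℝ × ℝ}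
    (hw : HasDerivAt (β i) w u) (hw' : HasDerivAt (β j) w' v) :
    w.1 * w'.2 - w.2 * w'.1 ≠ 0 ∧ P.sgn (S.param ε i u) (S.param ε j v) =
      J * (ε i : ℤ) * (ε j : ℤ) * if w.1 * w'.2 - w.2 * w'.1 < 0 then -1 else 1 := by
  obtain ⟨w₁, h1, h2⟩ := h.exists_hasDerivAt i hu
  obtain rfl := hw.unique h1
  obtain ⟨w₁, h1', h2'⟩ := h.exists_hasDerivAt j hv
  obtain rfl := hw'.unique h1'
  have hd := (h.isDoublePair_param_iff (Ioo_subset_Icc_self hu) (Ioo_subset_Icc_self hv)).2 ⟨he, hne⟩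
  have h3 := Φ.tripleDet_fderiv (β i u) w w'
  rw [h2] at h3
  rw [he, h2', ← he, ← h.apply i u (Ioo_subset_Icc_self hu), tripleDet_smul_smul] at h3
  have hr := S.r_pos
  have h4 := hd.tripleDet_ne_zero
  have h5 := hJ' (β i u)
  rw [SphericalCurve.sgn]
  set D := tripleDet (P.toFun (S.param ε i u)) (deriv P.toFun (S.param ε i u))
    (deriv P.toFun (S.param ε j v))
  set d := w.1 * w'.2 - w.2 * w'.1
  have hr2 : 0 < S.r * S.r := mul_pos hr hr
  -- The determinant `D` on the sphere and the determinant `d` in the chart are related by the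
  -- strand directions, the positive factor `r * r` and the Jacobian; only signs matter.
  have key : ∀ {e e' : ℤ} {D d q j : ℝ}, 0 < q → D ≠ 0 → (e = 1 ∨ e = -1) →
      (e' = 1 ∨ e' = -1) → (J = 1 ∨ J = -1) → 0 < (J : ℝ) * j → e * e' * q * D = j * d →
      d ≠ 0 ∧ (if D < 0 then (-1 : ℤ) else 1) = J * e * e' * if d < 0 then -1 else 1 := by
    intro e e' D d q j hq hD he he' hJ hj hh
    have hd0 : d ≠ 0 := by
      rintro rfl
      rcases he with rfl | rfl <;> rcases he' with rfl | rfl <;> simp [hq.ne', hD] at hh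
    refine ⟨hd0, ?_⟩
    have hDd : 0 < (J * e * e' : ℝ) * (D * d) := by
      have h6 : 0 < d * d := mul_self_pos.2 hd0
      have h7 : q * ((J * e * e' : ℝ) * (D * d)) = (J * j) * (d * d) := by
        linear_combination (J * d) * hh
      have h8 : 0 < q * ((J * e * e' : ℝ) * (D * d)) := h7 ▸ mul_pos hj h6
      exact (pos_iff_pos_of_mul_pos h8).1 hq
    have hs : (J * e * e' = 1 ∧ 0 < D * d) ∨ (J * e * e' = -1 ∧ D * d < 0) := by
      rcases hJ with rfl | rfl <;> rcases he with rfl | rfl <;> rcases he' with rfl | rfl <;>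
        push_cast at hDd
      all_goals first
        | exact Or.inl ⟨by norm_num, by linarith⟩
        | exact Or.inr ⟨by norm_num, by linarith⟩
    rcases hs with ⟨h6, h7⟩ | ⟨h6, h7⟩ <;> rw [h6]
    · rcases pos_and_pos_or_neg_and_neg_of_mul_pos h7 with h8 | h8
      · rw [if_neg h8.1.not_gt, if_neg h8.2.not_gt, one_mul]
      · rw [if_pos h8.1, if_pos h8.2, one_mul]
    · rcases mul_neg_iff.1 h7 with h8 | h8
      · rw [if_neg h8.1.not_gt, if_pos h8.2]
        norm_num
      · rw [if_pos h8.1, if_neg h8.2.not_gt]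
        norm_num
  have hε : ∀ i, (ε i : ℤ) = 1 ∨ (ε i : ℤ) = -1 := fun i => by
    rcases Int.units_eq_one_or (ε i) with h | h <;> simp [h]
  refine key hr2 h4 (hε i) (hε j) hJ h5 ?_
  rw [← h3]
  ring

end OnStrands

theorem Picture.congr {k : ℕ} {P : SphericalCurve} {S : Strands k} {x : Fin k → Bool → ℝ}
    {rel rel' : Fin k × Bool → Fin k × Bool → Prop} (h : Picture P S x rel)
    (hr : ∀ a b, rel a b ↔ rel' a b) : Picture P S x rel' := by
  obtain rfl : rel = rel' := by
    ext a b
    exact hr a b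
  exact h

theorem mem_Ioo_of_eq_zero {f : ℝ → ℝ} {u : ℝ} (hu : u ∈ Icc (-1 : ℝ) 1) (h1 : f (-1) ≠ 0)
    (h2 : f 1 ≠ 0) (h : f u = 0) : u ∈ Ioo (-1 : ℝ) 1 := by
  refine ⟨lt_of_le_of_ne hu.1 ?_, lt_of_le_of_ne hu.2 ?_⟩
  · rintro rfl
    exact h1 h
  · rintro rfl
    exact h2 h

/-! ### The local moves. -/

theorem LocalRI.exists_base {P P' : SphericalCurve} (h : LocalRI P P') :
    ∃ b, P.IsBase b ∧ P'.IsBase b ∧ P'.mu b = P.mu b ∧ P'.kappa = P.kappa := by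
  obtain ⟨Φ, ε, β, hin, ⟨p, hp, q, hq, hpq, hβ⟩, hrep⟩ := h
  obtain ⟨S, hS, hP, hP', hout, hend⟩ := hrep.exists_strands (by
    intro i u hu
    obtain rfl : i = 0 := Fin.ext (by omega)
    exact ⟨hu, by simp⟩) (by
    intro h i u hu
    obtain rfl : i = 0 := Fin.ext (by omega)
    have h4 : β (-1) = (-1, 0) := (h 0).1
    have h5 : β 1 = (1, 0) := (h 0).2
    change β u ∈ closedSquare
    by_cases h1 : u = -1
    · rw [h1, h4]
      simp [closedSquare]
    by_cases h2 : u = 1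
    · rw [h2, h5]
      simp [closedSquare]
    have h3 := hin u ⟨lt_of_le_of_ne hu.1 (Ne.symm h1), lt_of_le_of_ne hu.2 h2⟩
    exact ⟨Ioo_subset_Icc_self h3.1, Ioo_subset_Icc_self h3.2⟩)
  have hl : β (-1) = (-1, 0) := (hend 0).1
  have hr : β 1 = (1, 0) := (hend 0).2
  have hβpq : β p = β q := (hβ p hp q hq hpq).2 ⟨rfl, rfl⟩
  -- The ends of the new strand lie on the boundary of the square and differ, while all its inner
  -- points lie in the open square; so the double point is not at an end.
  have hq1 : q < 1 := by
    refine lt_of_le_of_ne hq.2 ?_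
    rintro rfl
    rcases hp.1.eq_or_lt with rfl | h1
    · rw [hl, hr] at hβpq
      norm_num at hβpq
    · have h2 := (hin p ⟨h1, hpq⟩).1.2
      rw [hβpq, hr] at h2
      exact lt_irrefl _ h2
  have hp1 : -1 < p := by
    refine lt_of_le_of_ne hp.1 ?_
    rintro rfl
    have h2 := (hin q ⟨hpq, hq1⟩).1.1
    rw [← hβpq, hl] at h2
    exact lt_irrefl _ h2
  have pic := hP.picture (y := fun _ b => if b then q else p) (rel := fun _ _ => False)
    (fun _ => hp1) (fun _ => hpq) (fun _ => hq1) (by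
    intro i j u _ v _
    obtain rfl : i = 0 := Fin.ext (by omega)
    obtain rfl : j = 0 := Fin.ext (by omega)
    simp)
  have pic' := hP'.picture (y := fun _ b => if b then q else p) (rel := fun a b => a.2 ≠ b.2)
    (fun _ => hp1) (fun _ => hpq) (fun _ => hq1) (by
    intro i j u hu v hv
    obtain rfl : i = 0 := Fin.ext (by omega)
    obtain rfl : j = 0 := Fin.ext (by omega)
    simp only [Matrix.cons_val, true_and]
    constructor
    · rintro ⟨h1, h2⟩
      rcases lt_or_gt_of_ne h2 with h3 | h3
      · obtain ⟨rfl, rfl⟩ := (hβ u hu v hv h3).1 h1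
        exact ⟨false, true, by simp⟩
      · obtain ⟨rfl, rfl⟩ := (hβ v hv u hu h3).1 h1.symm
        exact ⟨true, false, by simp⟩
    · rintro ⟨b, b', h1, rfl, rfl⟩
      cases b <;> cases b'
      · exact absurd rfl h1
      · exact ⟨hβpq, hpq.ne⟩
      · exact ⟨hβpq.symm, hpq.ne'⟩
      · exact absurd rfl h1)
  have pic'' := pic'.congr (rel' := fun a b => a.2 ≠ b.2) (by
    rintro ⟨i, b⟩ ⟨j, b'⟩
    obtain rfl : i = j := Fin.ext (by omega)
    cases b <;> cases b' <;> simp)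
  have := mu_eq_of_kink hS pic pic'' hout
  exact ⟨_, pic.isBase, pic''.isBase, this.1, this.2⟩

theorem LocalWeakRII.exists_base {P P' : SphericalCurve} (h : LocalWeakRII P P') :
    ∃ b, P.IsBase b ∧ P'.IsBase b ∧ P'.mu b = P.mu b := by
  obtain ⟨Φ, ε, f, g, hf, hg, ⟨p, q, hpq, hz⟩, hε, hrep⟩ := h
  obtain ⟨S, hS, hP, hP', hout, hend⟩ := hrep.exists_strands (by
    intro i u hu
    have := hf u hu
    fin_cases i
    · exact ⟨hu, by simp⟩
    · exact ⟨hu, ⟨by simp; linarith, this.2.le⟩⟩) (by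
    intro _ i u hu
    have := hg u hu
    fin_cases i
    · exact ⟨hu, by simp⟩
    · exact ⟨hu, ⟨this.1.le, this.2.le⟩⟩)
  have hgl : 0 < g (-1) := by
    have h1 : g (-1) = f (-1) := congrArg Prod.snd (hend 1).1
    rw [h1]
    exact (hf (-1) (by simp)).1
  have hgr : 0 < g 1 := by
    have h1 : g 1 = f 1 := congrArg Prod.snd (hend 1).2
    rw [h1]
    exact (hf 1 (by simp)).1
  have hz' : ∀ u ∈ Icc (-1 : ℝ) 1, (g u = 0 ↔ u = p ∨ u = q) := by
    intro u hu
    have := Set.ext_iff.1 hz u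
    simp only [mem_ofPred_eq, mem_insert_iff, mem_singleton_iff] at this
    tauto
  have hpz : p ∈ {u ∈ Icc (-1 : ℝ) 1 | g u = 0} := by rw [hz]; simp
  have hqz : q ∈ {u ∈ Icc (-1 : ℝ) 1 | g u = 0} := by rw [hz]; simp
  have hp := mem_Ioo_of_eq_zero hpz.1 hgl.ne' hgr.ne' hpz.2
  have hq := mem_Ioo_of_eq_zero hqz.1 hgl.ne' hgr.ne' hqz.2
  set y : Fin 2 → Bool → ℝ := fun _ b => if b then q else p with hy
  have pic := hP.picture (y := y) (rel := fun _ _ => False)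
    (fun _ => hp.1) (fun _ => hpq) (fun _ => hq.2) (by
    intro i j u hu v hv
    have h1 := hf u hu
    have h2 := hf v hv
    fin_cases i <;> fin_cases j <;> simp
    · rintro -
      exact h2.1.ne
    · rintro -
      exact h1.1.ne'
    · exact fun h _ => h)
  have pic' := hP'.picture (y := y) (rel := fun a b => a.1 ≠ b.1 ∧ a.2 = b.2)
    (fun _ => hp.1) (fun _ => hpq) (fun _ => hq.2) (by
    intro i j u hu v hv
    have h1 := hz' u hu
    have h2 := hz' v hv
    fin_cases i <;> fin_cases j
    · simp
    · change (u, (0 : ℝ)) = (v, g v) ∧ ¬ ((0 : Fin 2) = 1 ∧ u = v) ↔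
        ∃ b b', ((0 : Fin 2) ≠ 1 ∧ b = b') ∧ y 0 b = u ∧ y 0 b' = v
      simp
      grind
    · change (u, g u) = (v, (0 : ℝ)) ∧ ¬ ((1 : Fin 2) = 0 ∧ u = v) ↔
        ∃ b b', ((1 : Fin 2) ≠ 0 ∧ b = b') ∧ y 0 b = u ∧ y 0 b' = v
      simp
      grind
    · simp
      grind)
  -- Both strands run in the same direction, so the exchange of labels on backward strands preserves
  -- the pairing. This is where weakness is used.
  have pic'' := pic'.congr (rel' := fun a b => a.1 ≠ b.1 ∧ a.2 = b.2) (by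
    rintro ⟨i, b⟩ ⟨j, b'⟩
    have h1 : ε i = ε j := by fin_cases i <;> fin_cases j <;> simp [hε]
    simp only [h1]
    cases b <;> cases b' <;> cases decide (ε j = 1) <;> simp)
  refine ⟨_, pic.isBase, pic''.isBase, mu_eq_of_bigon hS pic pic'' hout ?_⟩
  obtain ⟨J, hJ, hJ'⟩ := Φ.exists_orientation
  -- Transversality of the curve makes the zeros of `g` simple, and the sign of the crossing is
  -- governed by the slope there.
  have hsgn : ∀ u ∈ Ioo (-1 : ℝ) 1, g u = 0 → ∃ d, HasDerivAt g d u ∧ d ≠ 0 ∧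
      P'.sgn (S.param ε 0 u) (S.param ε 1 u) =
        J * (ε 0 : ℤ) * (ε 1 : ℤ) * if d < 0 then -1 else 1 := by
    intro u hu hgu
    obtain ⟨w, hw, -⟩ := hP'.exists_hasDerivAt 0 hu
    obtain ⟨w', hw', -⟩ := hP'.exists_hasDerivAt 1 hu
    have h0 := hP'.sgn_eq hJ hJ' (i := 0) (j := 1) hu hu (by simp [hgu]) (by simp) hw hw'
    have e1 : w = (1, 0) := hw.unique ((hasDerivAt_id u).prodMk (hasDerivAt_const u (0 : ℝ)))
    have e2 : HasDerivAt g w'.2 u := hw'.snd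
    rw [e1] at h0
    simp only [one_mul, zero_mul, sub_zero] at h0
    exact ⟨w'.2, e2, h0.1, h0.2⟩
  obtain ⟨d, hd, hd0, hs⟩ := hsgn p hp hpz.2
  obtain ⟨d', hd', hd0', hs'⟩ := hsgn q hq hqz.2
  have hc : ContinuousOn g (Icc (-1) 1) := (hP'.continuousOn 1).snd
  -- `g` is positive at both ends of the strand, so it falls at its first zero and rises at its last
  -- one; the latter is seen after reflecting the parameter.
  have h1 : d < 0 := by
    refine hd.neg_of_first_zero hp.1 (hc.mono (Icc_subset_Icc_right hp.2.le)) (fun u hu h0 => ?_) hgl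
      hpz.2 hd0
    have := (hz' u ⟨hu.1, hu.2.le.trans hp.2.le⟩).1 h0
    rcases this with rfl | rfl
    · exact lt_irrefl _ hu.2
    · exact hu.2.not_gt hpq
  have h2 : -d' < 0 := by
    have h3 : HasDerivAt (fun u => g (-u)) (-d') (-q) := by
      have h4 : HasDerivAt g d' (-(-q)) := by rwa [neg_neg]
      simpa [Function.comp_def] using h4.scomp (-q) (hasDerivAt_neg (-q))
    refine h3.neg_of_first_zero (a := -1) (neg_lt_neg hq.2) ?_ (fun u hu h0 => ?_)
      (by simpa using hgr) (by simpa using hqz.2) (neg_ne_zero.2 hd0')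
    · refine hc.comp continuous_neg.continuousOn fun u hu => ?_
      constructor <;> linarith [hu.1, hu.2, hq.1]
    · have := (hz' (-u) ⟨by linarith [hu.2, hq.1], by linarith [hu.1]⟩).1 h0
      rcases this with h4 | h4 <;> linarith [hu.2]
  rw [if_pos h1] at hs
  rw [if_neg (by linarith)] at hs'
  have : ∀ b, P'.sgn (markParam S ε y 0 b) (markParam S ε y 1 b) =
      if (b == decide (ε 1 = 1)) then J * (ε 0 : ℤ) * (ε 1 : ℤ) * 1 else
        J * (ε 0 : ℤ) * (ε 1 : ℤ) * -1 := by
    intro b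
    rw [markParam, markParam, hε]
    cases h : (b == decide (ε 1 = 1))
    · simpa [hy, hε] using hs
    · simpa [hy, hε] using hs'
  rw [this, this]
  rcases Int.units_eq_one_or (ε 1) with h | h <;> simp [h]

/-- The marks on three strands that cross at the parameters `0`, `a` and `b`. -/
noncomputable def triangleMark (a b : ℝ) (E : Bool) : Fin 3 → Bool → ℝ :=
  ![fun t => if t = E then 0 else a, fun t => if t = E then b else 0,
    fun t => if t = E then b else a]

/-- The strands of the move RIII. -/
noncomputable def triangleStrands (h : ℝ → ℝ) : Fin 3 → ℝ → ℝ × ℝ :=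
  ![fun u => (u, u / 2), fun u => (u, -(u / 2)), fun u => (u, h u)]

section

variable {Φ : SphereChart} {S : Strands 3} {ε : Fin 3 → ℤˣ} {h : ℝ → ℝ} {Q : SphericalCurve}
  {a b : ℝ}

theorem triangleStrands_eq_iff (ha : ∀ u ∈ Icc (-1 : ℝ) 1, (h u = u / 2 ↔ u = a))
    (hb : ∀ u ∈ Icc (-1 : ℝ) 1, (h u = -(u / 2) ↔ u = b)) (E : Bool) {i j : Fin 3} {u v : ℝ}
    (hu : u ∈ Icc (-1 : ℝ) 1) (hv : v ∈ Icc (-1 : ℝ) 1) :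
    triangleStrands h i u = triangleStrands h j v ∧ ¬ (i = j ∧ u = v) ↔
      ∃ t t', TriangleRel (fun _ => E) (i, t) (j, t') ∧
        triangleMark a b E i t = u ∧ triangleMark a b E j t' = v := by
  have h0 : ∀ u : ℝ, u / 2 = -(u / 2) ↔ u = 0 := fun u => by
    constructor
    · intro h
      linarith
    · rintro rfl
      simp
  have ha := ha u hu
  have hb := hb u hu
  have h0 := h0 u
  cases E <;> fin_cases i <;> fin_cases j <;>
    simp [triangleStrands, triangleMark, TriangleRel] <;> grind

theorem OnStrands.triangle_picture (hQ : OnStrands Φ S ε (triangleStrands h) Q)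
    (ha : ∀ u ∈ Icc (-1 : ℝ) 1, (h u = u / 2 ↔ u = a))
    (hb : ∀ u ∈ Icc (-1 : ℝ) 1, (h u = -(u / 2) ↔ u = b)) (ha' : a ∈ Ioo (-1 : ℝ) 1)
    (hb' : b ∈ Ioo (-1 : ℝ) 1) (E : Bool) (hE : if E then a < 0 ∧ 0 < b else b < 0 ∧ 0 < a) :
    Picture Q S (markParam S ε (triangleMark a b E)) (TriangleRel fun i => decide (ε i = 1) == E) := by
  refine (hQ.picture (y := triangleMark a b E) (rel := TriangleRel fun _ => E) ?_ ?_ ?_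
    fun i j u hu v hv => triangleStrands_eq_iff ha hb E hu hv).congr ?_
  · intro i
    cases E <;> fin_cases i <;> simp [triangleMark, ha'.1, hb'.1]
  · intro i
    cases E <;> simp at hE <;> fin_cases i <;> simp [triangleMark] <;> linarith
  · intro i
    cases E <;> fin_cases i <;> simp [triangleMark, ha'.2, hb'.2]
  · rintro ⟨i, t⟩ ⟨j, t'⟩
    generalize hd : (fun i => decide (ε i = 1)) = d
    have hd' : ∀ i, decide (ε i = 1) = d i := fun i => congrFun hd i
    simp only [hd']
    clear hd hd' hE
    fin_cases i <;> fin_cases j <;> simp [TriangleRel] <;>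
      cases E <;> cases t <;> cases t' <;> cases d 0 <;> cases d 1 <;> cases d 2 <;> simp

/-- The third strand starts between the two lines on the left and ends between them on the right, so
it crosses the line of slope `1/2` from above and that of slope `-1/2` from below. These directions,
hence the signs, do not depend on the side on which it passes the origin. -/
theorem OnStrands.triangle_sgn (hQ : OnStrands Φ S ε (triangleStrands h) Q)
    (ha : ∀ u ∈ Icc (-1 : ℝ) 1, (h u = u / 2 ↔ u = a))
    (hb : ∀ u ∈ Icc (-1 : ℝ) 1, (h u = -(u / 2) ↔ u = b)) (ha' : a ∈ Ioo (-1 : ℝ) 1)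
    (hb' : b ∈ Ioo (-1 : ℝ) 1) (hl : |h (-1)| < 1 / 2) {J : ℤ} (hJ : J = 1 ∨ J = -1)
    (hJ' : ∀ x, 0 < (J : ℝ) * Φ.jac x) :
    Q.sgn (S.param ε 0 0) (S.param ε 1 0) = -J * (ε 0 : ℤ) * (ε 1 : ℤ) ∧
    Q.sgn (S.param ε 0 a) (S.param ε 2 a) = -J * (ε 0 : ℤ) * (ε 2 : ℤ) ∧
    Q.sgn (S.param ε 1 b) (S.param ε 2 b) = J * (ε 1 : ℤ) * (ε 2 : ℤ) := by
  have hl := abs_lt.1 hl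
  have hc : ContinuousOn h (Icc (-1) 1) := (hQ.continuousOn 2).snd
  have w0 : ∀ u, HasDerivAt (triangleStrands h 0) (1, 1 / 2) u := fun u =>
    (hasDerivAt_id u).prodMk ((hasDerivAt_id u).div_const 2)
  have w1 : ∀ u, HasDerivAt (triangleStrands h 1) (1, -(1 / 2)) u := fun u =>
    (hasDerivAt_id u).prodMk ((hasDerivAt_id u).div_const 2).neg
  have w2 : ∀ u ∈ Ioo (-1 : ℝ) 1, ∃ d, HasDerivAt h d u ∧
      HasDerivAt (triangleStrands h 2) (1, d) u := by
    intro u hu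
    obtain ⟨w, hw, -⟩ := hQ.exists_hasDerivAt 2 hu
    have e2 : HasDerivAt h w.2 u := hw.snd
    exact ⟨w.2, e2, (hasDerivAt_id u).prodMk e2⟩
  refine ⟨?_, ?_, ?_⟩
  · rw [(hQ.sgn_eq hJ hJ' (i := 0) (j := 1) (u := 0) (v := 0) (by simp) (by simp)
      (by simp [triangleStrands]) (by simp) (w0 0) (w1 0)).2, if_pos (by norm_num)]
    ring
  · obtain ⟨d, hd, hd2⟩ := w2 a ha'
    have haI := Ioo_subset_Icc_self ha'
    have haz := (ha a haI).2 rfl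
    have h1 := hQ.sgn_eq hJ hJ' (i := 0) (j := 2) ha' ha' (by simp [triangleStrands, haz])
      (by simp) (w0 a) hd2
    have h2 : d - 1 / 2 < 0 := by
      refine (hd.sub ((hasDerivAt_id a).div_const 2)).neg_of_first_zero ha'.1 ?_ ?_ ?_ ?_ ?_
      · exact (hc.sub (by fun_prop)).mono (Icc_subset_Icc_right ha'.2.le)
      · intro u hu h0
        exact hu.2.ne ((ha u ⟨hu.1, hu.2.le.trans ha'.2.le⟩).1 (sub_eq_zero.1 h0))
      · simp
        linarith
      · simp [haz]
      · intro h0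
        apply h1.1
        simp only
        linarith
    rw [h1.2, if_pos (by simp only; linarith)]
    ring
  · obtain ⟨d, hd, hd2⟩ := w2 b hb'
    have hbI := Ioo_subset_Icc_self hb'
    have hbz := (hb b hbI).2 rfl
    have h1 := hQ.sgn_eq hJ hJ' (i := 1) (j := 2) hb' hb' (by simp [triangleStrands, hbz])
      (by simp) (w1 b) hd2
    have h2 : -(d + 1 / 2) < 0 := by
      refine (hd.add ((hasDerivAt_id b).div_const 2)).neg.neg_of_first_zero hb'.1 ?_ ?_ ?_ ?_ ?_
      · exact (hc.add (by fun_prop)).neg.mono (Icc_subset_Icc_right hb'.2.le)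
      · intro u hu h0
        refine hu.2.ne ((hb u ⟨hu.1, hu.2.le.trans hb'.2.le⟩).1 ?_)
        simp at h0
        linarith
      · simp
        linarith
      · simp [hbz]
      · intro h0
        apply h1.1
        simp only
        linarith
    rw [h1.2, if_neg (by simp only; linarith)]
    ring

end

/-- A crossing of the graph of `h` with a line through the origin. -/
theorem exists_crossing {k : ℝ → ℝ} (hc : ContinuousOn k (Icc (-1) 1)) (hl : 0 < k (-1))
    (hr : k 1 < 0) (hk : ∃! u, u ∈ Icc (-1 : ℝ) 1 ∧ k u = 0) :
    ∃ a ∈ Ioo (-1 : ℝ) 1, (∀ u ∈ Icc (-1 : ℝ) 1, k u = 0 ↔ u = a) ∧ (k 0 < 0 → a < 0) ∧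
      (0 < k 0 → 0 < a) := by
  obtain ⟨a, ⟨ha, ha0⟩, hu⟩ := hk
  refine ⟨a, mem_Ioo_of_eq_zero ha hl.ne' hr.ne ha0, fun u h => ⟨fun h' => hu u ⟨h, h'⟩, ?_⟩,
    fun h0 => ?_, fun h0 => ?_⟩
  · rintro rfl
    exact ha0
  · obtain ⟨v, hv, hv0⟩ := intermediate_value_Ioo' (by norm_num : (-1 : ℝ) ≤ 0)
      (hc.mono (Icc_subset_Icc_right zero_le_one)) ⟨h0, hl⟩
    rw [← hu v ⟨⟨hv.1.le, by linarith [hv.2]⟩, hv0⟩]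
    exact hv.2
  · obtain ⟨v, hv, hv0⟩ := intermediate_value_Ioo' (zero_le_one' ℝ)
      (hc.mono (Icc_subset_Icc_left (by norm_num))) ⟨hr, h0⟩
    rw [← hu v ⟨⟨by linarith [hv.1], hv.2.le⟩, hv0⟩]
    exact hv.1

theorem LocalWeakRIII.exists_base {P P' : SphericalCurve} (h : LocalWeakRIII P P') :
    ∃ b, P.IsBase b ∧ P'.IsBase b ∧
      ((P.xTotal b < P'.xTotal b ∧ P'.mu b = P.mu b - 2) ∨
        (P'.xTotal b < P.xTotal b ∧ P.mu b = P'.mu b - 2)) ∧ P'.kappa = P.kappa := by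
  obtain ⟨Φ, ε, f, g, hfg, hf0, hg0, hε, hrep⟩ := h
  have hsq : ∀ h : ℝ → ℝ, (∀ u ∈ Icc (-1 : ℝ) 1, |h u| < 1) → ∀ i, ∀ u ∈ Icc (-1 : ℝ) 1,
      triangleStrands h i u ∈ closedSquare := by
    intro h hh i u hu
    have h1 := abs_lt.1 (hh u hu)
    have h2 := hu.1
    have h3 := hu.2
    refine ⟨?_, ?_⟩ <;> fin_cases i <;> constructor <;> simp [triangleStrands] <;> linarith
  obtain ⟨hf, hfl, hfr, hfa, hfb⟩ := hfg f (by simp)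
  obtain ⟨hg, hgl, hgr, hga, hgb⟩ := hfg g (by simp)
  obtain ⟨S, hS, hP, hP', hout, -⟩ :=
    IsLocalReplacement.exists_strands (β := triangleStrands f) (β' := triangleStrands g) hrep
      (hsq f hf) fun _ => hsq g hg
  obtain ⟨J, hJ, hJ'⟩ := Φ.exists_orientation
  have cross : ∀ {h : ℝ → ℝ} {Q : SphericalCurve}, OnStrands Φ S ε (triangleStrands h) Q →
      |h (-1)| < 1 / 2 → |h 1| < 1 / 2 → (∃! u, u ∈ Icc (-1 : ℝ) 1 ∧ h u = u / 2) →
      (∃! u, u ∈ Icc (-1 : ℝ) 1 ∧ h u = -(u / 2)) → ∃ a ∈ Ioo (-1 : ℝ) 1, ∃ b ∈ Ioo (-1 : ℝ) 1,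
      (∀ u ∈ Icc (-1 : ℝ) 1, (h u = u / 2 ↔ u = a)) ∧
      (∀ u ∈ Icc (-1 : ℝ) 1, (h u = -(u / 2) ↔ u = b)) ∧ (h 0 < 0 → a < 0 ∧ 0 < b) ∧
      (0 < h 0 → b < 0 ∧ 0 < a) := by
    intro h Q hQ hl hr ha hb
    have hc : ContinuousOn h (Icc (-1) 1) := (hQ.continuousOn 2).snd
    rw [abs_lt] at hl hr
    have e1 : ∀ u, h u - u / 2 = 0 ↔ h u = u / 2 := fun u => sub_eq_zero
    have e2 : ∀ u, -(h u + u / 2) = 0 ↔ h u = -(u / 2) := fun u => by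
      rw [neg_eq_zero, add_eq_zero_iff_eq_neg]
    obtain ⟨a, ha1, ha2, ha3, ha4⟩ := exists_crossing (k := fun u => h u - u / 2)
      (hc.sub (by fun_prop)) (by linarith) (by linarith) (by simpa only [e1] using ha)
    -- The sign is changed in order to have again a function that is positive at the left end and
    -- negative at the right end.
    obtain ⟨b, hb1, hb2, hb3, hb4⟩ := exists_crossing (k := fun u => -(h u + u / 2))
      (hc.add (by fun_prop)).neg (by linarith) (by linarith) (by simpa only [e2] using hb)
    simp only [e1, e2] at ha2 hb2
    exact ⟨a, ha1, b, hb1, ha2, hb2, fun h0 => ⟨ha3 (by simpa using h0), hb4 (by simpa using h0)⟩,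
      fun h0 => ⟨hb3 (by simpa using h0), ha4 (by simpa using h0)⟩⟩
  obtain ⟨a, ha, b, hb, hza, hzb, h1, -⟩ := cross hP hfl hfr hfa hfb
  obtain ⟨a', ha', b', hb', hza', hzb', -, h1'⟩ := cross hP' hgl hgr hga hgb
  have pic := hP.triangle_picture hza hzb ha hb true (by simpa using h1 hf0)
  have pic' := hP'.triangle_picture hza' hzb' ha' hb' false (by simpa using h1' hg0)
  obtain ⟨s1, s2, s3⟩ := hP.triangle_sgn hza hzb ha hb hfl hJ hJ'
  obtain ⟨s1', s2', s3'⟩ := hP'.triangle_sgn hza' hzb' ha' hb' hgl hJ hJ'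
  set E : Fin 3 → Bool := fun i => decide (ε i = 1) with hE
  have r1 : (fun i => decide (ε i = 1) == true) = E := by
    ext i
    simp [hE]
  have r2 : (fun i => decide (ε i = 1) == false) = fun i => !E i := by
    ext i
    simp [hE]
  rw [r1] at pic
  rw [r2] at pic'
  refine ⟨_, pic.isBase, pic'.isBase, change_of_triangle hS ?_ pic pic' hout hJ
    (e := fun i => (ε i : ℤ)) ?_ ?_ ?_ ?_ ?_ ?_ ?_⟩
  · rintro ⟨h2, h3⟩
    apply hε
    simp only [hE] at h2 h3
    rcases Int.units_eq_one_or (ε 0) with k0 | k0 <;>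
      rcases Int.units_eq_one_or (ε 1) with k1 | k1 <;>
      rcases Int.units_eq_one_or (ε 2) with k2 | k2 <;> simp [k0, k1, k2] at h2 h3 ⊢
  · intro i
    rcases Int.units_eq_one_or (ε i) with k | k <;> simp [hE, k]
  · simpa [markParam, triangleMark, hE] using s1
  · simpa [markParam, triangleMark, hE] using s2
  · simpa [markParam, triangleMark, hE] using s3
  · simpa [markParam, triangleMark, hE] using s1'
  · simpa [markParam, triangleMark, hE] using s2'
  · simpa [markParam, triangleMark, hE] using s3'

/-! ### Two examples -/

section Spiral

/-- A curve winding `n` times around an axis, with height `h`. -/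
noncomputable def spiralVec (n : ℕ) (h : ℝ → ℝ) (t : ℝ) : E3 :=
  Real.cos (2 * Real.pi * n * t) • EuclideanSpace.single 0 (1 : ℝ) +
    Real.sin (2 * Real.pi * n * t) • EuclideanSpace.single 1 (1 : ℝ) +
    h t • EuclideanSpace.single 2 (1 : ℝ)

noncomputable def spiralScale (h : ℝ → ℝ) (t : ℝ) : ℝ := (√(1 + h t ^ 2))⁻¹

variable {n : ℕ} {h h' : ℝ → ℝ}

theorem spiralVec_apply (t : ℝ) : spiralVec n h t 0 = Real.cos (2 * Real.pi * n * t) ∧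
    spiralVec n h t 1 = Real.sin (2 * Real.pi * n * t) ∧ spiralVec n h t 2 = h t := by
  simp [spiralVec]

theorem spiralScale_pos (t : ℝ) : 0 < spiralScale h t := by
  unfold spiralScale
  positivity

theorem norm_spiral (t : ℝ) : ‖spiralScale h t • spiralVec n h t‖ = 1 := by
  have h1 : ‖spiralVec n h t‖ = √(1 + h t ^ 2) := by
    obtain ⟨e0, e1, e2⟩ := spiralVec_apply (n := n) (h := h) t
    rw [EuclideanSpace.norm_eq, Fin.sum_univ_three, e0, e1, e2]
    congr 1
    simp only [Real.norm_eq_abs, sq_abs, Real.cos_sq_add_sin_sq]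
  rw [norm_smul, h1, Real.norm_of_nonneg (spiralScale_pos t).le, spiralScale]
  exact inv_mul_cancel₀ (by positivity)

theorem contDiff_spiral (hs : ContDiff ℝ ∞ h) :
    ContDiff ℝ ∞ fun t => spiralScale h t • spiralVec n h t := by
  have h1 : ContDiff ℝ ∞ (spiralScale h) := by
    unfold spiralScale
    refine ContDiff.inv (ContDiff.sqrt (by fun_prop) fun t => by positivity) fun t => by positivity
  have h2 : ContDiff ℝ ∞ (spiralVec n h) := by
    unfold spiralVec
    fun_prop
  exact h1.smul h2

/-- The velocity of `spiralVec`. -/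
noncomputable def spiralVel (n : ℕ) (h' : ℝ → ℝ) (t : ℝ) : E3 :=
  (-Real.sin (2 * Real.pi * n * t) * (2 * Real.pi * n)) • EuclideanSpace.single 0 (1 : ℝ) +
    (Real.cos (2 * Real.pi * n * t) * (2 * Real.pi * n)) • EuclideanSpace.single 1 (1 : ℝ) +
    h' t • EuclideanSpace.single 2 (1 : ℝ)

theorem spiralVel_apply (t : ℝ) :
    spiralVel n h' t 0 = -Real.sin (2 * Real.pi * n * t) * (2 * Real.pi * n) ∧
    spiralVel n h' t 1 = Real.cos (2 * Real.pi * n * t) * (2 * Real.pi * n) ∧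
    spiralVel n h' t 2 = h' t := by
  simp [spiralVel]

theorem hasDerivAt_spiralVec (hd : ∀ t, HasDerivAt h (h' t) t) (t : ℝ) :
    HasDerivAt (spiralVec n h) (spiralVel n h' t) t := by
  have h1 : HasDerivAt (fun t : ℝ => 2 * Real.pi * n * t) (2 * Real.pi * n) t := by
    simpa using (hasDerivAt_id t).const_mul (2 * Real.pi * n)
  exact ((h1.cos.smul_const _).add (h1.sin.smul_const _)).add ((hd t).smul_const _)

theorem deriv_spiral (hs : ContDiff ℝ ∞ h) (hd : ∀ t, HasDerivAt h (h' t) t) (t : ℝ) :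
    deriv (fun t => spiralScale h t • spiralVec n h t) t =
      spiralScale h t • spiralVel n h' t + deriv (spiralScale h) t • spiralVec n h t := by
  have h1 : ContDiff ℝ ∞ (spiralScale h) := by
    unfold spiralScale
    refine ContDiff.inv (ContDiff.sqrt (by fun_prop) fun t => by positivity) fun t => by positivity
  have h2 : HasDerivAt (spiralScale h) (deriv (spiralScale h) t) t :=
    (h1.differentiable (by simp) t).hasDerivAt
  exact (h2.smul (hasDerivAt_spiralVec hd t)).deriv

/-- Points on the cylinder of radius 1 are determined by their radial projections: the distance of
the projection from the axis is the scale factor. -/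
theorem spiral_eq_iff {s t : ℝ} :
    spiralScale h s • spiralVec n h s = spiralScale h t • spiralVec n h t ↔
      (∃ k : ℤ, n * s = n * t + k) ∧ h s = h t := by
  obtain ⟨e0, e1, e2⟩ := spiralVec_apply (n := n) (h := h) s
  obtain ⟨f0, f1, f2⟩ := spiralVec_apply (n := n) (h := h) t
  have hps := spiralScale_pos (h := h) s
  have hpt := spiralScale_pos (h := h) t
  constructor
  · intro he
    have g0 := congrArg (fun v : E3 => v 0) he
    have g1 := congrArg (fun v : E3 => v 1) he
    have g2 := congrArg (fun v : E3 => v 2) he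
    simp only [PiLp.smul_apply, smul_eq_mul, e0, e1, e2, f0, f1, f2] at g0 g1 g2
    have h1 := Real.cos_sq_add_sin_sq (2 * Real.pi * n * s)
    have h2 := Real.cos_sq_add_sin_sq (2 * Real.pi * n * t)
    have h3 : spiralScale h s ^ 2 = spiralScale h t ^ 2 := by
      linear_combination (-spiralScale h s ^ 2) * h1 + spiralScale h t ^ 2 * h2 +
        (spiralScale h s * Real.cos (2 * Real.pi * n * s) +
          spiralScale h t * Real.cos (2 * Real.pi * n * t)) * g0 +
        (spiralScale h s * Real.sin (2 * Real.pi * n * s) +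
          spiralScale h t * Real.sin (2 * Real.pi * n * t)) * g1
    have h4 : spiralScale h s = spiralScale h t := (sq_eq_sq₀ hps.le hpt.le).1 h3
    rw [h4] at g0 g1 g2
    have h5 := Real.Angle.cos_sin_inj (mul_left_cancel₀ hpt.ne' g0) (mul_left_cancel₀ hpt.ne' g1)
    obtain ⟨k, hk⟩ := Real.Angle.angle_eq_iff_two_pi_dvd_sub.1 h5
    refine ⟨⟨k, ?_⟩, mul_left_cancel₀ hpt.ne' g2⟩
    have h6 : (2 * Real.pi) * (n * s) = (2 * Real.pi) * (n * t + k) := by linear_combination hk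
    exact mul_left_cancel₀ (by positivity) h6
  · rintro ⟨⟨k, hk⟩, hh⟩
    have h1 : 2 * Real.pi * n * s = 2 * Real.pi * n * t + k * (2 * Real.pi) := by
      linear_combination (2 * Real.pi) * hk
    rw [spiralScale, spiralScale, spiralVec, spiralVec, h1, Real.cos_add_int_mul_two_pi,
      Real.sin_add_int_mul_two_pi, hh]

/-- The two velocities have the same angular part and differ in the slope of the height and in
radial components, which the determinant ignores. -/
theorem tripleDet_spiral (hs : ContDiff ℝ ∞ h) (hd : ∀ t, HasDerivAt h (h' t) t) {s t : ℝ} {k : ℤ}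
    (hk : n * s = n * t + k) (hh : h s = h t) :
    tripleDet (spiralScale h s • spiralVec n h s)
      (deriv (fun t => spiralScale h t • spiralVec n h t) s)
      (deriv (fun t => spiralScale h t • spiralVec n h t) t) =
    spiralScale h t ^ 3 * (2 * Real.pi * n) * (h' t - h' s) := by
  have h1 : 2 * Real.pi * n * s = 2 * Real.pi * n * t + k * (2 * Real.pi) := by
    linear_combination (2 * Real.pi) * hk
  obtain ⟨e0, e1, e2⟩ := spiralVec_apply (n := n) (h := h) s
  obtain ⟨f0, f1, f2⟩ := spiralVec_apply (n := n) (h := h) t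
  obtain ⟨u0, u1, u2⟩ := spiralVel_apply (n := n) (h' := h') s
  obtain ⟨v0, v1, v2⟩ := spiralVel_apply (n := n) (h' := h') t
  have hsc : spiralScale h s = spiralScale h t := by rw [spiralScale, spiralScale, hh]
  rw [deriv_spiral hs hd, deriv_spiral hs hd, tripleDet_eq, hsc]
  simp only [PiLp.smul_apply, PiLp.add_apply, smul_eq_mul, e0, e1, e2, f0, f1, f2, u0, u1, u2, v0, v1,
    v2, h1, Real.cos_add_int_mul_two_pi, Real.sin_add_int_mul_two_pi, hh]
  linear_combination (spiralScale h t ^ 3 * (2 * Real.pi * n) * (h' t - h' s)) *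
    Real.cos_sq_add_sin_sq (2 * Real.pi * n * t)

/-- The spherical curve obtained by radial projection. -/
noncomputable def spiral (n : ℕ) (h h' : ℝ → ℝ) (hn : 0 < n) (hs : ContDiff ℝ ∞ h)
    (hd : ∀ t, HasDerivAt h (h' t) t) (hp : ∀ t, h (t + 1) = h t)
    (htr : ∀ (s t : ℝ) (k : ℤ), n * s = n * t + k → h s = h t → ¬ SameParam s t → h' s ≠ h' t)
    (h3 : ∀ (r s t : ℝ) (k l : ℤ), n * r = n * s + k → n * s = n * t + l → h r = h s → h s = h t →
      SameParam r s ∨ SameParam s t ∨ SameParam r t) : SphericalCurve where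
  toFun t := spiralScale h t • spiralVec n h t
  smooth := contDiff_spiral hs
  periodic t := spiral_eq_iff.2 ⟨⟨n, by push_cast; ring⟩, hp t⟩
  norm_eq_one := norm_spiral
  immersion t h0 := by
    rw [deriv_spiral hs hd] at h0
    obtain ⟨f0, f1, -⟩ := spiralVec_apply (n := n) (h := h) t
    obtain ⟨v0, v1, -⟩ := spiralVel_apply (n := n) (h' := h') t
    have g0 := congrArg (fun v : E3 => v 0) h0
    have g1 := congrArg (fun v : E3 => v 1) h0
    simp only [PiLp.smul_apply, PiLp.add_apply, smul_eq_mul, f0, f1, v0, v1, PiLp.zero_apply]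
      at g0 g1
    have h1 : spiralScale h t * (2 * Real.pi * n) = 0 := by
      linear_combination Real.cos (2 * Real.pi * n * t) * g1 - Real.sin (2 * Real.pi * n * t) * g0 -
        spiralScale h t * (2 * Real.pi * n) * Real.cos_sq_add_sin_sq (2 * Real.pi * n * t)
    have h2 := spiralScale_pos (h := h) t
    have h3 : 0 < (n : ℝ) := by exact_mod_cast hn
    exact absurd h1 (by positivity)
  transverse s t he hst := by
    obtain ⟨⟨k, hk⟩, hh⟩ := spiral_eq_iff.1 he
    refine linearIndependent_of_tripleDet_ne_zero (n := spiralScale h s • spiralVec n h s) ?_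
    rw [tripleDet_spiral hs hd hk hh]
    have h2 := spiralScale_pos (h := h) t
    have h3 : 0 < (n : ℝ) := by exact_mod_cast hn
    exact mul_ne_zero (by positivity) (sub_ne_zero.2 (htr s t k hk hh hst).symm)
  no_triple r s t he he' := by
    obtain ⟨⟨k, hk⟩, hh⟩ := spiral_eq_iff.1 he
    obtain ⟨⟨l, hl⟩, hh'⟩ := spiral_eq_iff.1 he'
    exact h3 r s t k l hk hl hh hh'

end Spiral

/-! ### A great circle and a three-turn spiral. -/

/-- A great circle. -/
noncomputable def greatCircle : SphericalCurve :=
  spiral 1 (fun _ => 0) (fun _ => 0) one_pos contDiff_const (fun t => hasDerivAt_const t 0)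
    (fun _ => rfl)
    (fun s t k hk _ hst => absurd (SameParam.symm ⟨k, by simpa using hk⟩) hst)
    (fun r s t k l hk _ _ _ => Or.inl (SameParam.symm ⟨k, by simpa using hk⟩))

theorem not_isDoublePair_greatCircle (s t : ℝ) : ¬ greatCircle.IsDoublePair s t := by
  rintro ⟨h1, h2⟩
  obtain ⟨⟨k, hk⟩, -⟩ := spiral_eq_iff.1 h1
  exact h2 (SameParam.symm ⟨k, by simpa using hk⟩)

theorem greatCircle_kappa : 1 ≤ greatCircle.kappa ∧ greatCircle.IsBase 0 ∧
    greatCircle.mu 0 = greatCircle.kappa := by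
  have hb : greatCircle.IsBase 0 := fun ⟨s, hs⟩ => not_isDoublePair_greatCircle _ _ hs
  have hc : greatCircle.chords 0 = ∅ := by
    ext p
    rw [SphericalCurve.mem_chords_iff_isDoublePair]
    simp [not_isDoublePair_greatCircle]
  have hn : greatCircle.numDouble = 0 := by
    rw [SphericalCurve.numDouble_eq_card_chords hb, hc, Finset.card_empty]
  have hs : 0 < greatCircle.numSeifert := by
    have : Nonempty (Quot greatCircle.SeifertAdj) := ⟨greatCircle.circle 0⟩
    exact Nat.card_pos
  refine ⟨?_, hb, ?_⟩
  · rw [SphericalCurve.kappa, hn]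
    omega
  · rw [SphericalCurve.mu_eq, SphericalCurve.kappa, hc]
    simp [crossSum]

/-- Equal heights mean that `2 * t - 2 * s` or `2 * t + 2 * s` is an integer. The first, together
with the integrality of `3 * (s - t)`, would make `t - s` an integer. -/
theorem three_spiral_aux {s t : ℝ} {k : ℤ} (hk : 3 * s = 3 * t + k)
    (hh : Real.cos (4 * Real.pi * s) = Real.cos (4 * Real.pi * t)) (hst : ¬ SameParam s t) :
    (∃ l : ℤ, 2 * t = l - 2 * s) ∧ ¬ 3 ∣ k := by
  have hpi := Real.pi_pos
  constructor
  · obtain ⟨l, hl⟩ := Real.cos_eq_cos_iff.1 hh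
    rcases hl with hl | hl
    · have h1 : (2 * Real.pi) * (2 * t) = (2 * Real.pi) * (l + 2 * s) := by linear_combination hl
      have h2 := mul_left_cancel₀ (by positivity) h1
      refine absurd ⟨-k - l, ?_⟩ hst
      push_cast
      linarith
    · have h1 : (2 * Real.pi) * (2 * t) = (2 * Real.pi) * (l - 2 * s) := by linear_combination hl
      exact ⟨l, mul_left_cancel₀ (by positivity) h1⟩
  · rintro ⟨m, rfl⟩
    refine hst ⟨-m, ?_⟩
    push_cast at hk ⊢
    linarith

theorem hasDerivAt_cos_four_pi (t : ℝ) : HasDerivAt (fun t => Real.cos (4 * Real.pi * t))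
    (-Real.sin (4 * Real.pi * t) * (4 * Real.pi)) t := by
  have h1 : HasDerivAt (fun t : ℝ => 4 * Real.pi * t) (4 * Real.pi) t := by
    simpa using (hasDerivAt_id t).const_mul (4 * Real.pi)
  exact h1.cos

/-- A curve with four double points. -/
noncomputable def threeSpiral : SphericalCurve :=
  spiral 3 (fun t => Real.cos (4 * Real.pi * t))
    (fun t => -Real.sin (4 * Real.pi * t) * (4 * Real.pi)) (by norm_num) (by fun_prop)
    hasDerivAt_cos_four_pi
    (fun t => by
      have h1 : 4 * Real.pi * (t + 1) = 4 * Real.pi * t + (2 : ℤ) * (2 * Real.pi) := by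
        push_cast
        ring
      rw [h1, Real.cos_add_int_mul_two_pi])
    (fun s t k hk hh hst he => by
      obtain ⟨⟨l, hl⟩, hk3⟩ := three_spiral_aux (by simpa using hk) hh hst
      have hpi := Real.pi_pos
      have h1 : 4 * Real.pi * t = l * (2 * Real.pi) - 4 * Real.pi * s := by
        linear_combination (2 * Real.pi) * hl
      rw [h1, Real.sin_int_mul_two_pi_sub] at he
      -- Equal slopes force a horizontal tangent, hence `4 * s` to be an integer; this makes `2 * k`
      -- divisible by 3, against `three_spiral_aux`.
      have h2 : Real.sin (4 * Real.pi * s) = 0 := by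
        have h3 := mul_right_cancel₀ (by positivity) he
        linarith
      obtain ⟨m, hm⟩ := Real.sin_eq_zero_iff.1 h2
      have h3 : Real.pi * (4 * s) = Real.pi * m := by linear_combination -hm
      have h4 := mul_left_cancel₀ hpi.ne' h3
      have hk' : 3 * s = 3 * t + k := by simpa using hk
      have h5 : (2 * k : ℝ) = 3 * (m - l) := by linarith
      have h6 : 2 * k = 3 * (m - l) := by exact_mod_cast h5
      omega)
    (fun r s t k l hk hl h1 h2 => by
      by_contra! hne
      obtain ⟨⟨a, ha⟩, -⟩ := three_spiral_aux (by simpa using hk) h1 hne.1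
      obtain ⟨⟨b, hb⟩, -⟩ := three_spiral_aux (by simpa using hl) h2 hne.2.1
      have hk' : 3 * r = 3 * s + k := by simpa using hk
      have hl' : 3 * s = 3 * t + l := by simpa using hl
      -- Both `3 * (t - r)` and `2 * (t - r)` are integers, and this is their difference.
      refine hne.2.2 ⟨-k - l - b + a, ?_⟩
      push_cast
      linarith)

/-- The integers are `k = 3 * (s - t)` and `l = 2 * (s + t)`. The parameters of double points are
therefore twelfths whose numerators are not divisible by 3. -/
theorem isDoublePair_threeSpiral {s t : ℝ} : threeSpiral.IsDoublePair s t ↔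
    ∃ k l : ℤ, ¬ 3 ∣ k ∧ s = (3 * l + 2 * k) / 12 ∧ t = (3 * l - 2 * k) / 12 := by
  constructor
  · rintro ⟨h1, h2⟩
    obtain ⟨⟨k, hk⟩, hh⟩ := spiral_eq_iff.1 h1
    have hk' : 3 * s = 3 * t + k := by simpa using hk
    obtain ⟨⟨l, hl⟩, h3⟩ := three_spiral_aux hk' hh h2
    exact ⟨k, l, h3, by linarith, by linarith⟩
  · rintro ⟨k, l, h3, hs, ht⟩
    refine ⟨spiral_eq_iff.2 ⟨⟨k, by rw [hs, ht]; push_cast; ring⟩, ?_⟩, ?_⟩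
    · have h1 : 4 * Real.pi * s = l * (2 * Real.pi) - 4 * Real.pi * t := by
        rw [hs, ht]
        ring
      rw [h1, Real.cos_int_mul_two_pi_sub]
    · rintro ⟨n, hn⟩
      have h4 : (-k : ℝ) = 3 * n := by
        rw [hs, ht] at hn
        linarith
      have h5 : -k = 3 * n := by exact_mod_cast h4
      omega

theorem sgn_threeSpiral {s t : ℝ} (hst : threeSpiral.IsDoublePair s t) :
    threeSpiral.sgn s t = if Real.sin (4 * Real.pi * s) < 0 then -1 else 1 := by
  obtain ⟨k, l, -, hs, ht⟩ := isDoublePair_threeSpiral.1 hst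
  have hpi := Real.pi_pos
  have hρ := spiralScale_pos (h := fun t => Real.cos (4 * Real.pi * t)) t
  have h1 : 4 * Real.pi * t = l * (2 * Real.pi) - 4 * Real.pi * s := by
    rw [hs, ht]
    ring
  have h2 := hst.1
  obtain ⟨⟨k, hk⟩, hh⟩ := spiral_eq_iff.1 h2
  have h3 := tripleDet_spiral (by fun_prop) hasDerivAt_cos_four_pi hk hh
  rw [h1, Real.sin_int_mul_two_pi_sub] at h3
  rw [SphericalCurve.sgn]
  refine if_congr ?_ rfl rfl
  have h4 : tripleDet (threeSpiral.toFun s) (deriv threeSpiral.toFun s) (deriv threeSpiral.toFun t) =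
      (spiralScale (fun t => Real.cos (4 * Real.pi * t)) t ^ 3 * (48 * Real.pi ^ 2)) *
        Real.sin (4 * Real.pi * s) := by
    refine h3.trans ?_
    push_cast
    ring
  rw [h4]
  have h5 : 0 < spiralScale (fun t => Real.cos (4 * Real.pi * t)) t ^ 3 * (48 * Real.pi ^ 2) := by
    positivity
  exact ⟨fun h => not_le.1 fun h0 => h.not_ge (mul_nonneg h5.le h0), mul_neg_of_pos_of_neg h5⟩

theorem three_not_dvd_of_isDoubleParam {t : ℝ} (ht : threeSpiral.IsDoubleParam t) :
    ∃ j : ℤ, ¬ 3 ∣ j ∧ t = j / 12 := by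
  obtain ⟨s, hs⟩ := ht
  obtain ⟨k, l, h1, h2, -⟩ := isDoublePair_threeSpiral.1 hs
  exact ⟨3 * l + 2 * k, by omega, by rw [h2]; push_cast; ring⟩

theorem isBase_threeSpiral : threeSpiral.IsBase 0 := by
  intro h
  obtain ⟨j, h1, h2⟩ := three_not_dvd_of_isDoubleParam h
  have h3 : (j : ℝ) = 0 := by linarith
  have h4 : j = 0 := by exact_mod_cast h3
  omega

theorem chords_threeSpiral : threeSpiral.chords 0 =
    {(1 / 12, 5 / 12), (2 / 12, 10 / 12), (4 / 12, 8 / 12), (7 / 12, 11 / 12)} := by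
  ext ⟨s, t⟩
  rw [SphericalCurve.mem_chords_iff_isDoublePair, isDoublePair_threeSpiral]
  simp only [Finset.mem_insert, Finset.mem_singleton, Prod.mk.injEq]
  constructor
  · rintro ⟨h1, h2, h3, k, l, h4, rfl, rfl⟩
    have g1 : (0 : ℝ) < 3 * l + 2 * k := by linarith
    have g2 : (k : ℝ) < 0 := by linarith
    have g3 : (3 * l - 2 * k : ℝ) < 12 := by linarith
    have f1 : 0 < 3 * l + 2 * k := by exact_mod_cast g1
    have f2 : k < 0 := by exact_mod_cast g2
    have f3 : 3 * l - 2 * k < 12 := by exact_mod_cast g3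
    have f4 : (k = -1 ∧ l = 1) ∨ (k = -2 ∧ l = 2) ∨ (k = -1 ∧ l = 2) ∨ (k = -1 ∧ l = 3) := by omega
    rcases f4 with ⟨rfl, rfl⟩ | ⟨rfl, rfl⟩ | ⟨rfl, rfl⟩ | ⟨rfl, rfl⟩ <;> norm_num
  · rintro (⟨rfl, rfl⟩ | ⟨rfl, rfl⟩ | ⟨rfl, rfl⟩ | ⟨rfl, rfl⟩)
    · exact ⟨by norm_num, by norm_num, by norm_num, -1, 1, by norm_num, by norm_num, by norm_num⟩
    · exact ⟨by norm_num, by norm_num, by norm_num, -2, 2, by norm_num, by norm_num, by norm_num⟩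
    · exact ⟨by norm_num, by norm_num, by norm_num, -1, 2, by norm_num, by norm_num, by norm_num⟩
    · exact ⟨by norm_num, by norm_num, by norm_num, -1, 3, by norm_num, by norm_num, by norm_num⟩

theorem numDouble_threeSpiral : threeSpiral.numDouble = 4 := by
  rw [SphericalCurve.numDouble_eq_card_chords isBase_threeSpiral, chords_threeSpiral]
  rw [Finset.card_insert_of_notMem, Finset.card_insert_of_notMem, Finset.card_insert_of_notMem,
    Finset.card_singleton] <;> norm_num

/-- The chords starting at 1, 2, 7 twelfths have sign 1 and the one starting at 4 twelfths has sign
-1. Four pairs are interlaced: 1 with 2 and 2 with 7 give 1, while 1 with 4 and 4 with 7 give -1. -/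
theorem crossSum_threeSpiral :
    crossSum (threeSpiral.chords 0) (threeSpiral.chords 0) threeSpiral.chordSgn = 0 := by
  have hpi := Real.pi_pos
  have key : ∀ p ∈ threeSpiral.chords 0, threeSpiral.chordSgn p =
      if Real.sin (4 * Real.pi * p.1) < 0 then -1 else 1 := fun p hp =>
    sgn_threeSpiral (SphericalCurve.isDoublePair_of_mem_chords hp)
  have s1 : 0 < Real.sin (4 * Real.pi * (1 / 12)) :=
    Real.sin_pos_of_pos_of_lt_pi (by positivity) (by linarith)
  have s2 : 0 < Real.sin (4 * Real.pi * (2 / 12)) :=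
    Real.sin_pos_of_pos_of_lt_pi (by positivity) (by linarith)
  have s4 : Real.sin (4 * Real.pi * (4 / 12)) < 0 := by
    rw [show 4 * Real.pi * (4 / 12) = 4 * Real.pi * (1 / 12) + Real.pi by ring, Real.sin_add_pi]
    linarith
  have s7 : 0 < Real.sin (4 * Real.pi * (7 / 12)) := by
    rw [show 4 * Real.pi * (7 / 12) = 4 * Real.pi * (1 / 12) + 2 * Real.pi by ring,
      Real.sin_add_two_pi]
    exact s1
  rw [chords_threeSpiral] at key ⊢
  have k1 := key (1 / 12, 5 / 12) (by simp)
  have k2 := key (2 / 12, 10 / 12) (by simp)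
  have k4 := key (4 / 12, 8 / 12) (by simp)
  have k7 := key (7 / 12, 11 / 12) (by simp)
  rw [if_neg s1.not_gt] at k1
  rw [if_neg s2.not_gt] at k2
  rw [if_pos s4] at k4
  rw [if_neg s7.not_gt] at k7
  have hsum : ∀ F : ℝ × ℝ → ℤ, ∑ d ∈ ({(1 / 12, 5 / 12), (2 / 12, 10 / 12), (4 / 12, 8 / 12),
      (7 / 12, 11 / 12)} : Finset (ℝ × ℝ)), F d =
      F (1 / 12, 5 / 12) + (F (2 / 12, 10 / 12) + (F (4 / 12, 8 / 12) + F (7 / 12, 11 / 12))) := by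
    intro F
    rw [Finset.sum_insert (by norm_num), Finset.sum_insert (by norm_num),
      Finset.sum_insert (by norm_num), Finset.sum_singleton]
  unfold crossSum
  simp only [hsum, k1, k2, k4, k7, Interlaced]
  norm_num

theorem circle_threeSpiral_eq {a b : ℝ} (hab : ∀ j : ℤ, a < j → j < b → 3 ∣ j) {t u : ℝ}
    (ht : t ∈ Ioo (a / 12) (b / 12)) (hu : u ∈ Ioo (a / 12) (b / 12)) :
    threeSpiral.circle t = threeSpiral.circle u := by
  refine SphericalCurve.circle_eq_of_ordConnected ordConnected_Ioo (s := Ioo (a / 12) (b / 12))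
    (fun v hv hd => ?_) ht hu
  obtain ⟨j, h1, rfl⟩ := three_not_dvd_of_isDoubleParam hd
  exact h1 (hab j (by linarith [hv.1]) (by linarith [hv.2]))

theorem circle_threeSpiral_glue {a p q b : ℝ} (hap : ∀ j : ℤ, a < j → j < p → 3 ∣ j)
    (hqb : ∀ j : ℤ, q < j → j < b → 3 ∣ j) (hpq : threeSpiral.IsDoublePair (p / 12) (q / 12))
    {t u : ℝ} (ht : t ∈ Ioo (a / 12) (p / 12)) (hu : u ∈ Ioo (q / 12) (b / 12)) :
    threeSpiral.circle t = threeSpiral.circle u := by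
  obtain ⟨x, h1, h2⟩ := threeSpiral.seifertInv_circle.glue _ _ hpq
  obtain ⟨t', h3, h4⟩ := (h1.and (Ioo_mem_nhdsLT (ht.1.trans ht.2))).exists
  obtain ⟨u', h5, h6⟩ := (h2.and (Ioo_mem_nhdsGT (hu.1.trans hu.2))).exists
  rw [circle_threeSpiral_eq hap ht h4, h3, ← h5, circle_threeSpiral_eq hqb h6 hu]

/-- The eight arcs between double points fall into three groups; in twelfths: from -1 to 1 and 5 to
7; from 1 to 2, 4 to 5, 7 to 8 and 10 to 11; from 2 to 4 and 8 to 10. An upper bound is enough for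
comparison with the great circle. -/
theorem numSeifert_threeSpiral_le : threeSpiral.numSeifert ≤ 3 := by
  have hgap : ∀ a b : ℤ, (∀ j : ℤ, a < j → j < b → 3 ∣ j) →
      ∀ j : ℤ, (a : ℝ) < j → (j : ℝ) < b → 3 ∣ j := fun a b h j h1 h2 =>
    h j (by exact_mod_cast h1) (by exact_mod_cast h2)
  have g1 := hgap (-1) 1 (by omega)
  have g2 := hgap 1 2 (by omega)
  have g3 := hgap 2 4 (by omega)
  have g4 := hgap 4 5 (by omega)
  have g5 := hgap 5 7 (by omega)
  have g6 := hgap 7 8 (by omega)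
  have g7 := hgap 8 10 (by omega)
  have g8 := hgap 10 11 (by omega)
  push_cast at g1 g2 g3 g4 g5 g6 g7 g8
  let f : Fin 3 → Quot threeSpiral.SeifertAdj :=
    ![threeSpiral.circle 0, threeSpiral.circle (1 / 8), threeSpiral.circle (1 / 4)]
  have hf : Function.Surjective f := by
    intro x
    obtain ⟨t, ht, rfl⟩ := SphericalCurve.exists_circle_eq x
    obtain ⟨t', ht', n, rfl⟩ := SphericalCurve.exists_sameParam_mem_Ico (-1 / 12) t
    rw [← threeSpiral.seifertInv_circle.add_int ht n]
    have hd : ¬ threeSpiral.IsDoubleParam (t + n) := by rwa [SphericalCurve.isDoubleParam_add_int]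
    generalize t + (n : ℝ) = t at ht' hd
    have dp : ∀ (p q : ℝ) (k l : ℤ), ¬ 3 ∣ k → p = 3 * l + 2 * k → q = 3 * l - 2 * k →
        threeSpiral.IsDoublePair (p / 12) (q / 12) := by
      rintro p q k l h rfl rfl
      exact isDoublePair_threeSpiral.2 ⟨k, l, h, rfl, rfl⟩
    have d15 := dp 1 5 (-1) 1 (by norm_num) (by norm_num) (by norm_num)
    have d51 := dp 5 1 1 1 (by norm_num) (by norm_num) (by norm_num)
    have d48 := dp 4 8 (-1) 2 (by norm_num) (by norm_num) (by norm_num)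
    have d84 := dp 8 4 1 2 (by norm_num) (by norm_num) (by norm_num)
    have d210 := dp 2 10 (-2) 2 (by norm_num) (by norm_num) (by norm_num)
    have d711 := dp 7 11 (-1) 3 (by norm_num) (by norm_num) (by norm_num)
    have hlt : ∀ p : ℝ, threeSpiral.IsDoubleParam (p / 12) → t < p / 12 ∨ p / 12 < t := by
      intro p hp
      exact lt_or_gt_of_ne fun h => hd (h ▸ hp)
    have h45 : ∀ u ∈ Ioo (4 / 12 : ℝ) (5 / 12), threeSpiral.circle u = threeSpiral.circle (1 / 8) :=
      fun u hu => circle_threeSpiral_glue g4 g2 d51 hu ⟨by norm_num, by norm_num⟩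
    -- The period starts at a double point, so the first arc is open on the left.
    have h0 : -1 / 12 < t := by
      refine lt_of_le_of_ne ht'.1 fun h => hd ?_
      rw [← h]
      have := (dp (-1) (-5) 1 (-1) (by norm_num) (by norm_num) (by norm_num)).left
      exact this
    rcases hlt 1 d15.left with h1 | h1
    · exact ⟨0, circle_threeSpiral_eq g1 ⟨by norm_num, by norm_num⟩ ⟨h0, h1⟩⟩
    rcases hlt 2 d210.left with h2 | h2
    · exact ⟨1, circle_threeSpiral_eq g2 ⟨by norm_num, by norm_num⟩ ⟨h1, h2⟩⟩
    rcases hlt 4 d48.left with h4 | h4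
    · exact ⟨2, circle_threeSpiral_eq g3 ⟨by norm_num, by norm_num⟩ ⟨h2, h4⟩⟩
    rcases hlt 5 d15.right with h5 | h5
    · exact ⟨1, (h45 t ⟨h4, h5⟩).symm⟩
    rcases hlt 7 d711.left with h7 | h7
    · exact ⟨0, circle_threeSpiral_glue g1 g5 d15 ⟨by norm_num, by norm_num⟩ ⟨h5, h7⟩⟩
    rcases hlt 8 d48.right with h8 | h8
    · refine ⟨1, ((h45 (9 / 24) ⟨by norm_num, by norm_num⟩).symm.trans ?_)⟩
      exact (circle_threeSpiral_glue g6 g4 d84 ⟨h7, h8⟩ ⟨by norm_num, by norm_num⟩).symm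
    rcases hlt 10 d210.right with h10 | h10
    · exact ⟨2, circle_threeSpiral_glue g3 g7 d48 ⟨by norm_num, by norm_num⟩ ⟨h8, h10⟩⟩
    · refine ⟨1, circle_threeSpiral_glue g2 g8 d210 ⟨by norm_num, by norm_num⟩ ⟨h10, ?_⟩⟩
      linarith [ht'.2]
  have := Nat.card_le_card_of_surjective f hf
  simpa [SphericalCurve.numSeifert] using this

theorem threeSpiral_kappa : threeSpiral.kappa ≤ -1 ∧ threeSpiral.mu 0 = threeSpiral.kappa := by
  have h1 := numSeifert_threeSpiral_le
  constructor
  · rw [SphericalCurve.kappa, numDouble_threeSpiral]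
    omega
  · rw [SphericalCurve.mu_eq, SphericalCurve.kappa, crossSum_threeSpiral]
    ring

/-! ### The theorem. -/

theorem mainTheorem4 :
    -- `2 (x_u - x_l - x_r + x_b) + s - c` is well defined for spherical curves up to isotopy
    (∀ (P P' : SphericalCurve) (b b' : ℝ), P.IsBase b → P'.IsBase b' → P.Isotopic P' →
      P'.mu b' = P.mu b) ∧
    -- it is invariant under RI and weak RII
    (∀ (P P' : SphericalCurve) (b b' : ℝ), P.IsBase b → P'.IsBase b' → RI P P' →
      P'.mu b' = P.mu b) ∧
    (∀ (P P' : SphericalCurve) (b b' : ℝ), P.IsBase b → P'.IsBase b' → WeakRII P P' →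
      P'.mu b' = P.mu b) ∧
    -- every weak RIII changes `x`, and the one that increases `x` changes it by `-2`
    (∀ (P P' : SphericalCurve) (b b' : ℝ), P.IsBase b → P'.IsBase b' → WeakRIII P P' →
      (P.xTotal b < P'.xTotal b' ∧ P'.mu b' = P.mu b - 2) ∨
      (P'.xTotal b' < P.xTotal b ∧ P.mu b = P'.mu b' - 2)) ∧
    -- `s - c` is well defined up to isotopy, and invariant under RI and weak RIII
    (∀ P P' : SphericalCurve, P.Isotopic P' → P'.kappa = P.kappa) ∧
    (∀ P P' : SphericalCurve, RI P P' → P'.kappa = P.kappa) ∧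
    (∀ P P' : SphericalCurve, WeakRIII P P' → P'.kappa = P.kappa) ∧
    -- both invariants are non-trivial
    (∃ (P P' : SphericalCurve) (b b' : ℝ), P.IsBase b ∧ P'.IsBase b' ∧ P.mu b ≠ P'.mu b') ∧
    (∃ P P' : SphericalCurve, P.kappa ≠ P'.kappa) := by
  refine ⟨fun P P' b b' hb hb' h => h.sameInvariants.mu b b' hb hb', ?_, ?_, ?_,
    fun P P' h => h.sameInvariants.kappa, ?_, ?_, ?_, ?_⟩
  · rintro P P' b b' hb hb' ⟨Q, Q', h1, h2, h3⟩
    -- The local move supplies one base point common to both curves; isotopy invariance carries the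
    -- comparison to arbitrary base points.
    obtain ⟨d, hd, hd', hm, -⟩ := h2.exists_base
    rw [h3.sameInvariants.mu d b' hd' hb', hm, h1.sameInvariants.mu b d hb hd]
  · rintro P P' b b' hb hb' ⟨Q, Q', h1, h2, h3⟩
    obtain ⟨d, hd, hd', hm⟩ := h2.exists_base
    rw [h3.sameInvariants.mu d b' hd' hb', hm, h1.sameInvariants.mu b d hb hd]
  · rintro P P' b b' hb hb' ⟨Q, Q', h1, h2, h3⟩
    obtain ⟨d, hd, hd', hm, -⟩ := h2.exists_base
    rw [h3.sameInvariants.mu d b' hd' hb', h3.sameInvariants.xTotal d b' hd' hb',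
      ← h1.sameInvariants.mu b d hb hd, ← h1.sameInvariants.xTotal b d hb hd]
    exact hm
  · rintro P P' ⟨Q, Q', h1, h2, h3⟩
    obtain ⟨d, -, -, -, hk⟩ := h2.exists_base
    rw [h3.sameInvariants.kappa, hk, h1.sameInvariants.kappa]
  · rintro P P' ⟨Q, Q', h1, h2, h3⟩
    obtain ⟨d, -, -, -, hk⟩ := h2.exists_base
    rw [h3.sameInvariants.kappa, hk, h1.sameInvariants.kappa]
  · obtain ⟨h1, hb, h2⟩ := greatCircle_kappa
    obtain ⟨h3, h4⟩ := threeSpiral_kappa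
    exact ⟨greatCircle, threeSpiral, 0, 0, hb, isBase_threeSpiral, by omega⟩
  · have h1 := greatCircle_kappa.1
    have h2 := threeSpiral_kappa.1
    exact ⟨greatCircle, threeSpiral, by omega⟩
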